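/- Let $G$ be a finite group, let $S$ be a closed (compact, without boundary) connected oriented smooth surface, and let $\pi : P \to S$ be a $G$-cobordism over $S$, that is, a smooth principal $G$-bundle: a fiber bundle with fiber $G$ and a right $G$-action on $P$ that is free and transitive on each fiber, $P$ being a smooth surface and $\pi$ a local diffeomorphism. For $g \in G$ let $P_g \to S^1$ be the principal $G$-bundle obtained from $[0,1] \times G$ by identifying $(0,h)$ with $(1,gh)$ for every $h \in G$, with projection $[t,h] \mapsto e^{2\pi i t}$ and $G$ acting by right multiplication on the second coordinate. The bundle $\pi$ has monodromy $g$ along a closed curve $\gamma : S^1 \to S$ if the pullback $\gamma^*P$ is isomorphic to $P_g$ as a principal $G$-bundle over $S^1$. Let $\gamma : S^1 \to S$ be a smooth embedding such that $S \setminus \gamma(S^1)$ is not connected (an embedded simple closed separating curve). Then $\pi$ has a monodromy along $\gamma$, and every $g \in G$ that is a monodromy of $\pi$ along $\gamma$ lies in the commutator subgroup $[G,G]$. -/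

import Mathlib

open scoped Manifold ContDiff RightActions

noncomputable section

/-- A smooth orientation of a smooth surface, given as an oriented atlas: a family of smooth charts
that covers the surface and whose transition maps all have positive Jacobian determinant. -/
structure SmoothOrientation (S : Type*) [TopologicalSpace S]
    [ChartedSpace (EuclideanSpace ℝ (Fin 2)) S] where
  charts : Set (OpenPartialHomeomorph S (EuclideanSpace ℝ (Fin 2)))
  smooth : charts ⊆ IsManifold.maximalAtlas (𝓡 2) ∞ S
  cover : ∀ x : S, ∃ e ∈ charts, x ∈ e.source
  det_pos : ∀ e ∈ charts, ∀ e' ∈ charts, ∀ y ∈ (e.symm.trans e').source,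
    0 < (fderiv ℝ (e.symm.trans e') y).det

/-- A principal `G`-bundle `π : P → X` for a discrete group `G`: a fiber bundle with fiber `G`, with
a right action of `G` on `P` by continuous maps (`p <• g` is the right action of `g` on `p`) that
preserves the fibers and is free and transitive on each of them. -/
structure IsPrincipalBundle (G : Type*) [Group G] [TopologicalSpace G] {P X : Type*}
    [TopologicalSpace P] [TopologicalSpace X] [MulAction Gᵐᵒᵖ P] (π : P → X) : Prop where
  continuous_act : ∀ g : G, Continuous fun p : P => p <• g
  proj_act : ∀ (p : P) (g : G), π (p <• g) = π p
  free : ∀ (p : P) (g : G), p <• g = p → g = 1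
  transitive : ∀ p q : P, π p = π q → ∃ g : G, q = p <• g
  locallyTrivial : ∀ x : X, ∃ e : Bundle.Trivialization G π, x ∈ e.baseSet

/-- A `G`-cobordism over a surface `S` without boundary (`G` discrete): a smooth principal
`G`-bundle over `S`. The total space is a smooth surface, and, the fibers being discrete,
smoothness of the bundle means that the projection is a local diffeomorphism. -/
structure IsGCobordism (G : Type*) [Group G] [TopologicalSpace G] {P S : Type*}
    [TopologicalSpace P] [ChartedSpace (EuclideanSpace ℝ (Fin 2)) P]
    [TopologicalSpace S] [ChartedSpace (EuclideanSpace ℝ (Fin 2)) S]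
    [MulAction Gᵐᵒᵖ P] (π : P → S) : Prop extends IsPrincipalBundle G π where
  isLocalDiffeomorph : IsLocalDiffeomorph (𝓡 2) (𝓡 2) ∞ π

/-- The total space `P_g` of the principal `G`-bundle over the circle obtained from `[0,1] × G` by
identifying `(0, h)` with `(1, g * h)` for every `h`. It carries the quotient topology. -/
def CircleBundle {G : Type*} [Group G] (g : G) : Type _ :=
  Quot fun a b : unitInterval × G => ∃ h : G, a = (0, h) ∧ b = (1, g * h)

namespace CircleBundle

variable {G : Type*} [Group G] (g : G)

instance [TopologicalSpace G] : TopologicalSpace (CircleBundle g) :=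
  inferInstanceAs (TopologicalSpace (Quot _))

/-- The class of `(t, h)` in `P_g`. -/
def mk (a : unitInterval × G) : CircleBundle g := Quot.mk _ a

/-- The bundle projection of `P_g` onto the circle, `[t, h] ↦ exp (2 π i t)`. -/
def proj : CircleBundle g → Circle :=
  Quot.lift (fun a => Circle.exp (2 * Real.pi * (a.1 : ℝ))) <| by
    rintro _ _ ⟨h, rfl, rfl⟩
    simp

/-- The right action of `G` on `P_g`, `[t, h] <• k = [t, h * k]`. -/
instance : MulAction Gᵐᵒᵖ (CircleBundle g) where
  smul k := Quot.map (fun a => (a.1, a.2 * k.unop)) <| by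
    rintro _ _ ⟨h, rfl, rfl⟩
    exact ⟨h * k.unop, rfl, by simp [mul_assoc]⟩
  one_smul := by
    rintro ⟨t, h⟩
    exact congrArg (Quot.mk _) (by simp)
  mul_smul k l := by
    rintro ⟨t, h⟩
    exact congrArg (Quot.mk _) (by simp [mul_assoc])

end CircleBundle

/-- The bundle `π : P → X` has monodromy `g` along the closed curve `γ` in `X`: the pullback of
`π` along `γ` is isomorphic to `P_g`, by a `G`-equivariant homeomorphism over the circle. (The
monodromy of a curve is determined up to conjugation only, so this is a relation.) -/
def HasMonodromy {G : Type*} [Group G] [TopologicalSpace G] {P X : Type*}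
    [TopologicalSpace P] [MulAction Gᵐᵒᵖ P] (π : P → X) (γ : Circle → X) (g : G) : Prop :=
  ∃ Φ : CircleBundle g ≃ₜ {q : Circle × P // γ q.1 = π q.2},
    (∀ a, (Φ a).1.1 = CircleBundle.proj g a) ∧
    ∀ (a : CircleBundle g) (k : G), (Φ (a <• k)).1 = ((Φ a).1.1, (Φ a).1.2 <• k)

/-- An embedded simple closed curve `γ` in a smooth surface `S`: a smooth embedding of the
circle. -/
def IsEmbeddedClosedCurve {S : Type*} [TopologicalSpace S]
    [ChartedSpace (EuclideanSpace ℝ (Fin 2)) S] (γ : Circle → S) : Prop :=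
  Manifold.IsSmoothEmbedding (𝓡 1) (𝓡 2) ∞ γ

/-- The curve `γ` is separating: the surface cut along `γ` is not connected. -/
def IsSeparatingCurve {S : Type*} [TopologicalSpace S] (γ : Circle → S) : Prop :=
  ¬ IsPreconnected (Set.range γ)ᶜ

end

/-! Characters separate the points of the finite abelian group `G/[G,G]`, so it is enough that `χ g
= 1` for every character `χ` and every monodromy `g` along the curve
(`mem_commutator_of_forall_map_eq_one`, `map_eq_one_of_hasMonodromy`). Twisting the bundle by `χ`
gives a flat line bundle on `S`, whose sections are the functions `F` on `P` with `F (p <• k) = χ k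
* F p`. With `n` the order of `G`, `χ ^ n = 1`, so `F ^ n` descends to a function `h : S → ℂ`.

For generic `F` the zeros are regular and none lies over the curve (`exists_regular`, by Sard's
theorem). Each zero of `h` is then the `n`-th power of a local coordinate, of either orientation,
and counts as `±n`. By the argument principle on one side `U` of the curve, the winding number of
`h` along the curve is a multiple of `n` (`exists_winding_eq`). The argument of `F` varies `n` times
less than that of `h`, so it changes by a multiple of `2π` along a lift of the curve and `F` returns
to its initial value (`eq_of_winding`). The monodromy multiplies the end value by `χ g` to give the
initial one; hence `χ g = 1`.

The argument principle comes from Stokes' theorem `∫_U da ∧ du = ±∫_γ a du` (`exists_stokes`),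
applied to the pullback by `h` of the smoothed angular form `κ(p² + q²)(p dq - q dp)`. On the curve
the pullback is `d arg h`, and its differential lives near the zeros of `h`, each contributing
`±2πn` (`integral_polar_pow`, `exists_area_eq_int`). Integrals over `U` are sums over charts
weighted by a partition of unity, and Stokes' theorem is reduced to half-planes by charts that
straighten the curve.

The existence of a monodromy is path lifting in the covering `π` (`exists_hasMonodromy`). -/

noncomputable section

open MeasureTheory Set Filter Topology

/-! ### Stokes' theorem in the plane and in half-planes -/

/-- The value on the standard basis of the wedge product of two real linear forms on the plane. -/
def wedge (A B : ℂ →L[ℝ] ℝ) : ℝ := A 1 * B Complex.I - A Complex.I * B 1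

theorem Complex.real_det_eq (T : ℂ →L[ℝ] ℂ) :
    T.det = (T 1).re * (T Complex.I).im - (T Complex.I).re * (T 1).im := by
  rw [ContinuousLinearMap.det, ← LinearMap.det_toMatrix Complex.basisOneI, Matrix.det_fin_two]
  simp [LinearMap.toMatrix_apply]

theorem Complex.apply_eq_re_im (A : ℂ →L[ℝ] ℝ) (z : ℂ) :
    A z = z.re * A 1 + z.im * A Complex.I := by
  conv_lhs => rw [show z = z.re • (1 : ℂ) + z.im • Complex.I by simp]
  simp only [map_add, map_smul, smul_eq_mul]

/-- The transformation law of a 2-form, which makes the integral of a density over the surface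
independent of charts. -/
theorem wedge_comp (A B : ℂ →L[ℝ] ℝ) (T : ℂ →L[ℝ] ℂ) :
    wedge (A.comp T) (B.comp T) = T.det * wedge A B := by
  rw [Complex.real_det_eq]
  simp only [wedge, ContinuousLinearMap.comp_apply]
  rw [Complex.apply_eq_re_im A (T 1), Complex.apply_eq_re_im A (T Complex.I),
    Complex.apply_eq_re_im B (T 1), Complex.apply_eq_re_im B (T Complex.I)]
  ring

theorem wedge_re_im (T : ℂ →L[ℝ] ℂ) :
    wedge (Complex.reCLM.comp T) (Complex.imCLM.comp T) = T.det := by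
  rw [Complex.real_det_eq]; rfl

theorem Complex.setIntegral_im_preimage (s : Set ℝ) (f : ℂ → ℝ) :
    ∫ z in Complex.im ⁻¹' s, f z =
      ∫ p, f (Complex.equivRealProd.symm p) ∂(volume.prod (volume.restrict s) : Measure (ℝ × ℝ)) := by
  have h := Complex.volume_preserving_equiv_real_prod.symm.setIntegral_preimage_emb
    Complex.measurableEquivRealProd.symm.measurableEmbedding f (Complex.im ⁻¹' s)
  rw [← h]
  have h2 : (Complex.measurableEquivRealProd.symm ⁻¹' (Complex.im ⁻¹' s)) = univ ×ˢ s := by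
    ext p; simp
  rw [h2, Measure.volume_eq_prod, ← Measure.prod_restrict, Measure.restrict_univ]
  rfl

theorem Complex.integrable_prod_restrict {f : ℂ → ℝ} (hf : Integrable f) (s : Set ℝ) :
    Integrable (fun p => f (Complex.equivRealProd.symm p))
      (volume.prod (volume.restrict s) : Measure (ℝ × ℝ)) := by
  have h := (Complex.volume_preserving_equiv_real_prod.symm.integrable_comp_emb
    Complex.measurableEquivRealProd.symm.measurableEmbedding (g := f)).2 hf
  have h2 := h.integrableOn (s := univ ×ˢ s)
  rw [IntegrableOn, Measure.volume_eq_prod, ← Measure.prod_restrict, Measure.restrict_univ] at h2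
  exact h2

section Planar

variable {p : ℂ → ℝ}

theorem HasCompactSupport.comp_horizontal (hc : HasCompactSupport p) (y : ℝ) :
    HasCompactSupport fun x : ℝ => p (x + y * Complex.I) := by
  refine hc.comp_isClosedEmbedding (g := fun x : ℝ => (x + y * Complex.I : ℂ)) ?_
  refine Topology.IsClosedEmbedding.comp (g := fun z : ℂ => z + y * Complex.I)
    (Homeomorph.addRight _).isClosedEmbedding Complex.isometry_ofReal.isClosedEmbedding

theorem HasCompactSupport.comp_vertical (hc : HasCompactSupport p) (x : ℝ) :
    HasCompactSupport fun y : ℝ => p (x + y * Complex.I) := by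
  refine hc.comp_isClosedEmbedding (g := fun y : ℝ => (x + y * Complex.I : ℂ)) ?_
  refine Isometry.isClosedEmbedding ?_
  refine Isometry.of_dist_eq fun a b => ?_
  rw [dist_add_left, Complex.dist_eq, ← sub_mul, norm_mul, Complex.norm_I, mul_one,
    ← Complex.ofReal_sub, Complex.norm_real, Real.dist_eq, Real.norm_eq_abs]

theorem Complex.hasDerivAt_horizontal {E : Type*} [NormedAddCommGroup E] [NormedSpace ℝ E]
    {p : ℂ → E} {x y : ℝ} {L : ℂ →L[ℝ] E}
    (hp : HasFDerivAt p L (x + y * Complex.I)) :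
    HasDerivAt (fun t : ℝ => p (t + y * Complex.I)) (L 1) x := by
  have h : HasDerivAt (fun t : ℝ => (t + y * Complex.I : ℂ)) 1 x :=
    (Complex.ofRealCLM.hasDerivAt (x := x)).add_const _
  exact hp.comp_hasDerivAt x h

theorem Complex.hasDerivAt_vertical {E : Type*} [NormedAddCommGroup E] [NormedSpace ℝ E]
    {p : ℂ → E} {x y : ℝ} {L : ℂ →L[ℝ] E}
    (hp : HasFDerivAt p L (x + y * Complex.I)) :
    HasDerivAt (fun t : ℝ => p (x + t * Complex.I)) (L Complex.I) y := by
  have h : HasDerivAt (fun t : ℝ => (x + t * Complex.I : ℂ)) Complex.I y := by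
    have := ((Complex.ofRealCLM.hasDerivAt (x := y)).mul_const Complex.I).const_add (x : ℂ)
    simpa using this
  exact hp.comp_hasDerivAt y h

theorem contDiff_vertical (hp : ContDiff ℝ 1 p) (x : ℝ) :
    ContDiff ℝ 1 fun y : ℝ => p (x + y * Complex.I) :=
  hp.comp (contDiff_const.add (Complex.ofRealCLM.contDiff.mul contDiff_const))

variable (hp : ContDiff ℝ 1 p) (hc : HasCompactSupport p)
include hp hc

theorem integrable_fderiv_apply (v : ℂ) : Integrable fun z => fderiv ℝ p z v :=
  ((hp.continuous_fderiv one_ne_zero).clm_apply continuous_const).integrable_of_hasCompactSupport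
    (hc.fderiv_apply (𝕜 := ℝ) v)

/-- The domain is a union of horizontal lines, and the horizontal derivative integrates to zero
along each of them; the domain therefore needs no regularity. -/
theorem setIntegral_im_fderiv_one (s : Set ℝ) :
    ∫ z in Complex.im ⁻¹' s, fderiv ℝ p z 1 = 0 := by
  rw [Complex.setIntegral_im_preimage,
    integral_prod_symm _ (Complex.integrable_prod_restrict (integrable_fderiv_apply hp hc 1) s)]
  refine (integral_congr_ae (Eventually.of_forall fun y => ?_)).trans (integral_zero _ _)
  have h1 : ∀ x : ℝ, HasDerivAt (fun x : ℝ => p (x + y * Complex.I))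
      (fderiv ℝ p (x + y * Complex.I) 1) x := fun x =>
    Complex.hasDerivAt_horizontal (hp.differentiable one_ne_zero _).hasFDerivAt
  have hcont : ContDiff ℝ 1 fun x : ℝ => p (x + y * Complex.I) :=
    hp.comp ((Complex.ofRealCLM.contDiff).add contDiff_const)
  have hint : Integrable fun x : ℝ => p (x + y * Complex.I) :=
    hcont.continuous.integrable_of_hasCompactSupport (hc.comp_horizontal y)
  have hint' := (hcont.continuous_deriv le_rfl).integrable_of_hasCompactSupport (μ := volume)
    (hc.comp_horizontal y).deriv
  have h2 : deriv (fun x : ℝ => p (x + y * Complex.I)) =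
    fun x : ℝ => fderiv ℝ p (x + y * Complex.I) 1 := funext fun x => (h1 x).deriv
  rw [h2] at hint'
  have := integral_eq_zero_of_hasDerivAt_of_integrable h1 hint' hint
  simpa [Complex.equivRealProd_symm_apply] using this

/-- Here the domain cuts the vertical lines of integration, so for a half-plane a boundary term on
the real axis survives. -/
theorem setIntegral_im_fderiv_I (s : Set ℝ) :
    ∫ z in Complex.im ⁻¹' s, fderiv ℝ p z Complex.I =
      ∫ x : ℝ, ∫ y in s, deriv (fun y : ℝ => p (x + y * Complex.I)) y := by
  rw [Complex.setIntegral_im_preimage,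
    integral_prod _ (Complex.integrable_prod_restrict (integrable_fderiv_apply hp hc _) s)]
  refine integral_congr_ae (Eventually.of_forall fun x => ?_)
  refine integral_congr_ae (Eventually.of_forall fun y => ?_)
  have h1 : HasDerivAt (fun y : ℝ => p (x + y * Complex.I))
      (fderiv ℝ p (x + y * Complex.I) Complex.I) y :=
    Complex.hasDerivAt_vertical (hp.differentiable one_ne_zero _).hasFDerivAt
  simp [Complex.equivRealProd_symm_apply, h1.deriv]

theorem setIntegral_im_pos_fderiv_I :
    ∫ z in Complex.im ⁻¹' Ioi 0, fderiv ℝ p z Complex.I = - ∫ x : ℝ, p x := by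
  rw [setIntegral_im_fderiv_I hp hc, ← integral_neg]
  refine integral_congr_ae (Eventually.of_forall fun x => ?_)
  simpa using HasCompactSupport.integral_Ioi_deriv_eq (contDiff_vertical hp x)
    (hc.comp_vertical x) 0

theorem setIntegral_im_neg_fderiv_I :
    ∫ z in Complex.im ⁻¹' Iio 0, fderiv ℝ p z Complex.I = ∫ x : ℝ, p x := by
  rw [setIntegral_im_fderiv_I hp hc]
  refine integral_congr_ae (Eventually.of_forall fun x => ?_)
  simp only
  rw [← integral_Iic_eq_integral_Iio]
  simpa using HasCompactSupport.integral_Iic_deriv_eq (contDiff_vertical hp x)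
    (hc.comp_vertical x) 0

theorem integral_fderiv_I : ∫ z, fderiv ℝ p z Complex.I = 0 := by
  have h := setIntegral_im_fderiv_I hp hc univ
  rw [preimage_univ, setIntegral_univ] at h
  rw [h]
  refine (integral_congr_ae (Eventually.of_forall fun x => ?_)).trans (integral_zero _ _)
  simp only [setIntegral_univ]
  have hcd := contDiff_vertical hp x
  exact integral_eq_zero_of_hasDerivAt_of_integrable
    (fun y => (hcd.differentiable one_ne_zero y).hasDerivAt)
    ((hcd.continuous_deriv le_rfl).integrable_of_hasCompactSupport (hc.comp_vertical x).deriv)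
    (hcd.continuous.integrable_of_hasCompactSupport (hc.comp_vertical x))

end Planar

section PlanarStokes

variable {A B : ℂ → ℝ} (hA : ContDiff ℝ ∞ A) (hB : ContDiff ℝ ∞ B)
include hA hB

theorem contDiff_mul_fderiv_apply (v : ℂ) : ContDiff ℝ 1 fun z => A z * fderiv ℝ B z v := by
  refine (hA.of_le (mod_cast le_top)).mul ?_
  exact (hB.fderiv_right (m := 1) (by norm_cast)).clm_apply contDiff_const

/-- This is `dA ∧ dB = d(A dB)`: the second derivatives of `B` cancel by symmetry. -/
theorem wedge_fderiv_eq (z : ℂ) :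
    wedge (fderiv ℝ A z) (fderiv ℝ B z) =
      fderiv ℝ (fun z => A z * fderiv ℝ B z Complex.I) z 1 -
        fderiv ℝ (fun z => A z * fderiv ℝ B z 1) z Complex.I := by
  have hAd : DifferentiableAt ℝ A z := hA.differentiable (by simp) z
  have hB1 : ContDiff ℝ 1 (fderiv ℝ B) := hB.fderiv_right (m := 1) (by norm_cast)
  have hBd : DifferentiableAt ℝ (fderiv ℝ B) z := hB1.differentiable one_ne_zero z
  have hd : ∀ v w : ℂ, fderiv ℝ (fun z => A z * fderiv ℝ B z v) z w =
      A z * fderiv ℝ (fderiv ℝ B) z w v + fderiv ℝ A z w * fderiv ℝ B z v := by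
    intro v w
    rw [fderiv_fun_mul hAd (hBd.clm_apply (differentiableAt_const v)),
      fderiv_clm_apply hBd (differentiableAt_const v)]
    simp [mul_comm]
  have hsymm : IsSymmSndFDerivAt ℝ B z :=
    hB.contDiffAt.isSymmSndFDerivAt (by
      rw [minSmoothness_of_isRCLikeNormedField]; exact WithTop.coe_le_coe.2 le_top)
  rw [hd, hd, hsymm.eq 1 Complex.I, wedge]
  ring

variable (hc : HasCompactSupport A)
include hc

theorem integrable_wedge_fderiv : Integrable fun z => wedge (fderiv ℝ A z) (fderiv ℝ B z) := by
  simp_rw [wedge_fderiv_eq hA hB]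
  exact (integrable_fderiv_apply (contDiff_mul_fderiv_apply hA hB _) hc.mul_right _).sub
    (integrable_fderiv_apply (contDiff_mul_fderiv_apply hA hB _) hc.mul_right _)

theorem setIntegral_wedge_fderiv (s : Set ℝ) :
    ∫ z in Complex.im ⁻¹' s, wedge (fderiv ℝ A z) (fderiv ℝ B z) =
      - ∫ z in Complex.im ⁻¹' s, fderiv ℝ (fun z => A z * fderiv ℝ B z 1) z Complex.I := by
  simp_rw [wedge_fderiv_eq hA hB]
  rw [integral_sub
    (integrable_fderiv_apply (contDiff_mul_fderiv_apply hA hB _) hc.mul_right _).integrableOn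
    (integrable_fderiv_apply (contDiff_mul_fderiv_apply hA hB _) hc.mul_right _).integrableOn,
    setIntegral_im_fderiv_one (contDiff_mul_fderiv_apply hA hB _) hc.mul_right, zero_sub]

/-- Stokes' theorem in the upper half-plane. -/
theorem setIntegral_upper_wedge_fderiv :
    ∫ z in Complex.im ⁻¹' Ioi 0, wedge (fderiv ℝ A z) (fderiv ℝ B z) =
      ∫ x : ℝ, A x * fderiv ℝ B x 1 := by
  rw [setIntegral_wedge_fderiv hA hB hc,
    setIntegral_im_pos_fderiv_I (contDiff_mul_fderiv_apply hA hB _) hc.mul_right, neg_neg]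

/-- Stokes' theorem in the lower half-plane. -/
theorem setIntegral_lower_wedge_fderiv :
    ∫ z in Complex.im ⁻¹' Iio 0, wedge (fderiv ℝ A z) (fderiv ℝ B z) =
      - ∫ x : ℝ, A x * fderiv ℝ B x 1 := by
  rw [setIntegral_wedge_fderiv hA hB hc,
    setIntegral_im_neg_fderiv_I (contDiff_mul_fderiv_apply hA hB _) hc.mul_right]

/-- Stokes' theorem in the plane. -/
theorem integral_wedge_fderiv : ∫ z, wedge (fderiv ℝ A z) (fderiv ℝ B z) = 0 := by
  have h := setIntegral_wedge_fderiv hA hB hc univ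
  rw [preimage_univ, setIntegral_univ, setIntegral_univ] at h
  rw [h, integral_fderiv_I (contDiff_mul_fderiv_apply hA hB _) hc.mul_right, neg_zero]

end PlanarStokes

/-! ### The smoothed angular form -/

/-- With this `κ`, the form `κ(p² + q²)(p dq - q dp)` is smooth on the whole plane and is `dθ` where
`p² + q² ≥ δ`. -/
theorem exists_contDiff_eq_inv {δ : ℝ} (hδ : 0 < δ) :
    ∃ κ : ℝ → ℝ, ContDiff ℝ ∞ κ ∧ ∀ s, δ ≤ s → κ s = s⁻¹ := by
  -- The numerator is `0` for `s ≤ δ / 2` and `1` for `s ≥ δ`, so the division by zero at `s = 0`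
  -- does no harm.
  refine ⟨fun s => Real.smoothTransition (2 * s / δ - 1) / s, ?_, fun s hs => ?_⟩
  · rw [contDiff_iff_contDiffAt]
    intro s
    have hnum : ContDiff ℝ ∞ fun s => Real.smoothTransition (2 * s / δ - 1) :=
      Real.smoothTransition.contDiff.comp
        (((contDiff_const.mul contDiff_id).div_const _).sub contDiff_const)
    rcases lt_or_ge s (δ / 2) with h | h
    · refine (contDiffAt_const (c := (0 : ℝ))).congr_of_eventuallyEq ?_
      filter_upwards [Iio_mem_nhds h] with t ht
      rw [Real.smoothTransition.zero_of_nonpos, zero_div]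
      have : 2 * t / δ ≤ 1 := by rw [div_le_one hδ]; linarith [mem_Iio.1 ht]
      linarith
    · exact hnum.contDiffAt.div contDiffAt_id (by linarith)
  · simp only
    rw [Real.smoothTransition.one_of_one_le, one_div]
    have : 2 ≤ 2 * s / δ := by rw [le_div_iff₀ hδ]; linarith
    linarith

/-- The integrand is the pullback under `z ↦ z ^ n` of the differential `2 m'(|w|²) dx ∧ dy` of the
smoothed angular form, where `m s = s * κ s`; the factor `n² |z|^(2(n-1))` is the Jacobian. In polar
coordinates the radial integrand is the derivative of `n * m (r ^ (2n))`, which increases in total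
from `0` to `n`, and the angle contributes `2π`. -/
theorem integral_polar_pow {κ : ℝ → ℝ} (hκ : ContDiff ℝ ∞ κ) {δ : ℝ} (hδ : 0 < δ)
    (h1 : ∀ s, δ ≤ s → κ s = s⁻¹) {n : ℕ} (hn : 0 < n) :
    ∫ z : ℂ, 2 * deriv (fun s => s * κ s) (‖z‖ ^ (2 * n)) * (n ^ 2 * ‖z‖ ^ (2 * (n - 1))) =
      2 * Real.pi * n := by
  set m : ℝ → ℝ := fun s => s * κ s with hm
  have hmc : ContDiff ℝ 1 m := contDiff_id.mul (hκ.of_le (mod_cast le_top))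
  have hmd : ∀ s, HasDerivAt m (deriv m s) s := fun s =>
    (hmc.differentiable one_ne_zero s).hasDerivAt
  have hm1 : ∀ s, δ ≤ s → m s = 1 := fun s hs => by
    simp only [hm, h1 s hs]; exact mul_inv_cancel₀ (by linarith)
  have hm' : ∀ s, δ < s → deriv m s = 0 := fun s hs => by
    have : m =ᶠ[𝓝 s] fun _ => 1 := by
      filter_upwards [Ioi_mem_nhds hs] with t ht using hm1 t (le_of_lt ht)
    rw [this.deriv_eq, deriv_const]
  have hd : ∀ r : ℝ, HasDerivAt (fun r => n * m (r ^ (2 * n)))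
      (r * (2 * deriv m (r ^ (2 * n)) * (n ^ 2 * r ^ (2 * (n - 1))))) r := by
    intro r
    have h := ((hmd (r ^ (2 * n))).comp r (hasDerivAt_pow (2 * n) r)).const_mul (n : ℝ)
    refine h.congr_deriv ?_
    have : 2 * n - 1 = 2 * (n - 1) + 1 := by omega
    rw [this, pow_succ]
    push_cast
    ring
  have hevt : ∀ᶠ r : ℝ in atTop, δ < r ^ (2 * n) :=
    (tendsto_pow_atTop (by omega)).eventually_gt_atTop δ
  have hlim : Tendsto (fun r : ℝ => n * m (r ^ (2 * n))) atTop (𝓝 n) := by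
    refine tendsto_const_nhds.congr' ?_
    filter_upwards [hevt] with r hr
    rw [hm1 _ hr.le, mul_one]
  have hcontd : Continuous fun r : ℝ =>
      r * (2 * deriv m (r ^ (2 * n)) * (n ^ 2 * r ^ (2 * (n - 1)))) := by
    have := hmc.continuous_deriv le_rfl
    fun_prop
  obtain ⟨R, hR⟩ := eventually_atTop.1 (hevt.and (eventually_gt_atTop 0))
  have hint : IntegrableOn (fun r : ℝ =>
      r * (2 * deriv m (r ^ (2 * n)) * (n ^ 2 * r ^ (2 * (n - 1))))) (Ioi 0) := by
    have h2 : IntegrableOn (fun r : ℝ =>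
        r * (2 * deriv m (r ^ (2 * n)) * (n ^ 2 * r ^ (2 * (n - 1))))) (Icc 0 R) :=
      hcontd.continuousOn.integrableOn_compact isCompact_Icc
    refine h2.of_forall_sdiff_eq_zero measurableSet_Ioi fun r hr => ?_
    have hr2 : R ≤ r := by
      by_contra h
      exact hr.2 ⟨le_of_lt hr.1, le_of_not_ge h⟩
    rw [hm' _ (hR r hr2).1]
    ring
  have hone := integral_Ioi_of_hasDerivAt_of_tendsto' (a := 0) (fun r _ => hd r) hint hlim
  rw [← Complex.integral_comp_polarCoord_symm]
  have htgt : polarCoord.target = Ioi (0 : ℝ) ×ˢ Ioo (-Real.pi) Real.pi := rfl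
  have hsub : ∀ p ∈ polarCoord.target, p.1 • (2 * deriv m (‖Complex.polarCoord.symm p‖ ^ (2 * n)) *
      (n ^ 2 * ‖Complex.polarCoord.symm p‖ ^ (2 * (n - 1)))) =
      (p.1 * (2 * deriv m (p.1 ^ (2 * n)) * (n ^ 2 * p.1 ^ (2 * (n - 1))))) * (1 : ℝ) := by
    intro p hp
    rw [htgt] at hp
    rw [Complex.norm_polarCoord_symm, abs_of_pos hp.1, smul_eq_mul, mul_one]
  rw [setIntegral_congr_fun (by rw [htgt]; exact measurableSet_Ioi.prod measurableSet_Ioo) hsub,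
    htgt, Measure.volume_eq_prod, setIntegral_prod_mul
      (fun r : ℝ => r * (2 * deriv m (r ^ (2 * n)) * (n ^ 2 * r ^ (2 * (n - 1)))))
      (fun _ : ℝ => (1 : ℝ)), hone]
  have hpi : 0 ≤ Real.pi + Real.pi := by positivity
  simp [hm, hn.ne', hpi]
  ring

/-! ### Change of variables and Sard's theorem in equal dimensions -/

/-- Change of variables for a map whose Jacobian determinant has constant sign `s`. -/
theorem integral_comp_mul_det {V : Set ℂ} (hV : MeasurableSet V) {f : ℂ → ℂ}
    {f' : ℂ → ℂ →L[ℝ] ℂ} (hf : ∀ z ∈ V, HasFDerivAt f (f' z) z) (hinj : InjOn f V)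
    {s : ℝ} (hs : s = 1 ∨ s = -1) (hsign : ∀ z ∈ V, 0 < s * (f' z).det) (φ : ℂ → ℝ) :
    ∫ z in V, (f' z).det * φ (f z) = s * ∫ z in f '' V, φ z := by
  rw [integral_image_eq_integral_abs_det_fderiv_smul volume hV
    (fun z hz => (hf z hz).hasFDerivWithinAt) hinj, ← integral_const_mul]
  refine setIntegral_congr_fun hV fun z hz => ?_
  have h := hsign z hz
  simp only [smul_eq_mul]
  rcases hs with rfl | rfl
  · rw [abs_of_pos (by linarith)]; ring
  · rw [abs_of_neg (by linarith)]; ring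

/-- Critical values form a null set. So does the curve: it is the image of the map `w ↦ c w.re` of
the plane, whose Jacobian vanishes because it depends on one real coordinate only. -/
theorem exists_notMem_image_of_det_eq_zero {R : ℂ → ℂ} {C : Set ℂ} {R' : ℂ → ℂ →L[ℝ] ℂ}
    (hR : ∀ z ∈ C, HasFDerivAt R (R' z) z) (hC : ∀ z ∈ C, (R' z).det = 0)
    {c : ℝ → ℂ} {T : Set ℝ} (hc : ∀ t ∈ T, DifferentiableAt ℝ c t) :
    ∃ v : ℂ, v ∉ R '' C ∧ v ∉ c '' T := by
  have h1 : volume (R '' C) = 0 := addHaar_image_eq_zero_of_det_fderivWithin_eq_zero volume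
    (fun z hz => (hR z hz).hasFDerivWithinAt) hC
  have h2 : volume ((fun w : ℂ => c w.re) '' (Complex.re ⁻¹' T)) = 0 := by
    refine addHaar_image_eq_zero_of_det_fderivWithin_eq_zero volume
      (f' := fun w => (fderiv ℝ c w.re).comp Complex.reCLM) (fun w hw => ?_) fun w hw => ?_
    · exact ((hc _ hw).hasFDerivAt.comp w Complex.reCLM.hasFDerivAt).hasFDerivWithinAt
    · rw [Complex.real_det_eq]; simp
  have h3 : c '' T ⊆ (fun w : ℂ => c w.re) '' (Complex.re ⁻¹' T) := by
    rintro _ ⟨t, ht, rfl⟩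
    exact ⟨t, by simpa using ht, by simp⟩
  by_contra! hcon
  have h4 : (univ : Set ℂ) ⊆ R '' C ∪ (fun w : ℂ => c w.re) '' (Complex.re ⁻¹' T) := by
    intro v _
    by_cases hv : v ∈ R '' C
    · exact Or.inl hv
    · exact Or.inr (h3 (hcon v hv))
  have h5 := (measure_mono h4).trans ((measure_union_le _ _).trans_eq (by rw [h1, h2, zero_add]))
  exact NeZero.ne (volume (univ : Set ℂ)) (le_antisymm h5 zero_le)

/-! ### Complex-valued smooth charts and their transition maps -/

section SmoothCharts

variable {S : Type*} [TopologicalSpace S] [ChartedSpace (EuclideanSpace ℝ (Fin 2)) S]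

/-- A smooth chart of a surface with values in the complex plane. -/
def IsSmoothChart (e : OpenPartialHomeomorph S ℂ) : Prop :=
  ContMDiffOn (𝓡 2) 𝓘(ℝ, ℂ) ∞ e e.source ∧ ContMDiffOn 𝓘(ℝ, ℂ) (𝓡 2) ∞ e.symm e.target

/-- The transition map from `e` to `e'` has Jacobian determinant of sign `s`. -/
def HasTransitionSign (s : ℝ) (e e' : OpenPartialHomeomorph S ℂ) : Prop :=
  ∀ y ∈ (e.symm.trans e').source, 0 < s * (fderiv ℝ (e.symm.trans e') y).det

theorem IsSmoothChart.contDiffOn_comp {E : Type*} [NormedAddCommGroup E] [NormedSpace ℝ E]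
    {e : OpenPartialHomeomorph S ℂ} (he : IsSmoothChart e) {F : S → E}
    (hF : ContMDiff (𝓡 2) 𝓘(ℝ, E) ∞ F) : ContDiffOn ℝ ∞ (F ∘ e.symm) e.target :=
  (hF.comp_contMDiffOn he.2).contDiffOn

theorem IsSmoothChart.contDiffAt_comp {E : Type*} [NormedAddCommGroup E] [NormedSpace ℝ E]
    {e : OpenPartialHomeomorph S ℂ} (he : IsSmoothChart e) {F : S → E}
    (hF : ContMDiff (𝓡 2) 𝓘(ℝ, E) ∞ F) {y : ℂ} (hy : y ∈ e.target) :
    ContDiffAt ℝ ∞ (F ∘ e.symm) y :=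
  (he.contDiffOn_comp hF).contDiffAt (e.open_target.mem_nhds hy)

theorem IsSmoothChart.differentiableAt_comp {E : Type*} [NormedAddCommGroup E] [NormedSpace ℝ E]
    {e : OpenPartialHomeomorph S ℂ} (he : IsSmoothChart e) {F : S → E}
    (hF : ContMDiff (𝓡 2) 𝓘(ℝ, E) ∞ F) {y : ℂ} (hy : y ∈ e.target) :
    DifferentiableAt ℝ (F ∘ e.symm) y :=
  (he.contDiffAt_comp hF hy).differentiableAt (by simp)

theorem IsSmoothChart.contDiffOn_transition {e e' : OpenPartialHomeomorph S ℂ}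
    (he : IsSmoothChart e) (he' : IsSmoothChart e') :
    ContDiffOn ℝ ∞ (e.symm.trans e') (e.symm.trans e').source := by
  have h : ContMDiffOn 𝓘(ℝ, ℂ) 𝓘(ℝ, ℂ) ∞ (e' ∘ e.symm) (e.symm.trans e').source :=
    he'.1.comp (he.2.mono fun y hy => hy.1) fun y hy => hy.2
  exact h.contDiffOn

theorem IsSmoothChart.differentiableAt_transition {e e' : OpenPartialHomeomorph S ℂ}
    (he : IsSmoothChart e) (he' : IsSmoothChart e') {y : ℂ} (hy : y ∈ (e.symm.trans e').source) :
    DifferentiableAt ℝ (e.symm.trans e') y :=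
  ((he.contDiffOn_transition he').contDiffAt
    ((e.symm.trans e').open_source.mem_nhds hy)).differentiableAt (by simp)

theorem IsSmoothChart.restrOpen {e : OpenPartialHomeomorph S ℂ} (he : IsSmoothChart e) {s : Set S}
    (hs : IsOpen s) : IsSmoothChart (e.restrOpen s hs) := by
  refine ⟨he.1.mono ?_, he.2.mono ?_⟩
  · rw [e.restrOpen_source]; exact inter_subset_left
  · exact fun y hy => hy.1

theorem IsSmoothChart.of_mem_maximalAtlas [IsManifold (𝓡 2) ∞ S]
    {e : OpenPartialHomeomorph S (EuclideanSpace ℝ (Fin 2))}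
    (he : e ∈ IsManifold.maximalAtlas (𝓡 2) ∞ S) (L : EuclideanSpace ℝ (Fin 2) ≃L[ℝ] ℂ) :
    IsSmoothChart (e.transHomeomorph L.toHomeomorph) := by
  refine ⟨?_, ?_⟩
  · exact L.contDiff.contMDiff.comp_contMDiffOn (contMDiffOn_of_mem_maximalAtlas he)
  · exact (contMDiffOn_symm_of_mem_maximalAtlas he).comp L.symm.contDiff.contMDiff.contMDiffOn
      fun y hy => hy

omit [ChartedSpace (EuclideanSpace ℝ (Fin 2)) S] in
theorem transition_comp_eventuallyEq {E : Type*} {e e' : OpenPartialHomeomorph S ℂ} (F : S → E)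
    {y : ℂ} (hy : y ∈ (e.symm.trans e').source) :
    F ∘ e.symm =ᶠ[𝓝 y] (F ∘ e'.symm) ∘ (e.symm.trans e') := by
  filter_upwards [(e.symm.trans e').open_source.mem_nhds hy] with z hz
  have : e'.symm (e' (e.symm z)) = e.symm z := e'.left_inv hz.2
  simp [this]

theorem fderiv_comp_transition {E : Type*} [NormedAddCommGroup E] [NormedSpace ℝ E]
    {e e' : OpenPartialHomeomorph S ℂ} (he : IsSmoothChart e)
    (he' : IsSmoothChart e') {F : S → E} (hF : ContMDiff (𝓡 2) 𝓘(ℝ, E) ∞ F)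
    {y : ℂ} (hy : y ∈ (e.symm.trans e').source) :
    fderiv ℝ (F ∘ e.symm) y = (fderiv ℝ (F ∘ e'.symm) ((e.symm.trans e') y)).comp
      (fderiv ℝ (e.symm.trans e') y) := by
  rw [(transition_comp_eventuallyEq F hy).fderiv_eq]
  exact fderiv_comp y (he'.differentiableAt_comp hF ((e.symm.trans e').map_source hy).1)
    (he.differentiableAt_transition he' hy)

end SmoothCharts

/-! ### Integration of densities over an oriented surface -/

/-- A finite oriented atlas of complex-valued charts with a subordinate partition of unity. -/
structure OrientedCover (S : Type*) [TopologicalSpace S]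
    [ChartedSpace (EuclideanSpace ℝ (Fin 2)) S] (ι : Type*) [Fintype ι] where
  chart : ι → OpenPartialHomeomorph S ℂ
  smooth : ∀ i, IsSmoothChart (chart i)
  sign : ∀ i j, HasTransitionSign 1 (chart i) (chart j)
  weight : ι → S → ℝ
  weight_smooth : ∀ i, ContMDiff (𝓡 2) 𝓘(ℝ, ℝ) ∞ (weight i)
  weight_nonneg : ∀ i x, 0 ≤ weight i x
  tsupport_subset : ∀ i, tsupport (weight i) ⊆ (chart i).source
  sum_eq_one : ∀ x, ∑ i, weight i x = 1

namespace OrientedCover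

variable {S : Type*} [TopologicalSpace S] [ChartedSpace (EuclideanSpace ℝ (Fin 2)) S]
  {ι : Type*} [Fintype ι] (𝒞 : OrientedCover S ι)

/-- The integral over the surface of the density `g da ∧ du`. -/
def area (g a u : S → ℝ) : ℝ :=
  ∑ i, ∫ y in (𝒞.chart i).target, 𝒞.weight i ((𝒞.chart i).symm y) * g ((𝒞.chart i).symm y) *
    wedge (fderiv ℝ (a ∘ (𝒞.chart i).symm) y) (fderiv ℝ (u ∘ (𝒞.chart i).symm) y)

theorem weight_eq_zero {i : ι} {x : S} (hx : x ∉ (𝒞.chart i).source) : 𝒞.weight i x = 0 :=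
  image_eq_zero_of_notMem_tsupport fun h => hx (𝒞.tsupport_subset i h)

theorem weight_le_one (i : ι) (x : S) : 𝒞.weight i x ≤ 1 := by
  rw [← 𝒞.sum_eq_one x]
  exact Finset.single_le_sum (f := fun i => 𝒞.weight i x) (fun j _ => 𝒞.weight_nonneg j x)
    (Finset.mem_univ i)

end OrientedCover

section Integrability

variable {S : Type*} [TopologicalSpace S] [ChartedSpace (EuclideanSpace ℝ (Fin 2)) S]
  [MeasurableSpace S] [BorelSpace S]

omit [ChartedSpace (EuclideanSpace ℝ (Fin 2)) S] in
theorem aestronglyMeasurable_comp_chart_symm (e : OpenPartialHomeomorph S ℂ) {φ : S → ℝ}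
    (hφ : Measurable φ) :
    AEStronglyMeasurable (fun y => φ (e.symm y)) (volume.restrict e.target) := by
  have h : AEMeasurable e.symm (volume.restrict e.target) :=
    e.continuousOn_symm.aemeasurable e.open_target.measurableSet
  exact (hφ.comp_aemeasurable h).aestronglyMeasurable

omit [MeasurableSpace S] [BorelSpace S] in
theorem continuousOn_wedge_fderiv {e : OpenPartialHomeomorph S ℂ} (he : IsSmoothChart e)
    {a u : S → ℝ} (ha : ContMDiff (𝓡 2) 𝓘(ℝ, ℝ) ∞ a) (hu : ContMDiff (𝓡 2) 𝓘(ℝ, ℝ) ∞ u) :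
    ContinuousOn (fun y => wedge (fderiv ℝ (a ∘ e.symm) y) (fderiv ℝ (u ∘ e.symm) y)) e.target := by
  have h : ∀ {F : S → ℝ}, ContMDiff (𝓡 2) 𝓘(ℝ, ℝ) ∞ F → ∀ v : ℂ,
      ContinuousOn (fun y => fderiv ℝ (F ∘ e.symm) y v) e.target := fun hF v =>
    ((he.contDiffOn_comp hF).continuousOn_fderiv_of_isOpen e.open_target (by simp)).clm_apply
      continuousOn_const
  exact ((h ha 1).mul (h hu Complex.I)).sub ((h ha Complex.I).mul (h hu 1))

/-- The derivatives may be unbounded near the edge of the chart; the compact set `K` keeps the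
integrand away from it. -/
theorem integrableOn_mul_wedge_fderiv {e : OpenPartialHomeomorph S ℂ} (he : IsSmoothChart e)
    {a u φ : S → ℝ} (ha : ContMDiff (𝓡 2) 𝓘(ℝ, ℝ) ∞ a) (hu : ContMDiff (𝓡 2) 𝓘(ℝ, ℝ) ∞ u)
    (hφ : Measurable φ) {C : ℝ} (hC : ∀ x, |φ x| ≤ C) {K : Set S} (hK : IsCompact K)
    (hKe : K ⊆ e.source) (hφK : ∀ x ∉ K, φ x = 0) :
    IntegrableOn (fun y => φ (e.symm y) *
      wedge (fderiv ℝ (a ∘ e.symm) y) (fderiv ℝ (u ∘ e.symm) y)) e.target := by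
  have hK' : IsCompact (e '' K) := hK.image_of_continuousOn (e.continuousOn.mono hKe)
  have hKt : e '' K ⊆ e.target := by
    rintro _ ⟨x, hx, rfl⟩; exact e.map_source (hKe hx)
  have h1 : IntegrableOn (fun y => wedge (fderiv ℝ (a ∘ e.symm) y) (fderiv ℝ (u ∘ e.symm) y))
      (e '' K) := ((continuousOn_wedge_fderiv he ha hu).mono hKt).integrableOn_compact hK'
  have h2 : IntegrableOn (fun y => φ (e.symm y) *
      wedge (fderiv ℝ (a ∘ e.symm) y) (fderiv ℝ (u ∘ e.symm) y)) (e '' K) := by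
    refine h1.bdd_mul (c := C) ?_ (Eventually.of_forall fun y => by simpa using hC _)
    exact (aestronglyMeasurable_comp_chart_symm e hφ).mono_measure
      (Measure.restrict_mono hKt le_rfl)
  refine h2.of_forall_sdiff_eq_zero e.open_target.measurableSet fun y hy => ?_
  rw [hφK, zero_mul]
  exact fun h => hy.2 ⟨_, h, e.right_inv hy.1⟩

end Integrability

namespace OrientedCover

variable {S : Type*} [TopologicalSpace S] [ChartedSpace (EuclideanSpace ℝ (Fin 2)) S]
  [MeasurableSpace S] [BorelSpace S] [CompactSpace S]
  {ι : Type*} [Fintype ι] (𝒞 : OrientedCover S ι)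

theorem integrableOn {a u g : S → ℝ} (ha : ContMDiff (𝓡 2) 𝓘(ℝ, ℝ) ∞ a)
    (hu : ContMDiff (𝓡 2) 𝓘(ℝ, ℝ) ∞ u) (hg : Measurable g) {C : ℝ} (hC : ∀ x, |g x| ≤ C) (i : ι) :
    IntegrableOn (fun y => 𝒞.weight i ((𝒞.chart i).symm y) * g ((𝒞.chart i).symm y) *
      wedge (fderiv ℝ (a ∘ (𝒞.chart i).symm) y) (fderiv ℝ (u ∘ (𝒞.chart i).symm) y))
      (𝒞.chart i).target := by
  refine integrableOn_mul_wedge_fderiv (φ := fun x => 𝒞.weight i x * g x) (𝒞.smooth i) ha hu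
    ((𝒞.weight_smooth i).continuous.measurable.mul hg) (C := C) (fun x => ?_)
    (isClosed_tsupport (𝒞.weight i)).isCompact (𝒞.tsupport_subset i) fun x hx => ?_
  · rw [abs_mul, abs_of_nonneg (𝒞.weight_nonneg i x)]
    exact (mul_le_of_le_one_left (abs_nonneg _) (𝒞.weight_le_one i x)).trans (hC x)
  · rw [image_eq_zero_of_notMem_tsupport hx, zero_mul]

/-- Meant for the angular form, written `a du + b dv`, with `D dc ∧ dd` as its differential. -/
theorem area_add_eq {a u b v c d g D : S → ℝ} (ha : ContMDiff (𝓡 2) 𝓘(ℝ, ℝ) ∞ a)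
    (hu : ContMDiff (𝓡 2) 𝓘(ℝ, ℝ) ∞ u) (hb : ContMDiff (𝓡 2) 𝓘(ℝ, ℝ) ∞ b)
    (hv : ContMDiff (𝓡 2) 𝓘(ℝ, ℝ) ∞ v) (hg : Measurable g) {C : ℝ} (hC : ∀ x, |g x| ≤ C)
    (h : ∀ e : OpenPartialHomeomorph S ℂ, IsSmoothChart e → ∀ y ∈ e.target,
      wedge (fderiv ℝ (a ∘ e.symm) y) (fderiv ℝ (u ∘ e.symm) y) +
        wedge (fderiv ℝ (b ∘ e.symm) y) (fderiv ℝ (v ∘ e.symm) y) =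
      D (e.symm y) * wedge (fderiv ℝ (c ∘ e.symm) y) (fderiv ℝ (d ∘ e.symm) y)) :
    𝒞.area g a u + 𝒞.area g b v = 𝒞.area (fun x => g x * D x) c d := by
  rw [area, area, area, ← Finset.sum_add_distrib]
  refine Finset.sum_congr rfl fun i _ => ?_
  rw [← integral_add (𝒞.integrableOn ha hu hg hC i) (𝒞.integrableOn hb hv hg hC i)]
  refine setIntegral_congr_fun (𝒞.chart i).open_target.measurableSet fun y hy => ?_
  rw [← mul_add, h _ (𝒞.smooth i) y hy]
  ring

theorem area_sum_left {κ : Type*} (s : Finset κ) {a : κ → S → ℝ} {u g : S → ℝ}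
    (ha : ∀ k, ContMDiff (𝓡 2) 𝓘(ℝ, ℝ) ∞ (a k))
    (hu : ContMDiff (𝓡 2) 𝓘(ℝ, ℝ) ∞ u) (hg : Measurable g) {C : ℝ} (hC : ∀ x, |g x| ≤ C) :
    𝒞.area g (fun x => ∑ k ∈ s, a k x) u = ∑ k ∈ s, 𝒞.area g (a k) u := by
  simp only [area]
  rw [Finset.sum_comm]
  refine Finset.sum_congr rfl fun i _ => ?_
  rw [← integral_finsetSum _ fun k _ => 𝒞.integrableOn (ha k) hu hg hC i]
  refine setIntegral_congr_fun (𝒞.chart i).open_target.measurableSet fun y hy => ?_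
  have : fderiv ℝ ((fun x => ∑ k ∈ s, a k x) ∘ (𝒞.chart i).symm) y =
      ∑ k ∈ s, fderiv ℝ (a k ∘ (𝒞.chart i).symm) y :=
    fderiv_fun_sum fun k _ => (𝒞.smooth i).differentiableAt_comp (ha k) hy
  rw [this, ← Finset.mul_sum]
  congr 1
  simp [wedge, Finset.sum_mul, Finset.sum_sub_distrib]

theorem area_sum_density {κ : Type*} (s : Finset κ) {g : κ → S → ℝ} {a u : S → ℝ}
    (ha : ContMDiff (𝓡 2) 𝓘(ℝ, ℝ) ∞ a) (hu : ContMDiff (𝓡 2) 𝓘(ℝ, ℝ) ∞ u)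
    (hg : ∀ k, Measurable (g k)) {C : ℝ} (hC : ∀ k x, |g k x| ≤ C) :
    𝒞.area (fun x => ∑ k ∈ s, g k x) a u = ∑ k ∈ s, 𝒞.area (g k) a u := by
  simp only [area]
  rw [Finset.sum_comm]
  refine Finset.sum_congr rfl fun i _ => ?_
  rw [← integral_finsetSum _ fun k _ => 𝒞.integrableOn ha hu (hg k) (hC k) i]
  refine setIntegral_congr_fun (𝒞.chart i).open_target.measurableSet fun y hy => ?_
  rw [Finset.mul_sum, Finset.sum_mul]

omit [MeasurableSpace S] [BorelSpace S] [CompactSpace S] in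
theorem area_congr {g g' a u : S → ℝ} (h : ∀ e : OpenPartialHomeomorph S ℂ, ∀ y ∈ e.target,
      g (e.symm y) * wedge (fderiv ℝ (a ∘ e.symm) y) (fderiv ℝ (u ∘ e.symm) y) =
      g' (e.symm y) * wedge (fderiv ℝ (a ∘ e.symm) y) (fderiv ℝ (u ∘ e.symm) y)) :
    𝒞.area g a u = 𝒞.area g' a u := by
  refine Finset.sum_congr rfl fun i _ =>
    setIntegral_congr_fun (𝒞.chart i).open_target.measurableSet fun y hy => ?_
  rw [mul_assoc, mul_assoc, h _ y hy]

omit [CompactSpace S] in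
/-- The integral of a density that is supported in a chart can be computed in this chart. -/
theorem area_eq_of_chart {a u g : S → ℝ} (ha : ContMDiff (𝓡 2) 𝓘(ℝ, ℝ) ∞ a)
    (hu : ContMDiff (𝓡 2) 𝓘(ℝ, ℝ) ∞ u) {e : OpenPartialHomeomorph S ℂ} (he : IsSmoothChart e)
    {s : ℝ} (hs : s = 1 ∨ s = -1) (hsign : ∀ i, HasTransitionSign s e (𝒞.chart i))
    (hg : ∀ x ∉ e.source, g x = 0)
    (hint : IntegrableOn (fun y => g (e.symm y) *
      wedge (fderiv ℝ (a ∘ e.symm) y) (fderiv ℝ (u ∘ e.symm) y)) e.target) :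
    𝒞.area g a u = s * ∫ y in e.target, g (e.symm y) *
      wedge (fderiv ℝ (a ∘ e.symm) y) (fderiv ℝ (u ∘ e.symm) y) := by
  -- Each summand is moved to the chart `e` by the transition map. Off the overlap both sides
  -- vanish: in the chart `i` because `g` is zero outside `e.source`, in `e` because `weight i` is
  -- zero outside the chart `i`.
  have key : ∀ i, ∫ y in (𝒞.chart i).target, 𝒞.weight i ((𝒞.chart i).symm y) *
      g ((𝒞.chart i).symm y) *
        wedge (fderiv ℝ (a ∘ (𝒞.chart i).symm) y) (fderiv ℝ (u ∘ (𝒞.chart i).symm) y) =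
      s * ∫ y in e.target, 𝒞.weight i (e.symm y) * (g (e.symm y) *
        wedge (fderiv ℝ (a ∘ e.symm) y) (fderiv ℝ (u ∘ e.symm) y)) := by
    intro i
    set τ := e.symm.trans (𝒞.chart i) with hτ
    have h1 : ∀ y ∈ (𝒞.chart i).target \ τ.target, 𝒞.weight i ((𝒞.chart i).symm y) *
        g ((𝒞.chart i).symm y) *
        wedge (fderiv ℝ (a ∘ (𝒞.chart i).symm) y) (fderiv ℝ (u ∘ (𝒞.chart i).symm) y) = 0 := by
      intro y hy
      rw [hg, mul_zero, zero_mul]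
      exact fun h => hy.2 ⟨hy.1, h⟩
    rw [setIntegral_eq_of_subset_of_forall_sdiff_eq_zero (𝒞.chart i).open_target.measurableSet
      (fun y hy => hy.1) h1, integral_target_eq_integral_abs_det_fderiv_smul volume
      (fun y hy => (he.differentiableAt_transition (𝒞.smooth i) hy).hasFDerivAt),
      ← integral_const_mul]
    symm
    rw [setIntegral_eq_of_subset_of_forall_sdiff_eq_zero e.open_target.measurableSet
      (s := τ.source) (fun y hy => hy.1)]
    · refine setIntegral_congr_fun τ.open_source.measurableSet fun y hy => ?_
      have hp := hsign i y hy
      have hinv : (𝒞.chart i).symm (τ y) = e.symm y := (𝒞.chart i).left_inv hy.2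
      rw [fderiv_comp_transition he (𝒞.smooth i) ha hy, fderiv_comp_transition he (𝒞.smooth i) hu hy,
        wedge_comp, hinv, smul_eq_mul]
      have habs : |(fderiv ℝ τ y).det| = s * (fderiv ℝ τ y).det := by
        rcases hs with rfl | rfl
        · rw [one_mul]; exact abs_of_pos (by linarith)
        · rw [neg_one_mul]; exact abs_of_neg (by linarith)
      rw [habs]
      ring
    · intro y hy
      rw [𝒞.weight_eq_zero, zero_mul, mul_zero]
      exact fun h => hy.2 ⟨hy.1, h⟩
  rw [area, Finset.sum_congr rfl fun i _ => key i, ← Finset.mul_sum,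
    ← integral_finsetSum]
  · congr 1
    refine setIntegral_congr_fun e.open_target.measurableSet fun y _ => ?_
    rw [← Finset.sum_mul, 𝒞.sum_eq_one, one_mul]
  · intro i _
    refine hint.bdd_mul (c := 1) (aestronglyMeasurable_comp_chart_symm e
      (𝒞.weight_smooth i).continuous.measurable) (Eventually.of_forall fun y => ?_)
    rw [Real.norm_eq_abs, abs_of_nonneg (𝒞.weight_nonneg _ _)]
    exact 𝒞.weight_le_one _ _

end OrientedCover

/-! ### Stokes' theorem for functions supported in a chart -/

section Extension

variable {S : Type*} [TopologicalSpace S] [ChartedSpace (EuclideanSpace ℝ (Fin 2)) S]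
  [CompactSpace S]

/-- The image of the support is compact in the open target, so extension by zero is smooth. -/
theorem contDiff_indicator_comp_chart_symm {e : OpenPartialHomeomorph S ℂ} (he : IsSmoothChart e)
    {a : S → ℝ} (ha : ContMDiff (𝓡 2) 𝓘(ℝ, ℝ) ∞ a) (hsupp : tsupport a ⊆ e.source) :
    ContDiff ℝ ∞ (e.target.indicator (a ∘ e.symm)) ∧
      HasCompactSupport (e.target.indicator (a ∘ e.symm)) := by
  have hK : IsCompact (e '' tsupport a) :=
    (isClosed_tsupport a).isCompact.image_of_continuousOn (e.continuousOn.mono hsupp)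
  have hzero : ∀ y ∉ e '' tsupport a, e.target.indicator (a ∘ e.symm) y = 0 := by
    intro y hy
    by_cases hyt : y ∈ e.target
    · rw [indicator_of_mem hyt, Function.comp_apply]
      exact image_eq_zero_of_notMem_tsupport fun h => hy ⟨_, h, e.right_inv hyt⟩
    · exact indicator_of_notMem hyt _
  refine ⟨contDiff_iff_contDiffAt.2 fun y => ?_, HasCompactSupport.intro hK hzero⟩
  by_cases hyt : y ∈ e.target
  · refine (he.contDiffAt_comp ha hyt).congr_of_eventuallyEq ?_
    filter_upwards [e.open_target.mem_nhds hyt] with z hz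
    exact indicator_of_mem hz _
  · refine (contDiffAt_const (c := (0 : ℝ))).congr_of_eventuallyEq ?_
    have hy : y ∉ e '' tsupport a := by
      rintro ⟨x, hx, rfl⟩
      exact hyt (e.map_source (hsupp hx))
    filter_upwards [hK.isClosed.isOpen_compl.mem_nhds hy] with z hz
    exact hzero z hz

variable [T2Space S] [IsManifold (𝓡 2) ∞ S]

theorem exists_contMDiff_eventuallyEq_one {s o : Set S} (hs : IsClosed s) (ho : IsOpen o)
    (hso : s ⊆ o) : ∃ b : S → ℝ, ContMDiff (𝓡 2) 𝓘(ℝ, ℝ) ∞ b ∧ (∀ x ∈ s, b =ᶠ[𝓝 x] fun _ => 1) ∧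
      tsupport b ⊆ o ∧ ∀ x, b x ∈ Icc (0 : ℝ) 1 := by
  obtain ⟨t, ht, hst, hto⟩ := normal_exists_closure_subset hs ho hso
  obtain ⟨f, hf1, hf0, hf⟩ := exists_contMDiffMap_one_nhds_of_subset_interior (𝓡 2) (n := ⊤) hs
    (t := t) (by rwa [ht.interior_eq])
  refine ⟨f, f.contMDiff, fun x hx => ?_, ?_, hf⟩
  · exact (eventually_nhdsSet_iff_forall.1 hf1) x hx
  · refine (closure_mono fun x hx => ?_).trans hto
    by_contra h
    exact hx (hf0 x h)

/-- Transport to the plane of a pair of functions, the first of which is supported in a chart. -/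
theorem exists_planar_extension {e : OpenPartialHomeomorph S ℂ} (he : IsSmoothChart e)
    {a u : S → ℝ} (ha : ContMDiff (𝓡 2) 𝓘(ℝ, ℝ) ∞ a) (hu : ContMDiff (𝓡 2) 𝓘(ℝ, ℝ) ∞ u)
    (hsupp : tsupport a ⊆ e.source) :
    ∃ A B : ℂ → ℝ, ContDiff ℝ ∞ A ∧ ContDiff ℝ ∞ B ∧ HasCompactSupport A ∧
      (∀ y ∈ e.target, wedge (fderiv ℝ (a ∘ e.symm) y) (fderiv ℝ (u ∘ e.symm) y) =
        wedge (fderiv ℝ A y) (fderiv ℝ B y)) ∧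
      (∀ y ∉ e.target, wedge (fderiv ℝ A y) (fderiv ℝ B y) = 0) ∧
      (∀ y ∈ e.target, ∀ v, a (e.symm y) * fderiv ℝ (u ∘ e.symm) y v = A y * fderiv ℝ B y v) ∧
      ∀ y ∉ e.target, A y = 0 := by
  -- The function `u` need not be supported in the chart. It is replaced by `b * u`, with `b = 1`
  -- near the support of `a`, which is all that the 2-form and the 1-form see.
  obtain ⟨b, hb, hb1, hbs, -⟩ := exists_contMDiff_eventuallyEq_one (isClosed_tsupport a)
    e.open_source hsupp
  have hbu : ContMDiff (𝓡 2) 𝓘(ℝ, ℝ) ∞ fun x => b x * u x := hb.mul hu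
  have hbus : tsupport (fun x => b x * u x) ⊆ e.source := (tsupport_mul_subset_left).trans hbs
  obtain ⟨hA, hAc⟩ := contDiff_indicator_comp_chart_symm he ha hsupp
  obtain ⟨hB, -⟩ := contDiff_indicator_comp_chart_symm he hbu hbus
  have hAev : ∀ y ∈ e.target, e.target.indicator (a ∘ e.symm) =ᶠ[𝓝 y] a ∘ e.symm := by
    intro y hy
    filter_upwards [e.open_target.mem_nhds hy] with z hz using indicator_of_mem hz _
  have hBev : ∀ y ∈ e.target, e.symm y ∈ tsupport a →
      e.target.indicator ((fun x => b x * u x) ∘ e.symm) =ᶠ[𝓝 y] u ∘ e.symm := by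
    intro y hy hya
    filter_upwards [e.open_target.mem_nhds hy, (e.continuousAt_symm hy).eventually (hb1 _ hya)]
      with z hz hz1
    rw [indicator_of_mem hz]
    simp [hz1]
  have hzero : ∀ y ∈ e.target, e.symm y ∉ tsupport a → a ∘ e.symm =ᶠ[𝓝 y] fun _ => 0 := by
    intro y hy hya
    exact (e.continuousAt_symm hy).eventually (notMem_tsupport_iff_eventuallyEq.1 hya)
  refine ⟨_, _, hA, hB, hAc, fun y hy => ?_, fun y hy => ?_, fun y hy v => ?_, fun y hy => ?_⟩
  · rw [(hAev y hy).fderiv_eq]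
    by_cases hya : e.symm y ∈ tsupport a
    · rw [(hBev y hy hya).fderiv_eq]
    · rw [(hzero y hy hya).fderiv_eq]
      simp [wedge]
  · have h0 : fderiv ℝ (e.target.indicator (a ∘ e.symm)) y = 0 := by
      have hle : y ∉ tsupport (e.target.indicator (a ∘ e.symm)) := by
        intro h
        have hK : IsCompact (e '' tsupport a) :=
          (isClosed_tsupport a).isCompact.image_of_continuousOn (e.continuousOn.mono hsupp)
        have hsub : tsupport (e.target.indicator (a ∘ e.symm)) ⊆ e '' tsupport a := by
          refine closure_minimal (fun z hz => ?_) hK.isClosed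
          have hzt : z ∈ e.target := by
            by_contra hzt; exact hz (indicator_of_notMem hzt _)
          refine ⟨e.symm z, subset_tsupport _ ?_, e.right_inv hzt⟩
          exact fun h => hz (by rw [indicator_of_mem hzt]; exact h)
        obtain ⟨x, hx, rfl⟩ := hsub h
        exact hy (e.map_source (hsupp hx))
      rw [(notMem_tsupport_iff_eventuallyEq.1 hle).fderiv_eq]
      simp
    rw [h0]; simp [wedge]
  · rw [indicator_of_mem hy]
    by_cases hya : e.symm y ∈ tsupport a
    · rw [(hBev y hy hya).fderiv_eq]; rfl
    · rw [Function.comp_apply, image_eq_zero_of_notMem_tsupport hya, zero_mul, zero_mul]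
  · exact indicator_of_notMem hy _

theorem Complex.ae_im_ne_zero : ∀ᵐ z : ℂ, z.im ≠ 0 := by
  have h : volume ((LinearMap.ker Complex.imLm : Submodule ℝ ℂ) : Set ℂ) = 0 := by
    refine Measure.addHaar_submodule volume _ fun h => ?_
    have : Complex.I ∈ LinearMap.ker Complex.imLm := by rw [h]; trivial
    simp at this
  rw [ae_iff]
  convert h using 2
  ext z; simp

/-- Stokes' theorem for a function supported in a chart. -/
theorem setIntegral_chart_wedge_eq_zero {e : OpenPartialHomeomorph S ℂ} (he : IsSmoothChart e)
    {a u : S → ℝ} (ha : ContMDiff (𝓡 2) 𝓘(ℝ, ℝ) ∞ a) (hu : ContMDiff (𝓡 2) 𝓘(ℝ, ℝ) ∞ u)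
    (hsupp : tsupport a ⊆ e.source) :
    ∫ y in e.target, wedge (fderiv ℝ (a ∘ e.symm) y) (fderiv ℝ (u ∘ e.symm) y) = 0 := by
  obtain ⟨A, B, hA, hB, hAc, h1, h2, -, -⟩ := exists_planar_extension he ha hu hsupp
  rw [setIntegral_congr_fun e.open_target.measurableSet h1,
    setIntegral_eq_integral_of_forall_compl_eq_zero h2, integral_wedge_fderiv hA hB hAc]

/-- Stokes' theorem for a function supported in a chart, with a density that takes one constant
value above the real axis and another one below. -/
theorem setIntegral_chart_wedge_halves {e : OpenPartialHomeomorph S ℂ} (he : IsSmoothChart e)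
    {a u : S → ℝ} (ha : ContMDiff (𝓡 2) 𝓘(ℝ, ℝ) ∞ a) (hu : ContMDiff (𝓡 2) 𝓘(ℝ, ℝ) ∞ u)
    (hsupp : tsupport a ⊆ e.source) {g : S → ℝ} {p q : ℝ}
    (hp : ∀ y ∈ e.target, 0 < y.im → g (e.symm y) = p)
    (hq : ∀ y ∈ e.target, y.im < 0 → g (e.symm y) = q) :
    ∫ y in e.target, g (e.symm y) *
        wedge (fderiv ℝ (a ∘ e.symm) y) (fderiv ℝ (u ∘ e.symm) y) =
      (p - q) * ∫ x in {x : ℝ | (x : ℂ) ∈ e.target},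
        a (e.symm x) * fderiv ℝ (u ∘ e.symm) x 1 := by
  obtain ⟨A, B, hA, hB, hAc, h1, h2, h3, h4⟩ := exists_planar_extension he ha hu hsupp
  have hmeas : MeasurableSet {x : ℝ | (x : ℂ) ∈ e.target} :=
    (e.open_target.preimage Complex.continuous_ofReal).measurableSet
  have hup : MeasurableSet (Complex.im ⁻¹' Ioi 0) := Complex.measurable_im measurableSet_Ioi
  have hlo : MeasurableSet (Complex.im ⁻¹' Iio 0) := Complex.measurable_im measurableSet_Iio
  have hint := integrable_wedge_fderiv hA hB hAc
  rw [setIntegral_congr_fun hmeas (fun x hx => h3 x hx 1),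
    setIntegral_eq_integral_of_forall_compl_eq_zero
      (f := fun x : ℝ => A x * fderiv ℝ B x 1) (fun x hx => by rw [h4 _ hx, zero_mul])]
  have hae : ∫ y in e.target, g (e.symm y) *
        wedge (fderiv ℝ (a ∘ e.symm) y) (fderiv ℝ (u ∘ e.symm) y) =
      ∫ y, ((Complex.im ⁻¹' Ioi 0).indicator (fun y => p * wedge (fderiv ℝ A y) (fderiv ℝ B y)) y +
        (Complex.im ⁻¹' Iio 0).indicator
          (fun y => q * wedge (fderiv ℝ A y) (fderiv ℝ B y)) y) := by
    rw [← integral_indicator e.open_target.measurableSet]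
    refine integral_congr_ae ?_
    filter_upwards [Complex.ae_im_ne_zero] with y hy
    by_cases hyt : y ∈ e.target
    · rw [indicator_of_mem hyt, h1 y hyt]
      rcases lt_or_gt_of_ne hy with h | h
      · rw [indicator_of_notMem (by simp [h.le]), indicator_of_mem (by simpa using h),
          hq y hyt h, zero_add]
      · rw [indicator_of_mem (by simpa using h), indicator_of_notMem (by simp [h.le]),
          hp y hyt h, add_zero]
    · rw [indicator_of_notMem hyt]
      simp only [indicator, h2 y hyt, mul_zero, ite_self, add_zero]
  rw [hae, integral_add ((hint.const_mul p).indicator hup) ((hint.const_mul q).indicator hlo),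
    integral_indicator hup, integral_indicator hlo, integral_const_mul, integral_const_mul,
    setIntegral_upper_wedge_fderiv hA hB hAc, setIntegral_lower_wedge_fderiv hA hB hAc]
  ring

end Extension

/-! ### Charts that straighten an embedded curve -/

section AdaptedCharts

variable {S : Type*} [TopologicalSpace S] [ChartedSpace (EuclideanSpace ℝ (Fin 2)) S]

/-- A chart onto a square that straightens the closed curve `γ` to the real axis; `ψ` is the angle
of the point of the curve over a point of the axis. -/
structure IsAdaptedChart (γ : Circle → S) (e : OpenPartialHomeomorph S ℂ) (r : ℝ) (ψ : ℝ → ℝ) :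
    Prop where
  smooth : IsSmoothChart e
  pos : 0 < r
  target_eq : e.target = Ioo (-r) r ×ℂ Ioo (-r) r
  symm_ofReal : ∀ x ∈ Ioo (-r) r, e.symm x = γ (Circle.exp (ψ x))
  exists_angle : ∀ z, γ z ∈ e.source → ∃ x ∈ Ioo (-r) r, z = Circle.exp (ψ x)
  differentiableAt : ∀ x ∈ Ioo (-r) r, DifferentiableAt ℝ ψ x
  window : ∃ t₀, ∀ x ∈ Ioo (-r) r, ψ x ∈ Ioo (t₀ - Real.pi) (t₀ + Real.pi)

theorem exists_square_subset {o : Set ℂ} (ho : IsOpen o) (h0 : (0 : ℂ) ∈ o) :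
    ∃ r > 0, Ioo (-r) r ×ℂ Ioo (-r) r ⊆ o := by
  obtain ⟨ε, hε, h⟩ := Metric.isOpen_iff.1 ho 0 h0
  refine ⟨ε / 2, by positivity, fun z hz => h ?_⟩
  rw [Complex.mem_reProdIm] at hz
  rw [mem_ball_zero_iff]
  refine (Complex.norm_le_abs_re_add_abs_im z).trans_lt ?_
  have h1 := abs_lt.2 hz.1
  have h2 := abs_lt.2 hz.2
  linarith

/-- A continuous linear identification of the plane with `ℂ` that maps the first factor of
`ℝ¹ × F` to the real axis. -/
theorem exists_linear_straightening {F : Type*} [NormedAddCommGroup F] [NormedSpace ℝ F]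
    (E : (EuclideanSpace ℝ (Fin 1) × F) ≃L[ℝ] EuclideanSpace ℝ (Fin 2)) :
    ∃ L : EuclideanSpace ℝ (Fin 2) ≃L[ℝ] ℂ, ∃ l : EuclideanSpace ℝ (Fin 1) ≃L[ℝ] ℝ,
      ∀ w, L (E (w, 0)) = (l w : ℂ) := by
  have hfd : FiniteDimensional ℝ (EuclideanSpace ℝ (Fin 1) × F) :=
    E.symm.toLinearEquiv.finiteDimensional
  have hF : FiniteDimensional ℝ F :=
    Module.Finite.of_surjective (LinearMap.snd ℝ (EuclideanSpace ℝ (Fin 1)) F)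
      LinearMap.snd_surjective
  have hrank := E.toLinearEquiv.finrank_eq
  rw [Module.finrank_prod, finrank_euclideanSpace_fin, finrank_euclideanSpace_fin] at hrank
  have l : EuclideanSpace ℝ (Fin 1) ≃L[ℝ] ℝ :=
    ContinuousLinearEquiv.ofFinrankEq (by simp)
  have m : F ≃L[ℝ] ℝ := ContinuousLinearEquiv.ofFinrankEq (by simp; omega)
  refine ⟨E.symm.trans ((l.prodCongr m).trans Complex.equivRealProdCLM.symm), l, fun w => ?_⟩
  simp [Complex.equivRealProdCLM_symm_apply]

theorem det_fderiv_transition_ne_zero {e e' : OpenPartialHomeomorph S ℂ} (he : IsSmoothChart e)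
    (he' : IsSmoothChart e') {y : ℂ} (hy : y ∈ (e.symm.trans e').source) :
    (fderiv ℝ (e.symm.trans e') y).det ≠ 0 := by
  have hy' : e.symm.trans e' y ∈ (e'.symm.trans e).source := (e.symm.trans e').map_source hy
  have h1 := (he'.differentiableAt_transition he hy').hasFDerivAt.comp y
    (he.differentiableAt_transition he' hy).hasFDerivAt
  have h2 : (e'.symm.trans e) ∘ (e.symm.trans e') =ᶠ[𝓝 y] id := by
    filter_upwards [(e.symm.trans e').open_source.mem_nhds hy] with z hz
    exact (e.symm.trans e').left_inv hz
  have h3 := (h1.congr_of_eventuallyEq h2.symm).unique (hasFDerivAt_id y)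
  intro h0
  have h4 : ((fderiv ℝ (e'.symm.trans e) (e.symm.trans e' y)).comp
      (fderiv ℝ (e.symm.trans e') y)).det = 1 := by
    rw [h3]; simp [Complex.real_det_eq]
  have h5 : ∀ A B : ℂ →L[ℝ] ℂ, (A.comp B).det = A.det * B.det := fun A B => by
    simp only [ContinuousLinearMap.det, ContinuousLinearMap.toLinearMap_comp, LinearMap.det_comp]
  rw [h5, h0, mul_zero] at h4
  exact zero_ne_one h4

/-- The Jacobian determinant of a transition map has constant sign near every point. -/
theorem exists_isOpen_sign {e e' : OpenPartialHomeomorph S ℂ} (he : IsSmoothChart e)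
    (he' : IsSmoothChart e') {x : S} (hx : x ∈ e.source) (hx' : x ∈ e'.source) :
    ∃ (s : ℝ) (O : Set S), (s = 1 ∨ s = -1) ∧ IsOpen O ∧ x ∈ O ∧ O ⊆ e.source ∩ e'.source ∧
      ∀ y ∈ e.target, e.symm y ∈ O → 0 < s * (fderiv ℝ (e.symm.trans e') y).det := by
  set τ := e.symm.trans e' with hτ
  have hy : e x ∈ τ.source := ⟨e.map_source hx, by
    change e.symm (e x) ∈ e'.source
    rwa [e.left_inv hx]⟩
  have hcont : ContinuousOn (fun y => (fderiv ℝ τ y).det) τ.source := by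
    have h := (he.contDiffOn_transition he').continuousOn_fderiv_of_isOpen τ.open_source (by simp)
    exact ContinuousLinearMap.continuous_det.comp_continuousOn h
  obtain ⟨s, hs, hpos⟩ : ∃ s : ℝ, (s = 1 ∨ s = -1) ∧ 0 < s * (fderiv ℝ τ (e x)).det := by
    rcases lt_or_gt_of_ne (det_fderiv_transition_ne_zero he he' hy) with h | h
    · exact ⟨-1, Or.inr rfl, by linarith⟩
    · exact ⟨1, Or.inl rfl, by linarith⟩
  have hopen : IsOpen (τ.source ∩ (fun y => s * (fderiv ℝ τ y).det) ⁻¹' Ioi 0) :=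
    (continuousOn_const.mul hcont).isOpen_inter_preimage τ.open_source isOpen_Ioi
  refine ⟨s, _, hs, e.isOpen_inter_preimage hopen, ⟨hx, hy, hpos⟩, ?_, ?_⟩
  · rintro z ⟨hz, hz', -⟩
    refine ⟨hz, ?_⟩
    have h : e.symm (e z) ∈ e'.source := hz'.2
    rwa [e.left_inv hz] at h
  · rintro y hy ⟨-, h⟩
    rw [mem_preimage, e.right_inv hy] at h
    exact h.2

/-- A chart adapted to the curve is compared with a single chart of the oriented cover; this carries
its sign over to all the others. -/
theorem HasTransitionSign.trans {e e' e'' : OpenPartialHomeomorph S ℂ} (he : IsSmoothChart e)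
    (he' : IsSmoothChart e') (he'' : IsSmoothChart e'') (hsub : e.source ⊆ e'.source) {s : ℝ}
    (h : HasTransitionSign s e e') (h' : HasTransitionSign 1 e' e'') :
    HasTransitionSign s e e'' := by
  intro y hy
  have hy1 : y ∈ (e.symm.trans e').source := ⟨hy.1, hsub (e.map_target hy.1)⟩
  have hinv : e'.symm (e' (e.symm y)) = e.symm y := e'.left_inv hy1.2
  have hy2 : e.symm.trans e' y ∈ (e'.symm.trans e'').source := by
    refine ⟨((e.symm.trans e').map_source hy1).1, ?_⟩
    change e'.symm (e' (e.symm y)) ∈ e''.source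
    rw [hinv]; exact hy.2
  have heq : e.symm.trans e'' =ᶠ[𝓝 y] (e'.symm.trans e'') ∘ (e.symm.trans e') := by
    filter_upwards [(e.symm.trans e').open_source.mem_nhds hy1] with z hz
    have : e'.symm (e' (e.symm z)) = e.symm z := e'.left_inv hz.2
    simp [this]
  have hd : fderiv ℝ (e.symm.trans e'') y = (fderiv ℝ (e'.symm.trans e'') (e.symm.trans e' y)).comp
      (fderiv ℝ (e.symm.trans e') y) := by
    rw [heq.fderiv_eq]
    exact fderiv_comp y (he'.differentiableAt_transition he'' hy2)
      (he.differentiableAt_transition he' hy1)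
  rw [hd]
  simp only [ContinuousLinearMap.det, ContinuousLinearMap.toLinearMap_comp, LinearMap.det_comp]
  have h1 := h y hy1
  have h2 := h' _ hy2
  simp only [ContinuousLinearMap.det] at h1 h2
  nlinarith

variable [IsManifold (𝓡 2) ∞ S]

/-- The normal form `w ↦ (w, 0)` of an immersion puts the arc near `z₀` on the real axis. Being an
embedding then allows the chart to be shrunk until no other arc of the curve enters it. -/
theorem exists_isAdaptedChart {γ : Circle → S} (hγ : IsEmbeddedClosedCurve γ) (z₀ : Circle)
    {e' : OpenPartialHomeomorph S ℂ} (he' : IsSmoothChart e') (hz₀' : γ z₀ ∈ e'.source) :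
    ∃ e r ψ, IsAdaptedChart γ e r ψ ∧ γ z₀ ∈ e.source ∧ e.source ⊆ e'.source ∧
      ∃ s : ℝ, (s = 1 ∨ s = -1) ∧ HasTransitionSign s e e' := by
  obtain ⟨F, _, _, hF⟩ := hγ.isImmersion
  have h := hF z₀
  obtain ⟨L, l, hL⟩ := exists_linear_straightening h.equiv
  set φ := h.domChart with hφ
  set w₀ : ℝ := l (φ z₀) with hw₀
  have hz₀ : z₀ ∈ φ.source := h.mem_domChart_source
  let e₀ : OpenPartialHomeomorph S ℂ := h.codChart.transHomeomorph L.toHomeomorph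
  have he₀ : IsSmoothChart e₀ := IsSmoothChart.of_mem_maximalAtlas h.codChart_mem_maximalAtlas L
  let T : ℂ ≃ₜ ℂ := Homeomorph.addRight (-(w₀ : ℂ))
  let e₁ : OpenPartialHomeomorph S ℂ := e₀.transHomeomorph T
  have he₁ : IsSmoothChart e₁ := by
    refine ⟨?_, ?_⟩
    · have hT : ContDiff ℝ ∞ T := contDiff_id.add contDiff_const
      exact hT.contMDiff.comp_contMDiffOn he₀.1
    · have hT : ContDiff ℝ ∞ T.symm := contDiff_id.add contDiff_const
      exact he₀.2.comp hT.contMDiff.contMDiffOn fun y hy => hy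
  let q : ℝ → Circle := fun x => φ.symm (l.symm (x + w₀))
  have hq0 : q 0 = z₀ := by simp [q, hw₀, φ.left_inv hz₀]
  have hcurve : ∀ z ∈ φ.source, γ z ∈ e₁.source ∧ e₁ (γ z) = ((l (φ z) - w₀ : ℝ) : ℂ) := by
    intro z hz
    refine ⟨h.source_subset_preimage_source hz, ?_⟩
    have hmem : φ z ∈ (φ.extend (𝓡 1)).target := by simpa using φ.map_source hz
    have h1 := h.writtenInCharts hmem
    simp only [Function.comp_apply] at h1
    have h2 : h.codChart (γ z) = h.equiv (φ z, 0) := by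
      rw [← h1]
      simp [← hφ, φ.left_inv hz]
    have h3 : e₁ (γ z) = L (h.codChart (γ z)) + -(w₀ : ℂ) := rfl
    rw [h3, h2, hL]
    push_cast; ring
  -- On `W` the argument of `z / z₀` is a smooth function with values in the open interval `(-π,
  -- π)`; this provides the differentiable angle `ψ` and its window.
  let W : Set Circle := {z | ((z / z₀ : Circle) : ℂ) ∈ Complex.slitPlane}
  have hW : IsOpen W := Complex.isOpen_slitPlane.preimage
    (continuous_subtype_val.comp (continuous_id.div_const z₀))
  obtain ⟨s, O', hs, hO', hz₀O', hO's, hO'sign⟩ :=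
    exists_isOpen_sign he₁ he' (hcurve z₀ hz₀).1 hz₀'
  have hWφ : IsOpen (φ.source ∩ W ∩ γ ⁻¹' O') :=
    (φ.open_source.inter hW).inter (hO'.preimage hγ.isEmbedding.continuous)
  -- Here the topology of the circle is the one induced by `γ`: points of the curve in `O₀` come
  -- from the chosen neighborhood of `z₀`.
  obtain ⟨O₀, hO₀, hO₀φ⟩ := hγ.isEmbedding.isInducing.isOpen_iff.1 hWφ
  set O := O₀ ∩ O' with hOdef
  have hO : IsOpen O := hO₀.inter hO'
  have hOφ : γ ⁻¹' O = φ.source ∩ W ∩ γ ⁻¹' O' := by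
    rw [hOdef, preimage_inter, hO₀φ, inter_assoc, inter_self]
  have hz₀O : γ z₀ ∈ O := by
    have : z₀ ∈ γ ⁻¹' O := by
      rw [hOφ]; exact ⟨⟨hz₀, by simp [W]⟩, hz₀O'⟩
    exact this
  let e₂ := e₁.restrOpen O hO
  have he₂s : e₂.source = e₁.source ∩ O := e₁.restrOpen_source O hO
  have hz₀e₂ : γ z₀ ∈ e₂.source := by
    rw [he₂s]; exact ⟨(hcurve z₀ hz₀).1, hz₀O⟩
  have he₂0 : e₂ (γ z₀) = 0 := by
    change e₁ (γ z₀) = 0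
    rw [(hcurve z₀ hz₀).2]; simp [hw₀]
  have hcontl : Continuous fun x : ℝ => l.symm (x + w₀) :=
    l.symm.continuous.comp (continuous_id.add continuous_const)
  have hNopen : IsOpen {x : ℝ | l.symm (x + w₀) ∈ φ.target ∩ φ.symm ⁻¹' (W ∩ γ ⁻¹' O')} :=
    (φ.isOpen_inter_preimage_symm
      (hW.inter (hO'.preimage hγ.isEmbedding.continuous))).preimage hcontl
  have hN0 : (0 : ℝ) ∈ {x : ℝ | l.symm (x + w₀) ∈ φ.target ∩ φ.symm ⁻¹' (W ∩ γ ⁻¹' O')} := by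
    refine ⟨?_, ?_⟩
    · simpa [hw₀] using φ.map_source hz₀
    · change q 0 ∈ W ∩ γ ⁻¹' O'
      rw [hq0]; exact ⟨by simp [W], hz₀O'⟩
  obtain ⟨r₁, hr₁, hr₁s⟩ := exists_square_subset e₂.open_target
    (by rw [← he₂0]; exact e₂.map_source hz₀e₂)
  obtain ⟨r₂, hr₂, hr₂s⟩ := Metric.isOpen_iff.1 hNopen 0 hN0
  set r := min r₁ r₂ with hr
  have hrpos : 0 < r := lt_min hr₁ hr₂
  have hsq : Ioo (-r) r ×ℂ Ioo (-r) r ⊆ e₂.target := by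
    refine subset_trans (fun z hz => ?_) hr₁s
    rw [Complex.mem_reProdIm] at hz ⊢
    have := min_le_left r₁ r₂
    exact ⟨⟨by linarith [hz.1.1], by linarith [hz.1.2]⟩, ⟨by linarith [hz.2.1], by linarith [hz.2.2]⟩⟩
  have hN : ∀ x ∈ Ioo (-r) r, l.symm (x + w₀) ∈ φ.target ∧ q x ∈ W ∩ γ ⁻¹' O' := by
    intro x hx
    refine hr₂s ?_
    rw [mem_ball_zero_iff, Real.norm_eq_abs, abs_lt]
    have := min_le_right r₁ r₂
    exact ⟨by linarith [hx.1], by linarith [hx.2]⟩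
  have hsqo : IsOpen (Ioo (-r) r ×ℂ Ioo (-r) r) := isOpen_Ioo.reProdIm isOpen_Ioo
  let Q : Set S := e₂.source ∩ e₂ ⁻¹' (Ioo (-r) r ×ℂ Ioo (-r) r)
  have hQ : IsOpen Q := e₂.isOpen_inter_preimage hsqo
  let e := e₂.restrOpen Q hQ
  have hes : e.source = Q := by
    rw [e₂.restrOpen_source Q hQ]; exact inter_eq_right.2 inter_subset_left
  have het : e.target = Ioo (-r) r ×ℂ Ioo (-r) r := by
    have h1 : e.target = e₂.target ∩ e₂.symm ⁻¹' Q := rfl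
    rw [h1]
    ext y
    constructor
    · rintro ⟨hy1, hy2⟩
      have := hy2.2
      rwa [mem_preimage, e₂.right_inv hy1] at this
    · intro hy
      have hy1 := hsq hy
      refine ⟨hy1, e₂.map_target hy1, ?_⟩
      rwa [mem_preimage, e₂.right_inv hy1]
  let ψ : ℝ → ℝ := fun x => Complex.arg z₀ + Complex.arg ((q x / z₀ : Circle) : ℂ)
  have hψ : ∀ x, Circle.exp (ψ x) = q x := by
    intro x
    simp only [ψ]
    rw [Circle.exp_add, Circle.exp_arg, Circle.exp_arg, mul_div_cancel]
  have hlq : ∀ x ∈ Ioo (-r) r, q x ∈ φ.source ∧ l (φ (q x)) - w₀ = x := by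
    intro x hx
    refine ⟨φ.map_target (hN x hx).1, ?_⟩
    simp only [q]
    rw [φ.right_inv (hN x hx).1, l.apply_symm_apply]; ring
  refine ⟨e, r, ψ, ⟨(he₁.restrOpen hO).restrOpen hQ, hrpos, het, ?_, ?_, ?_, ?_⟩, ?_, ?_,
    s, hs, fun y hy => ?_⟩
  · intro x hx
    rw [hψ]
    obtain ⟨h1, h2⟩ := hlq x hx
    have h3 : e (γ (q x)) = x := by
      change e₁ (γ (q x)) = x
      rw [(hcurve _ h1).2, h2]
    have h4 : γ (q x) ∈ O := by
      have : q x ∈ γ ⁻¹' O := by rw [hOφ]; exact ⟨⟨h1, (hN x hx).2.1⟩, (hN x hx).2.2⟩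
      exact this
    have h5 : γ (q x) ∈ e.source := by
      rw [hes]
      refine ⟨by rw [he₂s]; exact ⟨(hcurve _ h1).1, h4⟩, ?_⟩
      have h3' : e₂ (γ (q x)) = x := h3
      rw [mem_preimage, h3', Complex.mem_reProdIm]
      simpa using ⟨hx, hrpos⟩
    rw [← h3, e.left_inv h5]
  · intro z hz
    have hz' := hz
    rw [hes] at hz'
    have hzφ : z ∈ φ.source := by
      have : z ∈ γ ⁻¹' O := by
        have := hz'.1
        rw [he₂s] at this
        exact this.2
      rw [hOφ] at this
      exact this.1.1
    have h1 : e₁ (γ z) ∈ Ioo (-r) r ×ℂ Ioo (-r) r := hz'.2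
    rw [(hcurve z hzφ).2, Complex.mem_reProdIm] at h1
    refine ⟨l (φ z) - w₀, by simpa using h1.1, ?_⟩
    rw [hψ]
    simp [q, φ.left_inv hzφ]
  · intro x hx
    have h1 : ContMDiffAt 𝓘(ℝ, ℝ) (𝓡 1) ∞ q x := by
      have h2 : ContMDiffAt (𝓡 1) (𝓡 1) ∞ φ.symm (l.symm (x + w₀)) :=
        (contMDiffOn_symm_of_mem_maximalAtlas h.domChart_mem_maximalAtlas).contMDiffAt
          (φ.open_target.mem_nhds (hN x hx).1)
      have h3 : ContDiff ℝ ∞ fun x : ℝ => l.symm (x + w₀) :=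
        l.symm.contDiff.comp (contDiff_id.add contDiff_const)
      exact h2.comp x h3.contMDiff.contMDiffAt
    have h4 : ContMDiff (𝓡 1) 𝓘(ℝ, ℂ) ∞ (fun z : Circle => (z : ℂ)) := by
      have : Fact (Module.finrank ℝ ℂ = 1 + 1) := finrank_real_complex_fact'
      exact contMDiff_coe_sphere
    have h5 : DifferentiableAt ℝ (fun x => (q x : ℂ)) x :=
      ((h4.contMDiffAt.comp x h1).contDiffAt).differentiableAt (by simp)
    have h6 : DifferentiableAt ℝ (fun x => ((q x / z₀ : Circle) : ℂ)) x := by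
      simp only [Circle.coe_div]
      exact h5.div_const _
    have h7 : DifferentiableAt ℝ (fun x => Complex.log ((q x / z₀ : Circle) : ℂ)) x :=
      (h6.hasDerivAt.clog_real (hN x hx).2.1).differentiableAt
    have h8 : DifferentiableAt ℝ (fun x => (Complex.log ((q x / z₀ : Circle) : ℂ)).im) x :=
      Complex.imCLM.differentiableAt.comp x h7
    simp only [Complex.log_im] at h8
    exact h8.const_add _
  · refine ⟨Complex.arg z₀, fun x hx => ?_⟩
    have h1 := Complex.mem_slitPlane_iff_arg.1 (hN x hx).2.1
    have h2 := Complex.neg_pi_lt_arg ((q x / z₀ : Circle) : ℂ)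
    have h3 := lt_of_le_of_ne (Complex.arg_le_pi ((q x / z₀ : Circle) : ℂ)) h1.1
    exact ⟨by simp only [ψ]; linarith, by simp only [ψ]; linarith⟩
  · rw [hes]
    refine ⟨hz₀e₂, ?_⟩
    rw [mem_preimage, he₂0, Complex.mem_reProdIm]
    simpa using hrpos
  · intro x hx
    rw [hes] at hx
    have hx2 := hx.1
    rw [he₂s] at hx2
    exact (hO's hx2.2.2).2
  · have h1 : e.symm y ∈ e.source := e.map_target hy.1
    rw [hes] at h1
    have h2 := h1.1
    rw [he₂s] at h2
    exact hO'sign y hy.1.1.1 h2.2.2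

end AdaptedCharts

/-! ### Integrals of one-forms along the curve, and its two sides in an adapted chart -/

section CurveIntegral

variable {S : Type*}

/-- The integral of the one-form `a du` along a closed curve. -/
def loopIntegral (γ : Circle → S) (a u : S → ℝ) : ℝ :=
  ∫ t in (0)..(2 * Real.pi), a (γ (Circle.exp t)) * deriv (fun t => u (γ (Circle.exp t))) t

variable [TopologicalSpace S] [ChartedSpace (EuclideanSpace ℝ (Fin 2)) S]

theorem IsEmbeddedClosedCurve.contDiff_comp {E : Type*} [NormedAddCommGroup E] [NormedSpace ℝ E]
    [IsManifold (𝓡 2) ∞ S] {γ : Circle → S} (hγ : IsEmbeddedClosedCurve γ) {u : S → E}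
    (hu : ContMDiff (𝓡 2) 𝓘(ℝ, E) ∞ u) : ContDiff ℝ ∞ fun t => u (γ (Circle.exp t)) :=
  (hu.comp (hγ.contMDiff.comp contMDiff_circleExp)).contDiff

theorem IsEmbeddedClosedCurve.continuous_integrand [IsManifold (𝓡 2) ∞ S] {γ : Circle → S}
    (hγ : IsEmbeddedClosedCurve γ) {a u : S → ℝ} (ha : ContMDiff (𝓡 2) 𝓘(ℝ, ℝ) ∞ a)
    (hu : ContMDiff (𝓡 2) 𝓘(ℝ, ℝ) ∞ u) :
    Continuous fun t => a (γ (Circle.exp t)) * deriv (fun t => u (γ (Circle.exp t))) t :=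
  (hγ.contDiff_comp ha).continuous.mul ((hγ.contDiff_comp hu).continuous_deriv (by simp))

theorem loopIntegral_sum_left [IsManifold (𝓡 2) ∞ S] {γ : Circle → S}
    (hγ : IsEmbeddedClosedCurve γ) {κ : Type*} (s : Finset κ) {a : κ → S → ℝ} {u : S → ℝ}
    (ha : ∀ k, ContMDiff (𝓡 2) 𝓘(ℝ, ℝ) ∞ (a k)) (hu : ContMDiff (𝓡 2) 𝓘(ℝ, ℝ) ∞ u) :
    loopIntegral γ (fun x => ∑ k ∈ s, a k x) u = ∑ k ∈ s, loopIntegral γ (a k) u := by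
  simp only [loopIntegral, Finset.sum_mul]
  exact intervalIntegral.integral_finsetSum fun k _ =>
    (hγ.continuous_integrand (ha k) hu).intervalIntegrable _ _

variable {γ : Circle → S} {e : OpenPartialHomeomorph S ℂ} {r : ℝ} {ψ : ℝ → ℝ}

namespace IsAdaptedChart

variable (h : IsAdaptedChart γ e r ψ)
include h

theorem ofReal_mem_target {x : ℝ} : (x : ℂ) ∈ e.target ↔ x ∈ Ioo (-r) r := by
  rw [h.target_eq, Complex.mem_reProdIm]
  have := h.pos
  simp [this]

theorem injOn_angle : InjOn ψ (Ioo (-r) r) := by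
  intro x hx y hy hxy
  have h1 : e.symm x = e.symm y := by rw [h.symm_ofReal x hx, h.symm_ofReal y hy, hxy]
  exact_mod_cast e.symm.injOn (h.ofReal_mem_target.2 hx) (h.ofReal_mem_target.2 hy) h1

/-- A continuous injective function on an interval is monotone or antitone; the derivative is not
required to be nonzero. -/
theorem exists_sign_deriv :
    ∃ s : ℝ, (s = 1 ∨ s = -1) ∧ ∀ x ∈ Ioo (-r) r, |deriv ψ x| = s * deriv ψ x := by
  have hcont : ContinuousOn ψ (Ioo (-r) r) := fun x hx =>
    (h.differentiableAt x hx).continuousAt.continuousWithinAt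
  have hlt : -r < r := by linarith [h.pos]
  have hd : ∀ x ∈ Ioo (-r) r, derivWithin ψ (Ioo (-r) r) x = deriv ψ x := fun x hx =>
    derivWithin_of_isOpen isOpen_Ioo hx
  rcases hcont.strictMonoOn_of_injOn_Ioo hlt h.injOn_angle with hm | hm
  · refine ⟨1, Or.inl rfl, fun x hx => ?_⟩
    rw [one_mul, abs_of_nonneg]
    rw [← hd x hx]; exact hm.monotoneOn.derivWithin_nonneg
  · refine ⟨-1, Or.inr rfl, fun x hx => ?_⟩
    rw [neg_one_mul, abs_of_nonpos]
    rw [← hd x hx]; exact hm.antitoneOn.derivWithin_nonpos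

/-- The curve integral of a one-form supported in an adapted chart. -/
theorem exists_loopIntegral_eq [IsManifold (𝓡 2) ∞ S] (hγ : IsEmbeddedClosedCurve γ) :
    ∃ s : ℝ, (s = 1 ∨ s = -1) ∧ ∀ a u : S → ℝ, (∀ x ∉ e.source, a x = 0) →
      ContMDiff (𝓡 2) 𝓘(ℝ, ℝ) ∞ u → loopIntegral γ a u =
        s * ∫ x in {x : ℝ | (x : ℂ) ∈ e.target}, a (e.symm x) * fderiv ℝ (u ∘ e.symm) x 1 := by
  obtain ⟨s, hs, hsd⟩ := h.exists_sign_deriv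
  refine ⟨s, hs, fun a u ha hu => ?_⟩
  obtain ⟨t₀, ht₀⟩ := h.window
  set G : ℝ → ℝ := fun t =>
    a (γ (Circle.exp t)) * deriv (fun t => u (γ (Circle.exp t))) t with hG
  have hset : {x : ℝ | (x : ℂ) ∈ e.target} = Ioo (-r) r := by
    ext x; exact h.ofReal_mem_target
  have hper : Function.Periodic G (2 * Real.pi) := by
    have h1 : ∀ t, Circle.exp (t + 2 * Real.pi) = Circle.exp t := Circle.exp_add_two_pi
    intro t
    simp only [hG, h1]
    congr 1
    rw [← deriv_comp_add_const]
    simp only [h1]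
  -- By periodicity the integral is moved to an interval of length `2π` that contains all the angles
  -- of the arc and on which `Circle.exp` is injective.
  have hwin : loopIntegral γ a u = ∫ t in Ioo (t₀ - Real.pi) (t₀ + Real.pi), G t := by
    have h1 := hper.intervalIntegral_add_eq 0 (t₀ - Real.pi)
    rw [zero_add, show t₀ - Real.pi + 2 * Real.pi = t₀ + Real.pi by ring,
      intervalIntegral.integral_of_le (a := t₀ - Real.pi) (by linarith [Real.pi_pos]),
      integral_Ioc_eq_integral_Ioo] at h1
    exact h1
  have himg : ψ '' Ioo (-r) r ⊆ Ioo (t₀ - Real.pi) (t₀ + Real.pi) := by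
    rintro _ ⟨x, hx, rfl⟩; exact ht₀ x hx
  have hzero : ∀ t ∈ Ioo (t₀ - Real.pi) (t₀ + Real.pi) \ ψ '' Ioo (-r) r, G t = 0 := by
    rintro t ⟨ht, htn⟩
    simp only [hG]
    rw [ha, zero_mul]
    intro hmem
    obtain ⟨x, hx, hxt⟩ := h.exists_angle _ hmem
    refine htn ⟨x, hx, ?_⟩
    have hinj := Circle.exp_injOn_Ioc (a := t₀ - Real.pi) (b := t₀ + Real.pi) (by linarith)
    exact hinj (Ioo_subset_Ioc_self (ht₀ x hx)) (Ioo_subset_Ioc_self ht) hxt.symm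
  rw [hwin, setIntegral_eq_of_subset_of_forall_sdiff_eq_zero measurableSet_Ioo himg hzero,
    integral_image_eq_integral_abs_deriv_smul measurableSet_Ioo
      (fun x hx => (h.differentiableAt x hx).hasDerivAt.hasDerivWithinAt) h.injOn_angle, hset,
    ← integral_const_mul]
  refine setIntegral_congr_fun measurableSet_Ioo fun x hx => ?_
  have hxt := h.ofReal_mem_target.2 hx
  have hd1 : HasDerivAt (fun x : ℝ => (u ∘ e.symm) x) (fderiv ℝ (u ∘ e.symm) x 1) x := by
    have := Complex.hasDerivAt_horizontal (p := u ∘ e.symm) (x := x) (y := 0)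
      (L := fderiv ℝ (u ∘ e.symm) x) (by
        simpa using (h.smooth.differentiableAt_comp hu hxt).hasFDerivAt)
    simpa using this
  have hd2 : HasDerivAt (fun x : ℝ => u (γ (Circle.exp (ψ x))))
      (deriv (fun t => u (γ (Circle.exp t))) (ψ x) * deriv ψ x) x :=
    HasDerivAt.comp (h₂ := fun t => u (γ (Circle.exp t))) x
      ((hγ.contDiff_comp hu).differentiable (by simp) _).hasDerivAt
      (h.differentiableAt x hx).hasDerivAt
  have heq : (fun x : ℝ => (u ∘ e.symm) x) =ᶠ[𝓝 x] fun x => u (γ (Circle.exp (ψ x))) := by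
    filter_upwards [isOpen_Ioo.mem_nhds hx] with y hy
    simp [h.symm_ofReal y hy]
  have hd3 := (hd2.congr_of_eventuallyEq heq).unique hd1
  rw [← hd3, h.symm_ofReal x hx, hsd x hx, smul_eq_mul]
  ring

theorem symm_notMem_range {y : ℂ} (hy : y ∈ e.target) (him : y.im ≠ 0) :
    e.symm y ∉ range γ := by
  rintro ⟨z, hz⟩
  obtain ⟨x, hx, rfl⟩ := h.exists_angle z (by rw [hz]; exact e.map_target hy)
  rw [← h.symm_ofReal x hx] at hz
  have := e.symm.injOn (h.ofReal_mem_target.2 hx) hy hz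
  rw [← this] at him
  simp at him

/-- Either open half of the square is convex, hence connected, and misses the curve, so it lies on
one side. -/
theorem symm_mem_or {U V : Set S} (hU : IsOpen U) (hV : IsOpen V) (hUV : Disjoint U V)
    (hcov : (range γ)ᶜ ⊆ U ∪ V) {I : Set ℝ} (hI : I = Ioo (-r) 0 ∨ I = Ioo 0 r) :
    (∀ y ∈ e.target, y.im ∈ I → e.symm y ∈ U) ∨ (∀ y ∈ e.target, y.im ∈ I → e.symm y ∈ V) := by
  have hIsub : I ⊆ Ioo (-r) r := by
    have := h.pos
    rcases hI with rfl | rfl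
    · exact Ioo_subset_Ioo_right this.le
    · exact Ioo_subset_Ioo_left (by linarith)
  have hIne : ∀ t ∈ I, t ≠ 0 := by
    rcases hI with rfl | rfl
    · exact fun t ht => ht.2.ne
    · exact fun t ht => ht.1.ne'
  have hconv : Convex ℝ I := by rcases hI with rfl | rfl <;> exact convex_Ioo _ _
  have hsub : Ioo (-r) r ×ℂ I ⊆ e.target := by
    rw [h.target_eq]
    exact fun z hz => ⟨hz.1, hIsub hz.2⟩
  have hpre : IsPreconnected (Ioo (-r) r ×ℂ I) :=
    (((convex_Ioo (-r) r).linear_preimage Complex.reLm).inter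
      (hconv.linear_preimage Complex.imLm)).isPreconnected
  have himg := hpre.image e.symm (e.continuousOn_symm.mono hsub)
  have hs : e.symm '' (Ioo (-r) r ×ℂ I) ⊆ U ∪ V := by
    rintro _ ⟨y, hy, rfl⟩
    exact hcov (h.symm_notMem_range (hsub hy) (hIne _ hy.2))
  have key : ∀ W : Set S, e.symm '' (Ioo (-r) r ×ℂ I) ⊆ W →
      ∀ y ∈ e.target, y.im ∈ I → e.symm y ∈ W := by
    intro W hW y hy hyI
    rw [h.target_eq] at hy
    exact hW ⟨y, ⟨hy.1, hyI⟩, rfl⟩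
  exact (himg.subset_or_subset hU hV hUV hs).imp (key U) (key V)

end IsAdaptedChart

end CurveIntegral

/-! ### Stokes' theorem for one side of a separating curve -/

theorem wedge_eq_zero_of_notMem_tsupport {S : Type*} [TopologicalSpace S]
    {e : OpenPartialHomeomorph S ℂ} {a u : S → ℝ} {y : ℂ} (hy : y ∈ e.target)
    (h : e.symm y ∉ tsupport a) :
    wedge (fderiv ℝ (a ∘ e.symm) y) (fderiv ℝ (u ∘ e.symm) y) = 0 := by
  have h0 : a ∘ e.symm =ᶠ[𝓝 y] fun _ => 0 :=
    (e.continuousAt_symm hy).eventually (notMem_tsupport_iff_eventuallyEq.1 h)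
  rw [h0.fderiv_eq]
  simp [wedge]

theorem HasTransitionSign.restrOpen_left {S : Type*} [TopologicalSpace S]
    {s : ℝ} {e e' : OpenPartialHomeomorph S ℂ} (h : HasTransitionSign s e e') {O : Set S}
    (hO : IsOpen O) : HasTransitionSign s (e.restrOpen O hO) e' :=
  fun y hy => h y ⟨hy.1.1, hy.2⟩

/-- On a compact manifold, every assignment of neighborhoods has a finite subordinate smooth
partition of unity. -/
theorem exists_finite_partition {S : Type*} [TopologicalSpace S]
    [ChartedSpace (EuclideanSpace ℝ (Fin 2)) S] [IsManifold (𝓡 2) ∞ S] [T2Space S] [CompactSpace S]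
    (O : S → Set S) (hO : ∀ x, IsOpen (O x)) (hx : ∀ x, x ∈ O x) :
    ∃ (t : Finset S) (ρ : t → S → ℝ), (∀ k, ContMDiff (𝓡 2) 𝓘(ℝ, ℝ) ∞ (ρ k)) ∧
      (∀ k x, 0 ≤ ρ k x) ∧ (∀ k : t, tsupport (ρ k) ⊆ O k) ∧ ∀ x, ∑ k, ρ k x = 1 := by
  obtain ⟨t, ht⟩ := isCompact_univ.elim_finite_subcover O hO
    (fun x _ => mem_iUnion.2 ⟨x, hx x⟩)
  obtain ⟨f, hf⟩ := SmoothPartitionOfUnity.exists_isSubordinate (𝓡 2) isClosed_univ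
    (fun k : t => O k) (fun k => hO k) (fun x hx => by
      obtain ⟨k, hk, hxk⟩ := mem_iUnion₂.1 (ht hx)
      exact mem_iUnion.2 ⟨⟨k, hk⟩, hxk⟩)
  refine ⟨t, fun k => f k, fun k => (f k).contMDiff, fun k x => f.nonneg k x, hf, fun x => ?_⟩
  rw [← f.sum_eq_one (mem_univ x), finsum_eq_sum_of_fintype]

namespace OrientedCover

variable {S : Type*} [TopologicalSpace S] [ChartedSpace (EuclideanSpace ℝ (Fin 2)) S]
  [MeasurableSpace S] [BorelSpace S] [CompactSpace S]
  {ι : Type*} [Fintype ι] (𝒞 : OrientedCover S ι)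

omit [MeasurableSpace S] [BorelSpace S] [CompactSpace S] in
theorem exists_mem_source (x : S) : ∃ i, x ∈ (𝒞.chart i).source := by
  by_contra! h
  have := 𝒞.sum_eq_one x
  rw [Finset.sum_eq_zero fun i _ => 𝒞.weight_eq_zero (h i)] at this
  exact zero_ne_one this

/-- The area integral of `da ∧ du` over `U`, when `a` is supported in a chart. -/
theorem area_indicator_eq {U : Set S} (hU : MeasurableSet U) {a u : S → ℝ}
    (ha : ContMDiff (𝓡 2) 𝓘(ℝ, ℝ) ∞ a) (hu : ContMDiff (𝓡 2) 𝓘(ℝ, ℝ) ∞ u)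
    {e : OpenPartialHomeomorph S ℂ} (he : IsSmoothChart e) {s : ℝ} (hs : s = 1 ∨ s = -1)
    (hsign : ∀ i, HasTransitionSign s e (𝒞.chart i)) (hsupp : tsupport a ⊆ e.source) :
    𝒞.area (U.indicator fun _ => 1) a u = s * ∫ y in e.target, U.indicator (fun _ => 1) (e.symm y) *
      wedge (fderiv ℝ (a ∘ e.symm) y) (fderiv ℝ (u ∘ e.symm) y) := by
  -- A density supported in the chart is needed in order to compute there; cutting `U` down to the
  -- support of `a` leaves the integrand unchanged.
  set g : S → ℝ := (U ∩ tsupport a).indicator fun _ => 1 with hg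
  have hgU : ∀ e' : OpenPartialHomeomorph S ℂ, ∀ y ∈ e'.target,
      U.indicator (fun _ => (1 : ℝ)) (e'.symm y) *
        wedge (fderiv ℝ (a ∘ e'.symm) y) (fderiv ℝ (u ∘ e'.symm) y) =
      g (e'.symm y) * wedge (fderiv ℝ (a ∘ e'.symm) y) (fderiv ℝ (u ∘ e'.symm) y) := by
    intro e' y hy
    by_cases h : e'.symm y ∈ tsupport a
    · congr 1
      by_cases hyU : e'.symm y ∈ U
      · rw [indicator_of_mem hyU, hg, indicator_of_mem (mem_inter hyU h)]
      · rw [indicator_of_notMem hyU, hg, indicator_of_notMem fun h' => hyU h'.1]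
    · rw [wedge_eq_zero_of_notMem_tsupport hy h, mul_zero, mul_zero]
  have hK : IsCompact (tsupport a) := (isClosed_tsupport a).isCompact
  have hgz : ∀ x ∉ tsupport a, g x = 0 := fun x hx => indicator_of_notMem (fun h => hx h.2) _
  rw [𝒞.area_congr hgU, 𝒞.area_eq_of_chart ha hu he hs hsign (fun x hx => hgz x fun h => hx (hsupp h)),
    setIntegral_congr_fun e.open_target.measurableSet (hgU e)]
  refine integrableOn_mul_wedge_fderiv he ha hu (measurable_const.indicator
    (hU.inter (isClosed_tsupport a).measurableSet)) (C := 1) (fun x => ?_) hK hsupp hgz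
  by_cases h : x ∈ U ∩ tsupport a
  · simp [hg, indicator_of_mem h]
  · simp [hg, indicator_of_notMem h]

variable [T2Space S] [IsManifold (𝓡 2) ∞ S] {γ : Circle → S}

/-- The factor `ε` combines the orientation `s` of an adapted chart, the direction `σ` of the curve
in it, and the jump `p - q` of the indicator of `U` across the axis. It is `0` if both halves of the
chart lie on the same side; only the connectedness of the surface rules this out. -/
theorem exists_local_stokes (hγ : IsEmbeddedClosedCurve γ) {U V : Set S} (hU : IsOpen U)
    (hV : IsOpen V) (hUV : Disjoint U V) (hcov : U ∪ V = (range γ)ᶜ) (z : Circle) :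
    ∃ (N : Set S) (ε : ℝ), IsOpen N ∧ γ z ∈ N ∧
      (ε = 1 ∨ ε = -1 ∨ ε = 0 ∧ (N \ range γ ⊆ U ∨ N \ range γ ⊆ V)) ∧
      ∀ a u : S → ℝ, ContMDiff (𝓡 2) 𝓘(ℝ, ℝ) ∞ a → ContMDiff (𝓡 2) 𝓘(ℝ, ℝ) ∞ u →
        tsupport a ⊆ N → 𝒞.area (U.indicator fun _ => 1) a u = ε * loopIntegral γ a u := by
  obtain ⟨i, hi⟩ := 𝒞.exists_mem_source (γ z)
  obtain ⟨e, r, ψ, he, hze, hei, s, hs, hsign⟩ := exists_isAdaptedChart hγ z (𝒞.smooth i) hi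
  obtain ⟨σ, hσ, hloop⟩ := he.exists_loopIntegral_eq hγ
  have hsign' : ∀ j, HasTransitionSign s e (𝒞.chart j) := fun j =>
    hsign.trans he.smooth (𝒞.smooth i) (𝒞.smooth j) hei (𝒞.sign i j)
  have him : ∀ y ∈ e.target, y.im ∈ Ioo (-r) r := by
    intro y hy
    rw [he.target_eq] at hy
    exact hy.2
  have hUp : ∀ W : Set S, (∀ y ∈ e.target, y.im ∈ Ioo 0 r → e.symm y ∈ W) →
      ∀ y ∈ e.target, 0 < y.im → e.symm y ∈ W :=
    fun W h y hy h0 => h y hy ⟨h0, (him y hy).2⟩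
  have hLo : ∀ W : Set S, (∀ y ∈ e.target, y.im ∈ Ioo (-r) 0 → e.symm y ∈ W) →
      ∀ y ∈ e.target, y.im < 0 → e.symm y ∈ W :=
    fun W h y hy h0 => h y hy ⟨(him y hy).1, h0⟩
  have hup := (he.symm_mem_or hU hV hUV hcov.ge (Or.inr rfl)).imp (hUp U) (hUp V)
  have hlo := (he.symm_mem_or hU hV hUV hcov.ge (Or.inl rfl)).imp (hLo U) (hLo V)
  have hind1 : ∀ x ∈ U, U.indicator (fun _ => (1 : ℝ)) x = 1 := fun x hx => indicator_of_mem hx _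
  have hind0 : ∀ x ∈ V, U.indicator (fun _ => (1 : ℝ)) x = 0 := fun x hx =>
    indicator_of_notMem (fun h => disjoint_left.1 hUV h hx) _
  have hσ2 : σ * σ = 1 := by rcases hσ with rfl | rfl <;> norm_num
  have main : ∀ p q : ℝ, (∀ y ∈ e.target, 0 < y.im → U.indicator (fun _ => (1 : ℝ)) (e.symm y) = p) →
      (∀ y ∈ e.target, y.im < 0 → U.indicator (fun _ => (1 : ℝ)) (e.symm y) = q) →
      ∀ a u : S → ℝ, ContMDiff (𝓡 2) 𝓘(ℝ, ℝ) ∞ a → ContMDiff (𝓡 2) 𝓘(ℝ, ℝ) ∞ u →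
        tsupport a ⊆ e.source →
        𝒞.area (U.indicator fun _ => 1) a u = (s * (p - q) * σ) * loopIntegral γ a u := by
    intro p q hp hq a u ha hu hsupp
    rw [𝒞.area_indicator_eq hU.measurableSet ha hu he.smooth hs hsign' hsupp,
      setIntegral_chart_wedge_halves he.smooth ha hu hsupp hp hq,
      hloop a u (fun x hx => image_eq_zero_of_notMem_tsupport fun h => hx (hsupp h)) hu]
    linear_combination (-(s * (p - q)) * (∫ x in {x : ℝ | (x : ℂ) ∈ e.target},
        a (e.symm x) * fderiv ℝ (u ∘ e.symm) x 1)) * hσ2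
  have hside : ∀ W : Set S, (∀ y ∈ e.target, 0 < y.im → e.symm y ∈ W) →
      (∀ y ∈ e.target, y.im < 0 → e.symm y ∈ W) → e.source \ range γ ⊆ W := by
    rintro W h1 h2 x ⟨hx, hxγ⟩
    have hxt := e.map_source hx
    rw [← e.left_inv hx]
    rcases lt_trichotomy (e x).im 0 with h | h | h
    · exact h2 _ hxt h
    · exfalso
      have hre : ((e x).re : ℂ) = e x := Complex.ext (by simp) (by simp [h])
      rw [← hre] at hxt
      have h3 := he.symm_ofReal _ (he.ofReal_mem_target.1 hxt)
      rw [hre, e.left_inv hx] at h3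
      exact hxγ ⟨_, h3.symm⟩
    · exact h1 _ hxt h
  have hsσ : s * σ = 1 ∨ s * σ = -1 := by
    rcases hs with rfl | rfl <;> rcases hσ with rfl | rfl <;> norm_num
  rcases hup with hup | hup <;> rcases hlo with hlo | hlo
  · exact ⟨e.source, _, e.open_source, hze, Or.inr (Or.inr ⟨by ring, Or.inl (hside U hup hlo)⟩),
      main 1 1 (fun y hy h => hind1 _ (hup y hy h)) fun y hy h => hind1 _ (hlo y hy h)⟩
  · refine ⟨e.source, _, e.open_source, hze, ?_,
      main 1 0 (fun y hy h => hind1 _ (hup y hy h)) fun y hy h => hind0 _ (hlo y hy h)⟩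
    rcases hsσ with h | h
    · left; linarith
    · right; left; linarith
  · refine ⟨e.source, _, e.open_source, hze, ?_,
      main 0 1 (fun y hy h => hind0 _ (hup y hy h)) fun y hy h => hind1 _ (hlo y hy h)⟩
    rcases hsσ with h | h
    · right; left; linarith
    · left; linarith
  · exact ⟨e.source, _, e.open_source, hze, Or.inr (Or.inr ⟨by ring, Or.inr (hside V hup hlo)⟩),
      main 0 0 (fun y hy h => hind0 _ (hup y hy h)) fun y hy h => hind0 _ (hlo y hy h)⟩

omit [MeasurableSpace S] [BorelSpace S] in
include 𝒞 in
/-- Near every point of an embedded closed curve there is a one-form with non-zero integral. -/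
theorem exists_loopIntegral_ne_zero (hγ : IsEmbeddedClosedCurve γ) (z : Circle) {O : Set S}
    (hO : IsOpen O) (hz : γ z ∈ O) :
    ∃ a u : S → ℝ, ContMDiff (𝓡 2) 𝓘(ℝ, ℝ) ∞ a ∧ ContMDiff (𝓡 2) 𝓘(ℝ, ℝ) ∞ u ∧ tsupport a ⊆ O ∧
      loopIntegral γ a u ≠ 0 := by
  obtain ⟨i, hi⟩ := 𝒞.exists_mem_source (γ z)
  obtain ⟨e, r, ψ, he, hze, hei, -⟩ := exists_isAdaptedChart hγ z
    ((𝒞.smooth i).restrOpen hO) (by rw [(𝒞.chart i).restrOpen_source]; exact ⟨hi, hz⟩)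
  obtain ⟨σ, hσ, hloop⟩ := he.exists_loopIntegral_eq hγ
  rw [(𝒞.chart i).restrOpen_source] at hei
  obtain ⟨a, ha, ha1, has, haI⟩ := exists_contMDiff_eventuallyEq_one (isClosed_singleton (x := γ z))
    e.open_source (singleton_subset_iff.2 hze)
  obtain ⟨b, hb, hb1, hbs, -⟩ := exists_contMDiff_eventuallyEq_one (isClosed_tsupport a)
    e.open_source has
  -- The function `u` is the first coordinate, cut off. Where `a` lives, `du` restricts to `dx` on
  -- the axis, so the loop integral is plus or minus the integral of the nonnegative bump `a`.
  have hu : ContMDiff (𝓡 2) 𝓘(ℝ, ℝ) ∞ fun x => b x * (e x).re := by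
    intro x
    by_cases hx : x ∈ e.source
    · have h1 : ContMDiffAt (𝓡 2) 𝓘(ℝ, ℂ) ∞ e x := he.smooth.1.contMDiffAt (e.open_source.mem_nhds hx)
      have h2 : ContMDiffAt (𝓡 2) 𝓘(ℝ, ℝ) ∞ (fun x => (e x).re) x :=
        Complex.reCLM.contDiff.contMDiff.contMDiffAt.comp x h1
      exact (hb x).mul h2
    · refine (contMDiffAt_const (c := (0 : ℝ))).congr_of_eventuallyEq ?_
      filter_upwards [notMem_tsupport_iff_eventuallyEq.1 fun h => hx (hbs h)] with y hy
      rw [hy]; simp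
  refine ⟨a, _, ha, hu, has.trans (hei.trans inter_subset_right), ?_⟩
  have haz : ∀ x ∉ e.source, a x = 0 := fun x hx =>
    image_eq_zero_of_notMem_tsupport fun h => hx (has h)
  rw [hloop a _ haz hu]
  refine mul_ne_zero (by rcases hσ with rfl | rfl <;> norm_num) ?_
  have hset : {x : ℝ | (x : ℂ) ∈ e.target} = Ioo (-r) r := by
    ext x; exact he.ofReal_mem_target
  have hcongr : ∀ x ∈ Ioo (-r) r, a (e.symm x) *
      fderiv ℝ ((fun x => b x * (e x).re) ∘ e.symm) x 1 = a (e.symm x) := by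
    intro x hx
    have hxt := he.ofReal_mem_target.2 hx
    by_cases hxa : e.symm x ∈ tsupport a
    · have h1 : (fun x => b x * (e x).re) ∘ e.symm =ᶠ[𝓝 (x : ℂ)] Complex.reCLM := by
        filter_upwards [e.open_target.mem_nhds hxt, (e.continuousAt_symm hxt).eventually
          (hb1 _ hxa)] with y hy hy1
        simp [hy1, e.right_inv hy]
      rw [h1.fderiv_eq, ContinuousLinearMap.fderiv]
      simp
    · rw [image_eq_zero_of_notMem_tsupport hxa, zero_mul]
  rw [hset, setIntegral_congr_fun measurableSet_Ioo hcongr]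
  have hcont : ContinuousOn (fun x : ℝ => a (e.symm x)) (Ioo (-r) r) :=
    ha.continuous.comp_continuousOn (e.continuousOn_symm.comp
      Complex.continuous_ofReal.continuousOn fun x hx => he.ofReal_mem_target.2 hx)
  obtain ⟨x₀, hx₀, hzx⟩ := he.exists_angle z hze
  have hax₀ : a (e.symm x₀) = 1 := by
    rw [he.symm_ofReal x₀ hx₀, ← hzx]
    exact (ha1 _ rfl).eq_of_nhds
  have hint : IntegrableOn (fun x : ℝ => a (e.symm x)) (Ioo (-r) r) := by
    refine Integrable.of_bound (hcont.aestronglyMeasurable measurableSet_Ioo) 1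
      (Eventually.of_forall fun x => ?_)
    rw [Real.norm_eq_abs, abs_of_nonneg (haI _).1]
    exact (haI _).2
  refine ne_of_gt ((setIntegral_pos_iff_support_of_nonneg_ae
    (Eventually.of_forall fun x => (haI _).1) hint).2 ?_)
  have hopen : IsOpen (Ioo (-r) r ∩ (fun x : ℝ => a (e.symm x)) ⁻¹' {0}ᶜ) :=
    hcont.isOpen_inter_preimage isOpen_Ioo isOpen_compl_singleton
  have hpos := hopen.measure_pos volume ⟨x₀, hx₀, by simp [hax₀]⟩
  refine hpos.trans_le (measure_mono ?_)
  rintro x ⟨hx, hx1⟩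
  exact ⟨hx1, hx⟩

/-- Stokes' theorem for one side `U` of a separating embedded curve. -/
theorem exists_stokes [ConnectedSpace S] (hγ : IsEmbeddedClosedCurve γ) {U V : Set S}
    (hU : IsOpen U) (hV : IsOpen V) (hUV : Disjoint U V) (hcov : U ∪ V = (range γ)ᶜ)
    (hUne : U.Nonempty) (hVne : V.Nonempty) :
    ∃ ε : ℝ, (ε = 1 ∨ ε = -1) ∧ ∀ a u : S → ℝ, ContMDiff (𝓡 2) 𝓘(ℝ, ℝ) ∞ a →
      ContMDiff (𝓡 2) 𝓘(ℝ, ℝ) ∞ u →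
        𝒞.area (U.indicator fun _ => 1) a u = ε * loopIntegral γ a u := by
  choose N ε hN hzN hε hst using 𝒞.exists_local_stokes hγ hU hV hUV hcov
  -- A one-form supported in both neighborhoods and with nonzero loop integral determines both
  -- factors, so `ε` is locally constant on the circle.
  have hloc : ∀ z z', γ z' ∈ N z → ε z' = ε z := by
    intro z z' hz'
    obtain ⟨a, u, ha, hu, hsupp, hne⟩ := 𝒞.exists_loopIntegral_ne_zero hγ z'
      ((hN z).inter (hN z')) ⟨hz', hzN z'⟩
    have h1 := hst z a u ha hu (hsupp.trans inter_subset_left)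
    have h2 := hst z' a u ha hu (hsupp.trans inter_subset_right)
    exact mul_right_cancel₀ hne (h2.symm.trans h1)
  have hcontγ : Continuous γ := hγ.isEmbedding.continuous
  have hconn : PreconnectedSpace Circle := by
    refine ⟨?_⟩
    rw [← Circle.exp_surjective.range_eq]
    exact isPreconnected_range Circle.exp.continuous
  have hconst : ∀ z z', ε z = ε z' := by
    have h1 : IsLocallyConstant ε := by
      rw [IsLocallyConstant.iff_eventually_eq]
      intro z
      filter_upwards [((hN z).preimage hcontγ).mem_nhds (hzN z)] with z' hz' using hloc z z' hz'
    exact fun z z' => h1.apply_eq_of_preconnectedSpace z z'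
  have hγU : ∀ z, γ z ∉ U ∪ V := fun z h => by
    rw [hcov] at h; exact h ⟨z, rfl⟩
  -- If `ε` were `0`, each point of the curve would have a neighborhood that is, off the curve,
  -- contained in `U` or in `V`. Adjoining these neighborhoods to `U` and `V` gives two open sets
  -- that cover the connected surface, so they meet, necessarily at a point of the curve. Near that
  -- point there are points off the curve, and these would lie in both `U` and `V`.
  have hε1 : ε 1 = 1 ∨ ε 1 = -1 := by
    rcases hε 1 with h | h | ⟨h0, -⟩
    · exact Or.inl h
    · exact Or.inr h
    exfalso
    have hside : ∀ z, N z \ range γ ⊆ U ∨ N z \ range γ ⊆ V := by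
      intro z
      rcases hε z with h | h | h
      · rw [hconst z 1, h0] at h; norm_num at h
      · rw [hconst z 1, h0] at h; norm_num at h
      · exact h.2
    set U' : Set S := U ∪ ⋃ z ∈ {z | N z \ range γ ⊆ U}, N z with hU'
    set V' : Set S := V ∪ ⋃ z ∈ {z | N z \ range γ ⊆ V}, N z with hV'
    have hU'o : IsOpen U' := hU.union (isOpen_biUnion fun z _ => hN z)
    have hV'o : IsOpen V' := hV.union (isOpen_biUnion fun z _ => hN z)
    have hU's : U' \ range γ ⊆ U := by
      rintro x ⟨hx | hx, hxγ⟩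
      · exact hx
      · obtain ⟨z, hz, hxz⟩ := mem_iUnion₂.1 hx
        exact hz ⟨hxz, hxγ⟩
    have hV's : V' \ range γ ⊆ V := by
      rintro x ⟨hx | hx, hxγ⟩
      · exact hx
      · obtain ⟨z, hz, hxz⟩ := mem_iUnion₂.1 hx
        exact hz ⟨hxz, hxγ⟩
    have hall : (univ : Set S) ⊆ U' ∪ V' := by
      intro x _
      by_cases hx : x ∈ range γ
      · obtain ⟨z, rfl⟩ := hx
        rcases hside z with h | h
        · exact Or.inl (Or.inr (mem_iUnion₂.2 ⟨z, h, hzN z⟩))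
        · exact Or.inr (Or.inr (mem_iUnion₂.2 ⟨z, h, hzN z⟩))
      · have : x ∈ U ∪ V := by rw [hcov]; exact hx
        exact this.imp Or.inl Or.inl
    obtain ⟨x, -, hxU, hxV⟩ := isPreconnected_univ U' V' hU'o hV'o hall
      (hUne.mono fun x hx => ⟨trivial, Or.inl hx⟩) (hVne.mono fun x hx => ⟨trivial, Or.inl hx⟩)
    have hxγ : x ∈ range γ := by
      by_contra h
      exact disjoint_left.1 hUV (hU's ⟨hxU, h⟩) (hV's ⟨hxV, h⟩)
    obtain ⟨z, rfl⟩ := hxγ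
    obtain ⟨i, hi⟩ := 𝒞.exists_mem_source (γ z)
    obtain ⟨e, r, ψ, he, hze, hei, -⟩ := exists_isAdaptedChart hγ z
      ((𝒞.smooth i).restrOpen (hU'o.inter hV'o))
      (by rw [(𝒞.chart i).restrOpen_source]; exact ⟨hi, hxU, hxV⟩)
    rw [(𝒞.chart i).restrOpen_source] at hei
    have hr := he.pos
    have hy : (⟨0, r / 2⟩ : ℂ) ∈ e.target := by
      rw [he.target_eq, Complex.mem_reProdIm]
      exact ⟨⟨by simpa using hr, hr⟩, ⟨by simp only; linarith, by simp only; linarith⟩⟩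
    have hyγ := he.symm_notMem_range hy (by simp only; linarith)
    have hy' := (hei (e.map_target hy)).2
    exact disjoint_left.1 hUV (hU's ⟨hy'.1, hyγ⟩) (hV's ⟨hy'.2, hyγ⟩)
  refine ⟨ε 1, hε1, fun a u ha hu => ?_⟩
  -- With a global factor at hand, Stokes' theorem becomes a local statement about `a`, to be summed
  -- over a partition of unity.
  have hlocal : ∀ x : S, ∃ O : Set S, IsOpen O ∧ x ∈ O ∧ ∀ a : S → ℝ,
      ContMDiff (𝓡 2) 𝓘(ℝ, ℝ) ∞ a → tsupport a ⊆ O →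
        𝒞.area (U.indicator fun _ => 1) a u = ε 1 * loopIntegral γ a u := by
    intro x
    have hoff : ∀ W : Set S, W ⊆ U ∪ V → ∀ a : S → ℝ, tsupport a ⊆ W →
        loopIntegral γ a u = 0 := by
      intro W hW a hsupp
      have h0 : ∀ z, a (γ z) = 0 := fun z =>
        image_eq_zero_of_notMem_tsupport fun h => hγU z (hW (hsupp h))
      simp [loopIntegral, h0]
    by_cases hx : x ∈ range γ
    · obtain ⟨z, rfl⟩ := hx
      refine ⟨N z, hN z, hzN z, fun a ha hsupp => ?_⟩
      rw [hst z a u ha hu hsupp, hconst z 1]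
    · have hxUV : x ∈ U ∪ V := by rw [hcov]; exact hx
      rcases hxUV with hxU | hxV
      · obtain ⟨i, hi⟩ := 𝒞.exists_mem_source x
        refine ⟨(𝒞.chart i).source ∩ U, (𝒞.chart i).open_source.inter hU, ⟨hi, hxU⟩,
          fun a ha hsupp => ?_⟩
        rw [hoff _ (inter_subset_right.trans subset_union_left) a hsupp, mul_zero]
        have he := (𝒞.smooth i).restrOpen hU
        set e := (𝒞.chart i).restrOpen U hU with hedef
        have hes : e.source = (𝒞.chart i).source ∩ U := (𝒞.chart i).restrOpen_source U hU
        rw [𝒞.area_indicator_eq hU.measurableSet ha hu he (Or.inl rfl)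
          (fun j => (𝒞.sign i j).restrOpen_left hU) (by rwa [hes])]
        rw [setIntegral_congr_fun e.open_target.measurableSet
          (g := fun y => wedge (fderiv ℝ (a ∘ e.symm) y) (fderiv ℝ (u ∘ e.symm) y)),
          setIntegral_chart_wedge_eq_zero he ha hu (by rwa [hes]), mul_zero]
        intro y hy
        have : e.symm y ∈ U := by
          have := e.map_target hy
          rw [hes] at this
          exact this.2
        simp only [indicator_of_mem this, one_mul]
      · refine ⟨V, hV, hxV, fun a ha hsupp => ?_⟩
        rw [hoff _ subset_union_right a hsupp, mul_zero, 𝒞.area_congr (g' := fun _ => 0)]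
        · simp [area]
        · intro e y hy
          rw [zero_mul]
          by_cases hya : e.symm y ∈ tsupport a
          · rw [indicator_of_notMem (fun h => disjoint_left.1 hUV h (hsupp hya)), zero_mul]
          · rw [wedge_eq_zero_of_notMem_tsupport hy hya, mul_zero]
  choose O hO hxO hOst using hlocal
  obtain ⟨t, ρ, hρ, -, hρs, hρ1⟩ := exists_finite_partition O hO hxO
  have hak : ∀ k, ContMDiff (𝓡 2) 𝓘(ℝ, ℝ) ∞ fun x => ρ k x * a x := fun k => (hρ k).mul ha
  have hsum : a = fun x => ∑ k, ρ k x * a x := by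
    funext x
    rw [← Finset.sum_mul, hρ1, one_mul]
  rw [hsum, 𝒞.area_sum_left Finset.univ hak hu (measurable_const.indicator hU.measurableSet)
    (C := 1), loopIntegral_sum_left hγ _ hak hu, Finset.mul_sum]
  · exact Finset.sum_congr rfl fun k _ =>
      hOst k _ (hak k) (tsupport_mul_subset_left.trans (hρs k))
  · intro x
    by_cases h : x ∈ U
    · simp [indicator_of_mem h]
    · simp [indicator_of_notMem h]

end OrientedCover

/-! ### The contribution of a zero that is the `n`-th power of a coordinate -/

/-- The derivative of `f ^ n` is that of `f` followed by multiplication by `c = n f^(n-1)`, whose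
real determinant is `|c|²`. -/
theorem Complex.det_fderiv_pow {f : ℂ → ℂ} {y : ℂ} (hf : DifferentiableAt ℝ f y) (n : ℕ) :
    (fderiv ℝ (fun y => f y ^ n) y).det = n ^ 2 * ‖f y‖ ^ (2 * (n - 1)) * (fderiv ℝ f y).det := by
  have hd : ∀ v, fderiv ℝ (fun y => f y ^ n) y v = (n * f y ^ (n - 1)) * fderiv ℝ f y v := by
    intro v
    rw [(hf.hasFDerivAt.pow n).fderiv]
    simp
  have hn : (n : ℝ) ^ 2 * ‖f y‖ ^ (2 * (n - 1)) = Complex.normSq (n * f y ^ (n - 1)) := by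
    rw [Complex.normSq_eq_norm_sq, norm_mul, norm_pow, mul_pow, ← pow_mul, mul_comm (n - 1)]
    simp
  rw [Complex.real_det_eq, Complex.real_det_eq, hd, hd, hn, Complex.normSq_apply]
  simp only [Complex.mul_re, Complex.mul_im]
  ring

/-- A map with invertible derivative at a zero maps arbitrarily small neighborhoods
diffeomorphically onto balls. -/
theorem exists_isOpen_image_eq_ball {f : ℂ → ℂ} {o : Set ℂ} (ho : IsOpen o)
    (hf : ContDiffOn ℝ ∞ f o) {y₀ : ℂ} (hy₀ : y₀ ∈ o) (h0 : f y₀ = 0)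
    (hdet : (fderiv ℝ f y₀).det ≠ 0) :
    ∃ (Y : Set ℂ) (r s : ℝ), IsOpen Y ∧ y₀ ∈ Y ∧ Y ⊆ o ∧ 0 < r ∧ (s = 1 ∨ s = -1) ∧ InjOn f Y ∧
      f '' Y = Metric.ball 0 r ∧ ∀ y ∈ Y, 0 < s * (fderiv ℝ f y).det := by
  have hfa : ContDiffAt ℝ ∞ f y₀ := hf.contDiffAt (ho.mem_nhds hy₀)
  have hd : HasFDerivAt f (((fderiv ℝ f y₀).toContinuousLinearEquivOfDetNeZero hdet : ℂ ≃L[ℝ] ℂ) :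
      ℂ →L[ℝ] ℂ) y₀ := (hfa.differentiableAt (by simp)).hasFDerivAt
  set Φ := hfa.toOpenPartialHomeomorph f hd (by simp) with hΦ
  have hΦf : ⇑Φ = f := hfa.toOpenPartialHomeomorph_coe hd (by simp)
  have hΦy : y₀ ∈ Φ.source := hfa.mem_toOpenPartialHomeomorph_source hd (by simp)
  obtain ⟨s, hs, hpos⟩ : ∃ s : ℝ, (s = 1 ∨ s = -1) ∧ 0 < s * (fderiv ℝ f y₀).det := by
    rcases lt_or_gt_of_ne hdet with h | h
    · exact ⟨-1, Or.inr rfl, by linarith⟩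
    · exact ⟨1, Or.inl rfl, by linarith⟩
  have hcont : ContinuousOn (fun y => s * (fderiv ℝ f y).det) o :=
    continuousOn_const.mul (ContinuousLinearMap.continuous_det.comp_continuousOn
      (hf.continuousOn_fderiv_of_isOpen ho (by simp)))
  set M := Φ.source ∩ (o ∩ (fun y => s * (fderiv ℝ f y).det) ⁻¹' Ioi 0) with hM
  have hMo : IsOpen M := Φ.open_source.inter (hcont.isOpen_inter_preimage ho isOpen_Ioi)
  have himg : IsOpen (f '' M) := by
    rw [← hΦf]
    exact Φ.isOpen_image_of_subset_source hMo inter_subset_left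
  obtain ⟨r, hr, hball⟩ := Metric.isOpen_iff.1 himg 0 ⟨y₀, ⟨hΦy, hy₀, hpos⟩, h0⟩
  refine ⟨M ∩ f ⁻¹' Metric.ball 0 r, r, s, ?_, ⟨⟨hΦy, hy₀, hpos⟩, by simp [h0, hr]⟩,
    fun y hy => hy.1.2.1, hr, hs, ?_, ?_, fun y hy => hy.1.2.2⟩
  · exact (hf.continuousOn.mono fun y hy => hy.2.1).isOpen_inter_preimage hMo Metric.isOpen_ball
  · have h := Φ.injOn
    rw [hΦf] at h
    exact h.mono fun y hy => hy.1.1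
  · rw [image_inter_preimage]
    exact inter_eq_right.2 hball

namespace OrientedCover

variable {S : Type*} [TopologicalSpace S] [ChartedSpace (EuclideanSpace ℝ (Fin 2)) S]
  [MeasurableSpace S] [BorelSpace S] [CompactSpace S] [T2Space S]
  {ι : Type*} [Fintype ι] (𝒞 : OrientedCover S ι)

omit [T2Space S] in
/-- Near a point where `h` is the `n`-th power of a coordinate, integrals of the pullback of a
density by `h` are integrals over a disk. -/
theorem exists_zero_neighborhood {h f : S → ℂ} (hh : ContMDiff (𝓡 2) 𝓘(ℝ, ℂ) ∞ h)
    (hf : ContMDiff (𝓡 2) 𝓘(ℝ, ℂ) ∞ f) {n : ℕ} (hn : 0 < n) {x : S} {i : ι}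
    (hxi : x ∈ (𝒞.chart i).source) (hhf : h =ᶠ[𝓝 x] fun x' => f x' ^ n) (hx : h x = 0)
    (hdet : (fderiv ℝ (f ∘ (𝒞.chart i).symm) (𝒞.chart i x)).det ≠ 0) {W : Set S} (hW : IsOpen W)
    (hxW : x ∈ W) :
    ∃ (O : Set S) (r : ℝ), IsOpen O ∧ x ∈ O ∧ O ⊆ W ∧ 0 < r ∧ (∀ x' ∈ O, h x' = 0 → x' = x) ∧
      ∃ s : ℝ, (s = 1 ∨ s = -1) ∧ ∀ D : ℂ → ℝ, Continuous D →
        𝒞.area (O.indicator fun x' => D (h x')) (fun x' => (h x').re) (fun x' => (h x').im) =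
          s * ∫ w in Metric.ball (0 : ℂ) r, D (w ^ n) * (n ^ 2 * ‖w‖ ^ (2 * (n - 1))) := by
  set e := 𝒞.chart i with he
  have hes := 𝒞.smooth i
  set y₀ := e x with hy₀
  have hy₀t : y₀ ∈ e.target := e.map_source hxi
  have hsymm : e.symm y₀ = x := e.left_inv hxi
  have hfx : f x = 0 := by
    have := hhf.eq_of_nhds
    rw [hx] at this
    exact pow_eq_zero_iff hn.ne' |>.1 this.symm
  obtain ⟨B, hBsub, hBo, hxB⟩ := mem_nhds_iff.1 hhf
  -- The closed ball provides the compact set that integrability in the chart requires.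
  obtain ⟨ρ, hρ, hρt⟩ := Metric.nhds_basis_closedBall.mem_iff.1 (e.open_target.mem_nhds hy₀t)
  have hoO : IsOpen (e.target ∩ e.symm ⁻¹' (B ∩ W)) := e.isOpen_inter_preimage_symm (hBo.inter hW)
  obtain ⟨Y, r, s, hY, hy₀Y, hYo, hr, hs, hinj, himg, hsign⟩ :=
    exists_isOpen_image_eq_ball (f := f ∘ e.symm) (hoO.inter (Metric.isOpen_ball (x := y₀) (ε := ρ)))
      ((hes.contDiffOn_comp hf).mono fun y hy => hy.1.1) (y₀ := y₀)
      ⟨⟨hy₀t, by rw [mem_preimage, hsymm]; exact ⟨hxB, hxW⟩⟩, Metric.mem_ball_self hρ⟩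
      (by rw [Function.comp_apply, hsymm, hfx]) hdet
  have hYt : Y ⊆ e.target := fun y hy => (hYo hy).1.1
  set O := e.source ∩ e ⁻¹' Y with hO
  have hxO : x ∈ O := ⟨hxi, hy₀Y⟩
  have hOY : ∀ y ∈ e.target, e.symm y ∈ O ↔ y ∈ Y := by
    intro y hy
    rw [hO, mem_inter_iff, mem_preimage, e.right_inv hy]
    exact and_iff_right (e.map_target hy)
  have hOBW : ∀ x' ∈ O, x' ∈ B ∧ x' ∈ W := by
    rintro x' ⟨hx', hx'Y⟩
    have := (hYo hx'Y).1.2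
    rwa [mem_preimage, e.left_inv hx'] at this
  refine ⟨O, r, e.isOpen_inter_preimage hY, hxO, fun x' hx' => (hOBW x' hx').2, hr, ?_, s, hs, ?_⟩
  · intro x' hx' h0
    have h1 : f x' = 0 := by
      have := hBsub (hOBW x' hx').1
      rw [mem_ofPred_eq, h0] at this
      exact pow_eq_zero_iff hn.ne' |>.1 this.symm
    have h2 : e x' = y₀ := hinj hx'.2 hy₀Y (by
      simp only [Function.comp_apply]
      rw [e.left_inv hx'.1, hsymm, h1, hfx])
    exact e.injOn hx'.1 hxi h2
  · intro D hD
    have hre : ContMDiff (𝓡 2) 𝓘(ℝ, ℝ) ∞ fun x' => (h x').re :=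
      Complex.reCLM.contDiff.contMDiff.comp hh
    have him : ContMDiff (𝓡 2) 𝓘(ℝ, ℝ) ∞ fun x' => (h x').im :=
      Complex.imCLM.contDiff.contMDiff.comp hh
    have hDh : Continuous fun x' => D (h x') := hD.comp hh.continuous
    obtain ⟨C, hC⟩ := isCompact_univ.exists_bound_of_continuousOn hDh.continuousOn
    have hgz : ∀ x' ∉ e.symm '' Metric.closedBall y₀ ρ, O.indicator (fun x' => D (h x')) x' = 0 := by
      intro x' hx'
      refine indicator_of_notMem (fun hO' => hx' ?_) _
      exact ⟨e x', Metric.ball_subset_closedBall (hYo hO'.2).2, e.left_inv hO'.1⟩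
    have hKs : e.symm '' Metric.closedBall y₀ ρ ⊆ e.source := by
      rintro _ ⟨y, hy, rfl⟩
      exact e.map_target (hρt hy)
    have hint := integrableOn_mul_wedge_fderiv (φ := O.indicator fun x' => D (h x')) hes hre him
      (hDh.measurable.indicator (e.isOpen_inter_preimage hY).measurableSet) (C := C)
      (fun x' => by
        by_cases hx' : x' ∈ O
        · rw [indicator_of_mem hx']; exact hC x' trivial
        · rw [indicator_of_notMem hx', abs_zero]
          exact (norm_nonneg _).trans (hC x trivial))
      ((isCompact_closedBall y₀ ρ).image_of_continuousOn (e.continuousOn_symm.mono hρt)) hKs hgz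
    rw [𝒞.area_eq_of_chart hre him hes (Or.inl rfl) (fun j => 𝒞.sign i j)
      (fun x' hx' => indicator_of_notMem (fun h' => hx' h'.1) _) hint, one_mul,
      setIntegral_eq_of_subset_of_forall_sdiff_eq_zero e.open_target.measurableSet hYt, ← himg,
      ← integral_comp_mul_det hY.measurableSet
        (fun y hy => (hes.differentiableAt_comp hf (hYt hy)).hasFDerivAt) hinj hs hsign]
    · refine setIntegral_congr_fun hY.measurableSet fun y hy => ?_
      have hyt := hYt hy
      have hyO := (hOY y hyt).2 hy
      have hd : DifferentiableAt ℝ (h ∘ e.symm) y := hes.differentiableAt_comp hh hyt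
      have hw : wedge (fderiv ℝ ((fun x' => (h x').re) ∘ e.symm) y)
          (fderiv ℝ ((fun x' => (h x').im) ∘ e.symm) y) = (fderiv ℝ (h ∘ e.symm) y).det := by
        rw [← wedge_re_im]
        congr 1
        · exact (Complex.reCLM.hasFDerivAt.comp y hd.hasFDerivAt).fderiv
        · exact (Complex.imCLM.hasFDerivAt.comp y hd.hasFDerivAt).fderiv
      have hev : h ∘ e.symm =ᶠ[𝓝 y] fun y => (f ∘ e.symm) y ^ n := by
        filter_upwards [(e.continuousAt_symm hyt).preimage_mem_nhds
          (hBo.mem_nhds (hOBW _ hyO).1)] with z hz using hBsub hz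
      have hval : h (e.symm y) = (f ∘ e.symm) y ^ n := hev.eq_of_nhds
      rw [indicator_of_mem hyO, hw, hev.fderiv_eq, hval,
        Complex.det_fderiv_pow (hes.differentiableAt_comp hf hyt)]
      ring
    · intro y hy
      rw [indicator_of_notMem (fun h' => hy.2 ((hOY y hy.1).1 h')), zero_mul]

/-- Let the zeros of `h` be `n`-th powers of coordinates. Then, for a suitable smoothing of the
angular form on the plane, the integral over `U` of the pullback by `h` of its differential is a
multiple of `2πn`. -/
theorem exists_area_eq_int {h : S → ℂ} (hh : ContMDiff (𝓡 2) 𝓘(ℝ, ℂ) ∞ h) {n : ℕ} (hn : 0 < n)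
    (hzero : ∀ x, h x = 0 → ∃ (i : ι) (f : S → ℂ), x ∈ (𝒞.chart i).source ∧
      ContMDiff (𝓡 2) 𝓘(ℝ, ℂ) ∞ f ∧ (h =ᶠ[𝓝 x] fun x' => f x' ^ n) ∧
      (fderiv ℝ (f ∘ (𝒞.chart i).symm) (𝒞.chart i x)).det ≠ 0)
    {U V K : Set S} (hU : IsOpen U) (hV : IsOpen V) (hUV : Disjoint U V) (hcov : U ∪ V = Kᶜ)
    (hK : IsCompact K) (hKz : ∀ x ∈ K, h x ≠ 0) :
    ∃ κ : ℝ → ℝ, ContDiff ℝ ∞ κ ∧ (∀ x ∈ K, κ (‖h x‖ ^ 2) = (‖h x‖ ^ 2)⁻¹) ∧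
      ∃ N : ℤ, 𝒞.area (fun x => U.indicator (fun _ => 1) x *
          (2 * deriv (fun s => s * κ s) (‖h x‖ ^ 2))) (fun x => (h x).re) (fun x => (h x).im) =
        2 * Real.pi * n * N := by
  classical
  set Z : Set S := {x | h x = 0} with hZ
  have hZc : IsCompact Z := (isClosed_eq hh.continuous continuous_const).isCompact
  have hzUV : ∀ x ∈ Z, x ∈ U ∪ V := by
    intro x hx
    rw [hcov]
    exact fun hxK => hKz x hxK hx
  choose! i f hi hf hhf hdet using hzero
  -- The zeros are isolated and form a compact set.
  have hfin : Z.Finite := by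
    have hiso : ∀ x ∈ Z, ∃ O : Set S, IsOpen O ∧ x ∈ O ∧ ∀ x' ∈ O, h x' = 0 → x' = x := by
      intro x hx
      obtain ⟨O, r, hO, hxO, -, -, huniq, -⟩ := 𝒞.exists_zero_neighborhood hh (hf x hx) hn
        (hi x hx) (hhf x hx) hx (hdet x hx) isOpen_univ (mem_univ x)
      exact ⟨O, hO, hxO, huniq⟩
    choose! O hO hxO huniq using hiso
    obtain ⟨t, htZ, ht⟩ := hZc.elim_nhds_subcover O fun x hx => (hO x hx).mem_nhds (hxO x hx)
    refine t.finite_toSet.subset fun x hx => ?_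
    obtain ⟨y, hy, hxy⟩ := mem_iUnion₂.1 (ht hx)
    rw [huniq y (htZ y hy) x hxy hx]
    exact hy
  obtain ⟨W, hW, hWd⟩ := hfin.t2_separation
  have hnbhd : ∀ x ∈ Z, ∃ (O : Set S) (r s : ℝ), IsOpen O ∧ x ∈ O ∧ O ⊆ W x ∧
      (O ⊆ U ∨ O ⊆ V) ∧ 0 < r ∧ (s = 1 ∨ s = -1) ∧ ∀ D : ℂ → ℝ, Continuous D →
        𝒞.area (O.indicator fun x' => D (h x')) (fun x' => (h x').re) (fun x' => (h x').im) =
          s * ∫ w in Metric.ball (0 : ℂ) r, D (w ^ n) * (n ^ 2 * ‖w‖ ^ (2 * (n - 1))) := by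
    intro x hx
    have key : ∀ A : Set S, IsOpen A → x ∈ A → ∃ (O : Set S) (r s : ℝ), IsOpen O ∧ x ∈ O ∧
        O ⊆ W x ∧ O ⊆ A ∧ 0 < r ∧ (s = 1 ∨ s = -1) ∧ ∀ D : ℂ → ℝ, Continuous D →
        𝒞.area (O.indicator fun x' => D (h x')) (fun x' => (h x').re) (fun x' => (h x').im) =
          s * ∫ w in Metric.ball (0 : ℂ) r, D (w ^ n) * (n ^ 2 * ‖w‖ ^ (2 * (n - 1))) := by
      intro A hA hxA
      obtain ⟨O, r, hO, hxO, hOW, hr, -, s, hs, hD⟩ := 𝒞.exists_zero_neighborhood hh (hf x hx) hn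
        (hi x hx) (hhf x hx) hx (hdet x hx) ((hW x).2.inter hA) ⟨(hW x).1, hxA⟩
      exact ⟨O, r, s, hO, hxO, hOW.trans inter_subset_left, hOW.trans inter_subset_right, hr, hs, hD⟩
    rcases hzUV x hx with hxU | hxV
    · obtain ⟨O, r, s, h1, h2, h3, h4, h5⟩ := key U hU hxU
      exact ⟨O, r, s, h1, h2, h3, Or.inl h4, h5⟩
    · obtain ⟨O, r, s, h1, h2, h3, h4, h5⟩ := key V hV hxV
      exact ⟨O, r, s, h1, h2, h3, Or.inr h4, h5⟩
  choose! O r s hO hxO hOW hOUV hr hs hD using hnbhd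
  set Zf := hfin.toFinset with hZf
  have hmem : ∀ x, x ∈ Zf ↔ x ∈ Z := fun x => hfin.mem_toFinset
  -- a lower bound for `‖h‖²` away from the zeros
  have hbound : ∃ δ : ℝ, 0 < δ ∧ (∀ x, x ∈ K ∪ (⋃ z ∈ Z, O z)ᶜ → δ < ‖h x‖ ^ 2) ∧
      ∀ z ∈ Z, δ < r z ^ (2 * n) := by
    have hC : IsCompact (K ∪ (⋃ z ∈ Z, O z)ᶜ) :=
      hK.union (isOpen_biUnion hO).isClosed_compl.isCompact
    have hpos : ∀ x ∈ K ∪ (⋃ z ∈ Z, O z)ᶜ, 0 < ‖h x‖ ^ 2 := by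
      rintro x (hx | hx)
      · have := norm_pos_iff.2 (hKz x hx); positivity
      · have : h x ≠ 0 := fun h0 => hx (mem_iUnion₂.2 ⟨x, h0, hxO x h0⟩)
        have := norm_pos_iff.2 this; positivity
    obtain ⟨δ₁, hδ₁, h1⟩ := hC.exists_forall_le' (f := fun x => ‖h x‖ ^ 2) (a := 0)
      (hh.continuous.norm.pow 2).continuousOn hpos
    have h2 : ∀ z ∈ Zf, 0 < r z ^ (2 * n) := fun z hz => pow_pos (hr z ((hmem z).1 hz)) _
    obtain ⟨δ₂, hδ₂, h3⟩ : ∃ δ₂ : ℝ, 0 < δ₂ ∧ ∀ z ∈ Zf, δ₂ ≤ r z ^ (2 * n) := by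
      rcases Zf.eq_empty_or_nonempty with he | he
      · exact ⟨1, one_pos, by simp [he]⟩
      · obtain ⟨z, hz, hmin⟩ := Zf.exists_min_image (fun z => r z ^ (2 * n)) he
        exact ⟨_, h2 z hz, hmin⟩
    refine ⟨min δ₁ δ₂ / 2, by positivity, fun x hx => ?_, fun z hz => ?_⟩
    · have := h1 x hx
      have := min_le_left δ₁ δ₂
      linarith
    · have := h3 z ((hmem z).2 hz)
      have := min_le_right δ₁ δ₂
      linarith
  obtain ⟨δ, hδ, hδK, hδr⟩ := hbound
  obtain ⟨κ, hκ, hκ1⟩ := exists_contDiff_eq_inv hδ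
  set m : ℝ → ℝ := fun s => s * κ s with hm
  have hmc : ContDiff ℝ 1 m := contDiff_id.mul (hκ.of_le (mod_cast le_top))
  have hm' : ∀ s, δ < s → deriv m s = 0 := fun s hs => by
    have : m =ᶠ[𝓝 s] fun _ => 1 := by
      filter_upwards [Ioi_mem_nhds hs] with t ht
      have ht : δ < t := ht
      simp only [hm, hκ1 t ht.le]
      exact mul_inv_cancel₀ (by linarith)
    rw [this.deriv_eq, deriv_const]
  -- The coefficient of the differential of the smoothed angular form. It vanishes for `‖w‖² > δ`,
  -- so `D ∘ h` vanishes on `K` and outside the neighborhoods `O z`.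
  set D : ℂ → ℝ := fun w => 2 * deriv m (‖w‖ ^ 2) with hDdef
  have hDc : Continuous D := by
    have := hmc.continuous_deriv le_rfl
    fun_prop
  have hDz : ∀ w, δ < ‖w‖ ^ 2 → D w = 0 := fun w hw => by simp only [hDdef, hm' _ hw, mul_zero]
  -- As `δ < r z ^ (2n)`, the disk already contains the support, and the integral over it is the
  -- full one.
  have hball : ∀ z ∈ Z, ∫ w in Metric.ball (0 : ℂ) (r z), D (w ^ n) *
      (n ^ 2 * ‖w‖ ^ (2 * (n - 1))) = 2 * Real.pi * n := by
    intro z hz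
    rw [setIntegral_eq_integral_of_forall_compl_eq_zero, ← integral_polar_pow hκ hδ hκ1 hn]
    · refine integral_congr_ae (Eventually.of_forall fun w => ?_)
      simp only [hDdef, norm_pow, ← pow_mul, mul_comm n 2, hm]
    · intro w hw
      rw [hDz, zero_mul]
      rw [mem_ball_zero_iff, not_lt] at hw
      rw [norm_pow, ← pow_mul, mul_comm n 2]
      exact (hδr z hz).trans_le (pow_le_pow_left₀ (hr z hz).le hw _)
  refine ⟨κ, hκ, fun x hx => hκ1 _ (hδK x (Or.inl hx)).le, ?_⟩
  -- The contribution of the zero `z`, counted only when it lies in `U`. The sets `O z` are disjoint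
  -- and each lies on one side, so the contributions add up to the density on `U`.
  set g : S → S → ℝ := fun z => if z ∈ Z ∧ O z ⊆ U then (O z).indicator fun x => D (h x) else 0
    with hg
  have hsum : (fun x => U.indicator (fun _ => 1) x *
      (2 * deriv (fun s => s * κ s) (‖h x‖ ^ 2))) = fun x => ∑ z ∈ Zf, g z x := by
    funext x
    change U.indicator (fun _ => (1 : ℝ)) x * D (h x) = _
    have hother : ∀ z ∈ Zf, x ∉ O z → g z x = 0 := by
      intro z hz hxz
      simp only [hg]
      split_ifs
      · exact indicator_of_notMem hxz _
      · rfl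
    by_cases hx : x ∈ ⋃ z ∈ Z, O z
    · obtain ⟨z, hz, hxz⟩ := mem_iUnion₂.1 hx
      rw [Finset.sum_eq_single z]
      · rcases hOUV z hz with hzU | hzV
        · rw [indicator_of_mem (hzU hxz), one_mul]
          simp only [hg]
          rw [if_pos ⟨hz, hzU⟩, indicator_of_mem hxz]
        · have hxU : x ∉ U := fun h' => disjoint_left.1 hUV h' (hzV hxz)
          rw [indicator_of_notMem hxU, zero_mul]
          simp only [hg]
          rw [if_neg fun h' => hxU (h'.2 hxz)]
          rfl
      · intro z' hz' hne
        refine hother z' hz' fun hxz' => ?_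
        exact disjoint_left.1 (hWd ((hmem z').1 hz') hz hne) (hOW z' ((hmem z').1 hz') hxz')
          (hOW z hz hxz)
      · intro hz'
        exact absurd ((hmem z).2 hz) hz'
    · rw [hDz _ (hδK x (Or.inr hx)), mul_zero, Finset.sum_eq_zero]
      intro z hz
      exact hother z hz fun hxz => hx (mem_iUnion₂.2 ⟨z, (hmem z).1 hz, hxz⟩)
  have hre : ContMDiff (𝓡 2) 𝓘(ℝ, ℝ) ∞ fun x' => (h x').re :=
    Complex.reCLM.contDiff.contMDiff.comp hh
  have him : ContMDiff (𝓡 2) 𝓘(ℝ, ℝ) ∞ fun x' => (h x').im :=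
    Complex.imCLM.contDiff.contMDiff.comp hh
  have hDh : Continuous fun x' => D (h x') := hDc.comp hh.continuous
  obtain ⟨C, hC⟩ := isCompact_univ.exists_bound_of_continuousOn hDh.continuousOn
  have hgm : ∀ z, Measurable (g z) := by
    intro z
    simp only [hg]
    split_ifs with hz
    · exact hDh.measurable.indicator (hO z hz.1).measurableSet
    · exact measurable_const
  have hgb : ∀ z x, |g z x| ≤ max C 0 := by
    intro z x
    simp only [hg]
    split_ifs with hz
    · by_cases hx : x ∈ O z
      · rw [indicator_of_mem hx]; exact (hC x trivial).trans (le_max_left _ _)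
      · rw [indicator_of_notMem hx, abs_zero]; exact le_max_right _ _
    · simp
  have hterm : ∀ z ∈ Zf, ∃ N : ℤ, 𝒞.area (g z) (fun x => (h x).re) (fun x => (h x).im) =
      2 * Real.pi * n * N := by
    intro z hz
    have hz' := (hmem z).1 hz
    by_cases hzU : O z ⊆ U
    · have hgz : g z = (O z).indicator fun x => D (h x) := if_pos ⟨hz', hzU⟩
      rw [hgz, hD z hz' D hDc, hball z hz']
      rcases hs z hz' with h1 | h1
      · exact ⟨1, by rw [h1]; push_cast; ring⟩
      · exact ⟨-1, by rw [h1]; push_cast; ring⟩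
    · have hgz : g z = 0 := if_neg fun h' => hzU h'.2
      exact ⟨0, by rw [hgz]; simp [area]⟩
  choose! N hN using hterm
  refine ⟨∑ z ∈ Zf, N z, ?_⟩
  rw [hsum, 𝒞.area_sum_density _ hre him hgm hgb, Finset.sum_congr rfl hN]
  push_cast
  rw [Finset.mul_sum]

end OrientedCover

/-! ### The winding number along a separating curve -/

/-- The differential of the angular form `κ(p² + q²) (p dq - q dp)`. -/
theorem wedge_angular_form {κ : ℝ → ℝ} (hκ : Differentiable ℝ κ) {p q : ℂ → ℝ} {y : ℂ}
    (hp : DifferentiableAt ℝ p y) (hq : DifferentiableAt ℝ q y) :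
    wedge (fderiv ℝ (fun y => -(κ (p y ^ 2 + q y ^ 2) * q y)) y) (fderiv ℝ p y) +
        wedge (fderiv ℝ (fun y => κ (p y ^ 2 + q y ^ 2) * p y) y) (fderiv ℝ q y) =
      2 * deriv (fun s => s * κ s) (p y ^ 2 + q y ^ 2) * wedge (fderiv ℝ p y) (fderiv ℝ q y) := by
  set s := p y ^ 2 + q y ^ 2 with hs
  have hκs : HasDerivAt κ (deriv κ s) s := (hκ s).hasDerivAt
  have hm : deriv (fun s => s * κ s) s = κ s + s * deriv κ s := by
    have := ((hasDerivAt_id' s).fun_mul hκs).deriv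
    simpa using this
  have hP := hp.hasFDerivAt
  have hQ := hq.hasFDerivAt
  have hk : HasFDerivAt (fun y => κ (p y ^ 2 + q y ^ 2))
      (deriv κ s • ((2 * p y) • fderiv ℝ p y + (2 * q y) • fderiv ℝ q y)) y := by
    have h1 := (hP.pow 2).add (hQ.pow 2)
    have h2 := hκs.comp_hasFDerivAt y h1
    refine h2.congr_fderiv ?_
    ext v
    simp
  rw [(hk.fun_mul hQ).fun_neg.fderiv, (hk.fun_mul hP).fderiv, hm]
  simp only [wedge, hs]
  simp only [neg_apply, add_apply, smul_apply, smul_eq_mul]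
  ring

namespace OrientedCover

variable {S : Type*} [TopologicalSpace S] [ChartedSpace (EuclideanSpace ℝ (Fin 2)) S]
  [IsManifold (𝓡 2) ∞ S] [CompactSpace S] [T2Space S] [ConnectedSpace S]
  {ι : Type*} [Fintype ι] (𝒞 : OrientedCover S ι)

/-- If every zero of `h` is the `n`-th power of a coordinate, then the winding number of `h` along
a separating curve is a multiple of `n`. -/
theorem exists_winding_eq {γ : Circle → S} (hγ : IsEmbeddedClosedCurve γ)
    (hsep : IsSeparatingCurve γ) {h : S → ℂ} (hh : ContMDiff (𝓡 2) 𝓘(ℝ, ℂ) ∞ h) {n : ℕ}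
    (hn : 0 < n)
    (hzero : ∀ x, h x = 0 → ∃ (i : ι) (f : S → ℂ), x ∈ (𝒞.chart i).source ∧
      ContMDiff (𝓡 2) 𝓘(ℝ, ℂ) ∞ f ∧ (h =ᶠ[𝓝 x] fun x' => f x' ^ n) ∧
      (fderiv ℝ (f ∘ (𝒞.chart i).symm) (𝒞.chart i x)).det ≠ 0)
    (hγz : ∀ z, h (γ z) ≠ 0) :
    ∃ N : ℤ, ∫ t in (0)..(2 * Real.pi), (deriv (fun t => h (γ (Circle.exp t))) t /
      h (γ (Circle.exp t))).im = 2 * Real.pi * n * N := by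
  let _ : MeasurableSpace S := borel S
  have : BorelSpace S := ⟨rfl⟩
  have hcontγ : Continuous γ := hγ.isEmbedding.continuous
  have hK : IsCompact (range γ) := isCompact_range hcontγ
  obtain ⟨u, v, hu, hv, hcov, hune, hvne, hdisj⟩ : ∃ u v : Set S, IsOpen u ∧ IsOpen v ∧
      (range γ)ᶜ ⊆ u ∪ v ∧ ((range γ)ᶜ ∩ u).Nonempty ∧ ((range γ)ᶜ ∩ v).Nonempty ∧
      ¬ ((range γ)ᶜ ∩ (u ∩ v)).Nonempty := by
    have h := hsep
    simp only [IsSeparatingCurve, IsPreconnected, not_forall] at h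
    obtain ⟨u, v, hu, hv, h1, h2, h3, h4⟩ := h
    exact ⟨u, v, hu, hv, h1, h2, h3, h4⟩
  -- The sets `u` and `v` may still meet on the curve, which is removed here.
  set U := (range γ)ᶜ ∩ u with hU
  set V := (range γ)ᶜ ∩ v with hV
  have hUo : IsOpen U := hK.isClosed.isOpen_compl.inter hu
  have hVo : IsOpen V := hK.isClosed.isOpen_compl.inter hv
  have hUV : Disjoint U V := by
    rw [disjoint_left]
    exact fun x hx hx' => hdisj ⟨x, hx.1, hx.2, hx'.2⟩
  have hUVcov : U ∪ V = (range γ)ᶜ := by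
    rw [hU, hV, ← inter_union_distrib_left]
    exact inter_eq_left.2 hcov
  obtain ⟨κ, hκ, hκ1, N, hN⟩ := 𝒞.exists_area_eq_int hh hn hzero hUo hVo hUV hUVcov hK
    (by rintro _ ⟨z, rfl⟩; exact hγz z)
  obtain ⟨ε, hε, hst⟩ := 𝒞.exists_stokes hγ hUo hVo hUV hUVcov hune hvne
  have hre : ContMDiff (𝓡 2) 𝓘(ℝ, ℝ) ∞ fun x' => (h x').re :=
    Complex.reCLM.contDiff.contMDiff.comp hh
  have him : ContMDiff (𝓡 2) 𝓘(ℝ, ℝ) ∞ fun x' => (h x').im :=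
    Complex.imCLM.contDiff.contMDiff.comp hh
  have hk : ContMDiff (𝓡 2) 𝓘(ℝ, ℝ) ∞ fun x => κ ((h x).re ^ 2 + (h x).im ^ 2) :=
    hκ.contMDiff.comp ((hre.pow 2).add (him.pow 2))
  have ha : ContMDiff (𝓡 2) 𝓘(ℝ, ℝ) ∞ fun x => -(κ ((h x).re ^ 2 + (h x).im ^ 2) * (h x).im) :=
    (hk.mul him).neg
  have hb : ContMDiff (𝓡 2) 𝓘(ℝ, ℝ) ∞ fun x => κ ((h x).re ^ 2 + (h x).im ^ 2) * (h x).re :=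
    hk.mul hre
  have hsq : ∀ w : ℂ, w.re ^ 2 + w.im ^ 2 = ‖w‖ ^ 2 := fun w => by
    rw [← Complex.normSq_eq_norm_sq, Complex.normSq_apply]; ring
  have hadd := 𝒞.area_add_eq (g := U.indicator fun _ => 1) (C := 1)
    (c := fun x => (h x).re) (d := fun x => (h x).im)
    (D := fun x => 2 * deriv (fun s => s * κ s) (‖h x‖ ^ 2)) ha hre hb him
    (measurable_const.indicator hUo.measurableSet) (fun x => by
      by_cases hx : x ∈ U
      · simp [indicator_of_mem hx]
      · simp [indicator_of_notMem hx]) (fun e he y hy => by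
      have := wedge_angular_form (hκ.differentiable (by simp)) (he.differentiableAt_comp hre hy)
        (he.differentiableAt_comp him hy)
      rw [← hsq]
      exact this)
  rw [hN, hst _ _ ha hre, hst _ _ hb him, ← mul_add] at hadd
  -- On the curve `κ(|h|²) = |h|⁻²`, so the smoothed form is the genuine `d arg h = Im (dh / h)`.
  have hloop : loopIntegral γ (fun x => -(κ ((h x).re ^ 2 + (h x).im ^ 2) * (h x).im))
      (fun x => (h x).re) + loopIntegral γ (fun x => κ ((h x).re ^ 2 + (h x).im ^ 2) * (h x).re)
      (fun x => (h x).im) = ∫ t in (0)..(2 * Real.pi),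
        (deriv (fun t => h (γ (Circle.exp t))) t / h (γ (Circle.exp t))).im := by
    rw [loopIntegral, loopIntegral, ← intervalIntegral.integral_add
      ((hγ.continuous_integrand ha hre).intervalIntegrable _ _)
      ((hγ.continuous_integrand hb him).intervalIntegrable _ _)]
    refine intervalIntegral.integral_congr fun t _ => ?_
    have hd : HasDerivAt (fun t => h (γ (Circle.exp t)))
        (deriv (fun t => h (γ (Circle.exp t))) t) t :=
      ((hγ.contDiff_comp hh).differentiable (by simp) t).hasDerivAt
    have hdre : deriv (fun t => (h (γ (Circle.exp t))).re) t =
        (deriv (fun t => h (γ (Circle.exp t))) t).re :=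
      (Complex.reCLM.hasFDerivAt.comp_hasDerivAt t hd).deriv
    have hdim : deriv (fun t => (h (γ (Circle.exp t))).im) t =
        (deriv (fun t => h (γ (Circle.exp t))) t).im :=
      (Complex.imCLM.hasFDerivAt.comp_hasDerivAt t hd).deriv
    simp only [hdre, hdim, hsq, hκ1 _ ⟨_, rfl⟩]
    rw [Complex.div_im, Complex.normSq_eq_norm_sq]
    ring
  rw [hloop] at hadd
  rcases hε with rfl | rfl
  · exact ⟨N, by rw [← hadd, one_mul]⟩
  · exact ⟨-N, by push_cast; linarith⟩

end OrientedCover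

/-- If an `n`-th root `F` of a nowhere vanishing function `H` has the property that the increment of
the argument of `H` is a multiple of `2πn`, and `F` has equal absolute values at the ends, then `F`
has equal values at the ends. -/
theorem eq_of_winding {H F : ℝ → ℂ} (hH : ContDiff ℝ 1 H) (hH0 : ∀ t, H t ≠ 0) {n : ℕ} (hn : 0 < n)
    {b : ℝ} (hb : 0 ≤ b) (hF : ContinuousOn F (Icc 0 b))
    (hF' : ∀ t ∈ Icc 0 b, HasDerivWithinAt F (deriv H t / (n * H t) * F t) (Icc 0 b) t)
    (hF0 : F 0 ≠ 0) (hnorm : ‖F b‖ = ‖F 0‖) {N : ℤ}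
    (hN : ∫ t in (0)..b, (deriv H t / H t).im = 2 * Real.pi * n * N) : F b = F 0 := by
  have hq : Continuous fun t => deriv H t / (n * H t) :=
    (hH.continuous_deriv le_rfl).div (continuous_const.mul hH.continuous)
      fun t => mul_ne_zero (by exact_mod_cast hn.ne') (hH0 t)
  set G : ℝ → ℂ := fun t => ∫ s in (0)..t, deriv H s / (n * H s) with hG
  have hG' : ∀ t, HasDerivAt G (deriv H t / (n * H t)) t := fun t =>
    intervalIntegral.integral_hasDerivAt_right (hq.intervalIntegrable _ _)
      hq.aestronglyMeasurable.stronglyMeasurableAtFilter hq.continuousAt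
  have hG0 : G 0 = 0 := by simp [hG]
  -- Both `F` and `exp G` solve the equation `y' = (H' / (n H)) y`, so their ratio is constant. It
  -- remains to see that `exp (G b) = 1`: the real part of `G b` vanishes because the norms at the
  -- ends agree, and the imaginary part is `2πN`.
  have hE : ∀ t ∈ Icc 0 b, F t * Complex.exp (-G t) = F 0 * Complex.exp (-G 0) := by
    refine constant_of_has_deriv_right_zero ?_ fun t ht => ?_
    · have : Continuous G := continuous_iff_continuousAt.2 fun t => (hG' t).continuousAt
      exact hF.mul (Complex.continuous_exp.comp this.neg).continuousOn
    · have h1 := hF' t (Ico_subset_Icc_self ht)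
      have h2 := ((hG' t).neg.cexp).hasDerivWithinAt (s := Icc 0 b)
      have h3 := (h1.mul h2).congr_deriv (g' := 0) (by ring)
      exact h3.mono_of_mem_nhdsWithin (Icc_mem_nhdsGE_of_mem ht)
  have hend : F b = F 0 * Complex.exp (G b) := by
    have h1 := hE b ⟨hb, le_rfl⟩
    rw [hG0, neg_zero, Complex.exp_zero, mul_one] at h1
    rw [← h1, mul_assoc, ← Complex.exp_add, neg_add_cancel, Complex.exp_zero, mul_one]
  have hre : (G b).re = 0 := by
    have h1 : ‖F 0‖ * Real.exp (G b).re = ‖F 0‖ := by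
      rw [← Complex.norm_exp, ← norm_mul, ← hend, hnorm]
    have h2 : Real.exp (G b).re = 1 := by
      have : ‖F 0‖ ≠ 0 := norm_ne_zero_iff.2 hF0
      exact mul_left_cancel₀ this (by rw [h1, mul_one])
    exact Real.exp_eq_one_iff _ |>.1 h2
  have him : (G b).im = 2 * Real.pi * N := by
    have h1 : (G b).im = ∫ t in (0)..b, (deriv H t / (n * H t)).im := by
      have := (Complex.imCLM.intervalIntegral_comp_comm (hq.intervalIntegrable (μ := volume) 0 b)).symm
      exact this
    have h2 : ∀ t, (deriv H t / (n * H t)).im = (deriv H t / H t).im / n := fun t => by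
      rw [mul_comm, ← div_div, ← Complex.ofReal_natCast, Complex.div_ofReal_im]
    rw [h1]
    simp only [h2]
    rw [intervalIntegral.integral_div, hN]
    have : (n : ℝ) ≠ 0 := by exact_mod_cast hn.ne'
    field_simp
  have hexp : Complex.exp (G b) = 1 := by
    rw [Complex.exp_eq_one_iff]
    refine ⟨N, Complex.ext ?_ ?_⟩
    · rw [hre]; simp
    · rw [him]; simp; ring
  rw [hend, hexp, mul_one]

/-! ### Equivariant functions on the total space and their regular zeros -/

theorem Complex.det_smul (c : ℂ) (T : ℂ →L[ℝ] ℂ) : (c • T).det = Complex.normSq c * T.det := by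
  rw [Complex.real_det_eq, Complex.real_det_eq, Complex.normSq_apply]
  simp only [smul_apply, smul_eq_mul, Complex.mul_re, Complex.mul_im]
  ring

theorem Complex.det_fderiv_mul_of_eq_zero {a b : ℂ → ℂ} {y : ℂ} (ha : DifferentiableAt ℝ a y)
    (hb : DifferentiableAt ℝ b y) (h0 : b y = 0) :
    (fderiv ℝ (fun y => a y * b y) y).det = Complex.normSq (a y) * (fderiv ℝ b y).det := by
  rw [fderiv_fun_mul ha hb, h0, zero_smul, add_zero, Complex.det_smul]

theorem exists_orientedCover {S : Type*} [TopologicalSpace S]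
    [ChartedSpace (EuclideanSpace ℝ (Fin 2)) S] [IsManifold (𝓡 2) ∞ S] [T2Space S] [CompactSpace S]
    (o : SmoothOrientation S) (B : S → Set S) (hB : ∀ x, IsOpen (B x)) (hx : ∀ x, x ∈ B x) :
    ∃ (t : Finset S) (𝒞 : OrientedCover S t), ∀ k : t, (𝒞.chart k).source ⊆ B k := by
  choose e he hxe using o.cover
  let L : EuclideanSpace ℝ (Fin 2) ≃L[ℝ] ℂ :=
    Complex.orthonormalBasisOneI.repr.symm.toContinuousLinearEquiv
  let c : S → OpenPartialHomeomorph S ℂ := fun x =>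
    ((e x).transHomeomorph L.toHomeomorph).restrOpen (B x) (hB x)
  have hcs : ∀ x, (c x).source = (e x).source ∩ B x := fun x =>
    ((e x).transHomeomorph L.toHomeomorph).restrOpen_source (B x) (hB x)
  have hsmooth : ∀ x, IsSmoothChart (c x) := fun x =>
    (IsSmoothChart.of_mem_maximalAtlas (o.smooth (he x)) L).restrOpen (hB x)
  obtain ⟨t, ρ, hρ, hρ0, hρs, hρ1⟩ := exists_finite_partition (fun x => (c x).source)
    (fun x => (c x).open_source) fun x => by rw [hcs]; exact ⟨hxe x, hx x⟩
  refine ⟨t, ⟨fun k => c k, fun k => hsmooth k, fun i j y hy => ?_, ρ, hρ, hρ0, hρs, hρ1⟩,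
    fun k => by rw [hcs]; exact inter_subset_right⟩
  have h1 : L.symm y ∈ ((e i).symm.trans (e j)).source := by
    refine ⟨hy.1.1, ?_⟩
    have h2 : (c i).symm y ∈ (c j).source := hy.2
    rw [hcs] at h2
    exact h2.1
  have hpos := o.det_pos _ (he i) _ (he j) _ h1
  have hfun : ⇑((c i).symm.trans (c j)) = L ∘ ((e i).symm.trans (e j)) ∘ L.symm := rfl
  rw [one_mul, hfun, ContinuousLinearEquiv.comp_fderiv, ContinuousLinearEquiv.comp_right_fderiv]
  -- All charts are composed with the same `L`, so transition derivatives are only conjugated and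
  -- their determinants do not change, whatever the orientation of `L`.
  have hdet := LinearMap.det_conj
    (fderiv ℝ ((e i).symm.trans (e j)) (L.symm y)).toLinearMap L.toLinearEquiv
  rw [ContinuousLinearMap.det] at hpos ⊢
  rw [← hdet] at hpos
  exact hpos

/-- Locally constant equivariant functions on the parts of a principal bundle over the charts of a
surface, normalized along local sections; `χ` is a character of the structure group. -/
structure EquivariantFrame {S : Type*} [TopologicalSpace S]
    [ChartedSpace (EuclideanSpace ℝ (Fin 2)) S] {ι : Type*} [Fintype ι] (𝒞 : OrientedCover S ι)
    {G : Type*} [Group G] {P : Type*} [TopologicalSpace P] [MulAction Gᵐᵒᵖ P] (π : P → S)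
    (χ : G →* ℂ) where
  coeff : ι → P → ℂ
  sec : ι → S → P
  coeff_act : ∀ i p g, coeff i (p <• g) = χ g * coeff i p
  coeff_eventually : ∀ i p, π p ∈ (𝒞.chart i).source → ∀ᶠ q in 𝓝 p, coeff i q = coeff i p
  proj_sec : ∀ i, ∀ x ∈ (𝒞.chart i).source, π (sec i x) = x
  continuousOn_sec : ∀ i, ContinuousOn (sec i) (𝒞.chart i).source
  coeff_sec : ∀ i, ∀ x ∈ (𝒞.chart i).source, coeff i (sec i x) = 1

namespace EquivariantFrame

variable {S : Type*} [TopologicalSpace S] [ChartedSpace (EuclideanSpace ℝ (Fin 2)) S]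
  {ι : Type*} [Fintype ι] {𝒞 : OrientedCover S ι} {G : Type*} [Group G]
  {P : Type*} [TopologicalSpace P] [MulAction Gᵐᵒᵖ P] {π : P → S} {χ : G →* ℂ}
  (ℰ : EquivariantFrame 𝒞 π χ)

/-- The function on `S` that represents near `p` the equivariant function with coordinates `v i`
for `i` in `s`. -/
def rep (s : Finset ι) (v : ι → ℂ) (p : P) (x : S) : ℂ :=
  ∑ i ∈ s, v i * ℰ.coeff i p * (𝒞.weight i x : ℂ)

theorem contMDiff_weight_ofReal (𝒞 : OrientedCover S ι) (i : ι) :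
    ContMDiff (𝓡 2) 𝓘(ℝ, ℂ) ∞ fun x => (𝒞.weight i x : ℂ) :=
  Complex.ofRealCLM.contDiff.contMDiff.comp (𝒞.weight_smooth i)

theorem contMDiff_rep (s : Finset ι) (v : ι → ℂ) (p : P) :
    ContMDiff (𝓡 2) 𝓘(ℝ, ℂ) ∞ (ℰ.rep s v p) := by
  refine ContMDiff.sum fun i _ => ?_
  have h : ContDiff ℝ ∞ fun z : ℂ => v i * ℰ.coeff i p * z := contDiff_const.mul contDiff_id
  exact h.contMDiff.comp (contMDiff_weight_ofReal 𝒞 i)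

theorem rep_act (s : Finset ι) (v : ι → ℂ) (p : P) (g : G) (x : S) :
    ℰ.rep s v (p <• g) x = χ g * ℰ.rep s v p x := by
  simp only [rep, Finset.mul_sum, ℰ.coeff_act]
  exact Finset.sum_congr rfl fun i _ => by ring

/-- For each `i`, either `coeff i` is constant near `p` or `weight i` vanishes near `π p`. So near
`p` the equivariant function is the pullback of one fixed smooth function on `S`, and can be
differentiated there. -/
theorem rep_eventually (s : Finset ι) (v : ι → ℂ) (p : P) {l : Filter P} {ξ : P → S}
    (hl : l ≤ 𝓝 p) (hξ : Tendsto ξ l (𝓝 (π p))) :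
    ∀ᶠ q in l, ℰ.rep s v q (ξ q) = ℰ.rep s v p (ξ q) := by
  have h : ∀ i ∈ s, ∀ᶠ q in l, v i * ℰ.coeff i q * (𝒞.weight i (ξ q) : ℂ) =
      v i * ℰ.coeff i p * (𝒞.weight i (ξ q) : ℂ) := by
    intro i _
    by_cases hi : π p ∈ (𝒞.chart i).source
    · filter_upwards [hl (ℰ.coeff_eventually i p hi)] with q hq
      rw [hq]
    · filter_upwards [hξ (notMem_tsupport_iff_eventuallyEq.1 fun h => hi (𝒞.tsupport_subset i h))]
        with q hq
      have : 𝒞.weight i (ξ q) = 0 := hq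
      rw [this]; simp
  filter_upwards [(Finset.eventually_all s).2 h] with q hq
  exact Finset.sum_congr rfl hq

theorem rep_sec_eventually (s : Finset ι) (v : ι → ℂ) (k : ι) {x : S}
    (hx : x ∈ (𝒞.chart k).source) :
    ∀ᶠ x' in 𝓝 x, ℰ.rep s v (ℰ.sec k x') x' = ℰ.rep s v (ℰ.sec k x) x' := by
  have hopen := (𝒞.chart k).open_source.mem_nhds hx
  have hc : Tendsto (ℰ.sec k) (𝓝 x) (𝓝 (ℰ.sec k x)) := (ℰ.continuousOn_sec k).continuousAt hopen
  have h1 : ∀ i ∈ s, ∀ᶠ x' in 𝓝 x, v i * ℰ.coeff i (ℰ.sec k x') * (𝒞.weight i x' : ℂ) =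
      v i * ℰ.coeff i (ℰ.sec k x) * (𝒞.weight i x' : ℂ) := by
    intro i _
    by_cases hi : x ∈ (𝒞.chart i).source
    · filter_upwards [hc (ℰ.coeff_eventually i (ℰ.sec k x) (by rwa [ℰ.proj_sec k x hx]))] with q hq
      have hq : ℰ.coeff i (ℰ.sec k q) = ℰ.coeff i (ℰ.sec k x) := hq
      rw [hq]
    · filter_upwards [notMem_tsupport_iff_eventuallyEq.1 fun h => hi (𝒞.tsupport_subset i h)]
        with q hq
      rw [hq]; simp
  filter_upwards [(Finset.eventually_all s).2 h1] with q hq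
  exact Finset.sum_congr rfl hq

variable [IsManifold (𝓡 2) ∞ S]

/-- By Sard's theorem, a generic equivariant function has only regular zeros, and no zero over a
given embedded curve. -/
theorem exists_regular (hfiber : ∀ p q : P, π p = π q → ∃ g : G, q = p <• g)
    {γ : Circle → S} (hγ : IsEmbeddedClosedCurve γ) :
    ∃ v : ι → ℂ, ∀ p, ℰ.rep Finset.univ v p (π p) = 0 → π p ∉ range γ ∧
      ∃ j, π p ∈ (𝒞.chart j).source ∧
        (fderiv ℝ (ℰ.rep Finset.univ v p ∘ (𝒞.chart j).symm) (𝒞.chart j (π p))).det ≠ 0 := by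
  classical
  -- The coordinates of `v` are chosen one chart at a time. Only points where some weight from `s`
  -- is nonzero are considered, since elsewhere the partial sum is identically zero on the fiber.
  suffices h : ∀ s : Finset ι, ∃ v : ι → ℂ, ∀ p, (∃ i ∈ s, 𝒞.weight i (π p) ≠ 0) →
      ℰ.rep s v p (π p) = 0 → π p ∉ range γ ∧ ∃ j, π p ∈ (𝒞.chart j).source ∧
        (fderiv ℝ (ℰ.rep s v p ∘ (𝒞.chart j).symm) (𝒞.chart j (π p))).det ≠ 0 by
    obtain ⟨v, hv⟩ := h Finset.univ
    refine ⟨v, fun p hp => hv p ?_ hp⟩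
    by_contra! hcon
    have := 𝒞.sum_eq_one (π p)
    rw [Finset.sum_eq_zero hcon] at this
    exact zero_ne_one this
  intro s
  induction s using Finset.induction_on with
  | empty => exact ⟨0, fun p ⟨i, hi, _⟩ => absurd hi (Finset.notMem_empty i)⟩
  | insert k s hk ih =>
    obtain ⟨v, hv⟩ := ih
    set e := 𝒞.chart k with he
    have hes := 𝒞.smooth k
    -- On the section `sec k`, where `coeff k = 1`, adding the term with coefficient `c` gives
    -- `weight k * (c - R)`. The zeros with `weight k ≠ 0` are thus the solutions of `R = c`: they
    -- are regular if `c` is a regular value of `R`, and avoid the curve if `c` is not a value of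
    -- `R` on it.
    set R : S → ℂ := fun x => -(ℰ.rep s v (ℰ.sec k x) x) / (𝒞.weight k x : ℂ) with hR
    have hRev : ∀ x ∈ e.source, R =ᶠ[𝓝 x] fun x' =>
        -(ℰ.rep s v (ℰ.sec k x) x') / (𝒞.weight k x' : ℂ) := by
      intro x hx
      filter_upwards [ℰ.rep_sec_eventually s v k hx] with x' hx'
      simp only [hR, hx']
    have hRe : ∀ y ∈ e.target, 𝒞.weight k (e.symm y) ≠ 0 → DifferentiableAt ℝ (R ∘ e.symm) y := by
      intro y hy hy0
      have h1 : R ∘ e.symm =ᶠ[𝓝 y] fun y' =>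
          -((ℰ.rep s v (ℰ.sec k (e.symm y)) ∘ e.symm) y') /
            ((fun x => (𝒞.weight k x : ℂ)) ∘ e.symm) y' :=
        (e.continuousAt_symm hy).eventually (hRev _ (e.map_target hy))
      refine DifferentiableAt.congr_of_eventuallyEq ?_ h1
      have hy0' : ((fun x => (𝒞.weight k x : ℂ)) ∘ e.symm) y ≠ 0 := Complex.ofReal_ne_zero.2 hy0
      have hnum := (hes.differentiableAt_comp (ℰ.contMDiff_rep s v (ℰ.sec k (e.symm y))) hy).fun_neg
      have hden := hes.differentiableAt_comp (contMDiff_weight_ofReal 𝒞 k) hy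
      simpa only [div_eq_mul_inv] using hnum.fun_mul (hden.fun_inv hy0')
    obtain ⟨c, hc1, hc2⟩ := exists_notMem_image_of_det_eq_zero (R := R ∘ e.symm)
      (C := {y | y ∈ e.target ∧ 𝒞.weight k (e.symm y) ≠ 0 ∧ (fderiv ℝ (R ∘ e.symm) y).det = 0})
      (fun y hy => (hRe y hy.1 hy.2.1).hasFDerivAt) (fun y hy => hy.2.2)
      (c := fun t => R (γ (Circle.exp t)))
      (T := {t | γ (Circle.exp t) ∈ e.source ∧ 𝒞.weight k (γ (Circle.exp t)) ≠ 0}) (by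
        rintro t ⟨ht, ht0⟩
        have hγc : Continuous fun t => γ (Circle.exp t) :=
          hγ.isEmbedding.continuous.comp Circle.exp.continuous
        refine DifferentiableAt.congr_of_eventuallyEq ?_ (hγc.continuousAt.eventually (hRev _ ht))
        exact ((hγ.contDiff_comp (ℰ.contMDiff_rep s v _)).differentiable (by simp) t).fun_neg.fun_div
          ((hγ.contDiff_comp (contMDiff_weight_ofReal 𝒞 k)).differentiable (by simp) t)
          (by simpa using ht0))
    set v' := Function.update v k c with hv'
    have hrep : ∀ p x, ℰ.rep (insert k s) v' p x =
        c * ℰ.coeff k p * (𝒞.weight k x : ℂ) + ℰ.rep s v p x := by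
      intro p x
      rw [rep, Finset.sum_insert hk, rep]
      congr 1
      · simp [hv']
      · refine Finset.sum_congr rfl fun i hi => ?_
        rw [hv', Function.update_of_ne]
        exact fun h => hk (h ▸ hi)
    refine ⟨v', fun p hpi hp => ?_⟩
    -- Where the nonnegative `weight k` vanishes it has a minimum, so its derivative vanishes too,
    -- and the new term changes neither the value nor the derivative.
    by_cases hk0 : 𝒞.weight k (π p) = 0
    · have hp' : ℰ.rep s v p (π p) = 0 := by
        rw [hrep, hk0] at hp
        simpa using hp
      obtain ⟨i, hi, hi0⟩ := hpi
      have his : i ∈ s := by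
        rcases Finset.mem_insert.1 hi with rfl | h
        · exact absurd hk0 hi0
        · exact h
      obtain ⟨hpγ, j, hj, hdet⟩ := hv p ⟨i, his, hi0⟩ hp'
      refine ⟨hpγ, j, hj, ?_⟩
      set y := 𝒞.chart j (π p) with hy
      have hyt : y ∈ (𝒞.chart j).target := (𝒞.chart j).map_source hj
      have hmin : IsLocalMin (𝒞.weight k ∘ (𝒞.chart j).symm) y := by
        refine Eventually.of_forall fun y' => ?_
        simp only [Function.comp_apply]
        rw [hy, (𝒞.chart j).left_inv hj, hk0]
        exact 𝒞.weight_nonneg k _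
      have hd0 : HasFDerivAt (𝒞.weight k ∘ (𝒞.chart j).symm) (0 : ℂ →L[ℝ] ℝ) y := by
        have := ((𝒞.smooth j).differentiableAt_comp (𝒞.weight_smooth k) hyt).hasFDerivAt
        rwa [hmin.fderiv_eq_zero] at this
      have hd1 : HasFDerivAt (fun y => c * ℰ.coeff k p *
          ((𝒞.weight k ∘ (𝒞.chart j).symm) y : ℂ)) (0 : ℂ →L[ℝ] ℂ) y := by
        have h1 := (Complex.ofRealCLM.hasFDerivAt.comp y hd0).const_mul (c * ℰ.coeff k p)
        refine h1.congr_fderiv ?_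
        ext v
        simp
      have hd2 := ((𝒞.smooth j).differentiableAt_comp (ℰ.contMDiff_rep s v p) hyt).hasFDerivAt
      have hd3 : HasFDerivAt (ℰ.rep (insert k s) v' p ∘ (𝒞.chart j).symm)
          (fderiv ℝ (ℰ.rep s v p ∘ (𝒞.chart j).symm) y) y := by
        have h1 := hd1.add hd2
        rw [zero_add] at h1
        refine h1.congr_of_eventuallyEq (Eventually.of_forall fun y' => ?_)
        simp [hrep]
      rwa [hd3.fderiv]
    · have hpk : π p ∈ e.source := by
        by_contra h
        exact hk0 (𝒞.weight_eq_zero h)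
      obtain ⟨x, hx⟩ : ∃ x, x = π p := ⟨_, rfl⟩
      rw [← hx] at hpk hk0 hp ⊢
      set p₀ := ℰ.sec k x with hp₀
      obtain ⟨g, hg⟩ := hfiber p₀ p (by rw [hp₀, ℰ.proj_sec k x hpk, hx])
      have hw0 : (𝒞.weight k x : ℂ) ≠ 0 := by exact_mod_cast hk0
      have hχ0 : χ g ≠ 0 := by
        intro h0
        have h1 : χ (g * g⁻¹) = 1 := by rw [mul_inv_cancel, map_one]
        rw [map_mul, h0, zero_mul] at h1
        exact zero_ne_one h1
      have hrep' : ∀ x', ℰ.rep (insert k s) v' p x' =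
          χ g * (c * (𝒞.weight k x' : ℂ) + ℰ.rep s v p₀ x') := by
        intro x'
        rw [hg, ℰ.rep_act, hrep, hp₀, ℰ.coeff_sec k x hpk, mul_one]
      have hcR : c = R x := by
        rw [hrep'] at hp
        have h1 := (mul_eq_zero.1 hp).resolve_left hχ0
        simp only [hR]
        rw [eq_div_iff hw0]
        linear_combination h1
      refine ⟨?_, k, hpk, ?_⟩
      · rintro ⟨z, hz⟩
        obtain ⟨t, rfl⟩ := Circle.exp_surjective z
        exact hc2 ⟨t, ⟨by rw [hz]; exact hpk, by rw [hz]; exact hk0⟩, by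
          simp only; rw [hz, hcR]⟩
      · have hyt : e x ∈ e.target := e.map_source hpk
        have hsymm : e.symm (e x) = x := e.left_inv hpk
        have hRd := hRe (e x) hyt (by rwa [hsymm])
        have hev : ℰ.rep (insert k s) v' p ∘ e.symm =ᶠ[𝓝 (e x)] fun y =>
            (χ g * ((fun x => (𝒞.weight k x : ℂ)) ∘ e.symm) y) * (c - (R ∘ e.symm) y) := by
          have h1 : Tendsto e.symm (𝓝 (e x)) (𝓝 x) := by
            have := e.continuousAt_symm hyt
            rwa [ContinuousAt, hsymm] at this
          have h2 : ∀ᶠ x' in 𝓝 x, 𝒞.weight k x' ≠ 0 :=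
            (𝒞.weight_smooth k).continuous.continuousAt.eventually_ne hk0
          filter_upwards [h1.eventually (hRev x hpk), h1.eventually h2] with y hy hy0
          have hy0' : (𝒞.weight k (e.symm y) : ℂ) ≠ 0 := by exact_mod_cast hy0
          simp only [Function.comp_apply]
          rw [hrep', hy]
          field_simp
          ring
        have hW := hes.differentiableAt_comp (contMDiff_weight_ofReal 𝒞 k) hyt
        rw [hev.fderiv_eq, Complex.det_fderiv_mul_of_eq_zero (hW.const_mul _) (hRd.const_sub c)
          (by simp only [Function.comp_apply]; rw [hsymm, hcR, sub_self])]
        refine mul_ne_zero ?_ fun h0 => ?_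
        · rw [Ne, Complex.normSq_eq_zero]
          refine mul_ne_zero hχ0 ?_
          simp only [Function.comp_apply]
          rwa [hsymm]
        · refine hc1 ⟨e x, ⟨hyt, by rwa [hsymm], ?_⟩, by rw [Function.comp_apply, hsymm, hcR]⟩
          rw [fderiv_const_sub] at h0
          rw [Complex.real_det_eq] at h0 ⊢
          simp only [neg_apply, Complex.neg_re, Complex.neg_im] at h0
          linear_combination h0

end EquivariantFrame

/-! ### Existence of a monodromy by path lifting -/

theorem MulOpposite.smul_smul_right {G P : Type*} [Group G] [MulAction Gᵐᵒᵖ P] (p : P) (g h : G) :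
    (p <• g) <• h = p <• (g * h) := by
  rw [smul_smul, ← MulOpposite.op_mul]

theorem Circle.exp_eq_exp_unitInterval {s t : unitInterval}
    (h : Circle.exp (2 * Real.pi * s) = Circle.exp (2 * Real.pi * t)) :
    s = t ∨ s = 0 ∧ t = 1 ∨ s = 1 ∧ t = 0 := by
  obtain ⟨m, hm⟩ := Circle.exp_eq_exp.1 h
  have h1 : (s : ℝ) = t + m := by
    have h2 : 2 * Real.pi * ((s : ℝ) - (t + m)) = 0 := by linarith
    have h3 := (mul_eq_zero.1 h2).resolve_left Real.two_pi_pos.ne'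
    linarith
  have hs := s.2
  have ht := t.2
  have hm1 : m < 2 := by
    have : (m : ℝ) < 2 := by linarith [hs.2, ht.1]
    exact_mod_cast this
  have hm2 : -2 < m := by
    have : (-2 : ℝ) < m := by linarith [hs.1, ht.2]
    exact_mod_cast this
  have hm3 : m = -1 ∨ m = 0 ∨ m = 1 := by omega
  rcases hm3 with rfl | rfl | rfl
  · right; left
    push_cast at h1
    exact ⟨le_antisymm (Subtype.coe_le_coe.1 (show (s : ℝ) ≤ 0 by linarith [ht.2])) bot_le,
      le_antisymm le_top (Subtype.coe_le_coe.1 (show (1 : ℝ) ≤ t by linarith [hs.1]))⟩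
  · left
    exact Subtype.ext (by simpa using h1)
  · right; right
    push_cast at h1
    exact ⟨le_antisymm le_top (Subtype.coe_le_coe.1 (show (1 : ℝ) ≤ s by linarith [ht.1])),
      le_antisymm (Subtype.coe_le_coe.1 (show (t : ℝ) ≤ 0 by linarith [hs.2])) bot_le⟩

theorem Circle.exists_unitInterval (z : Circle) :
    ∃ t : unitInterval, Circle.exp (2 * Real.pi * t) = z := by
  have hpi := Real.two_pi_pos
  obtain ⟨s, hs⟩ : ∃ s, Circle.exp s = z := ⟨_, Circle.exp_arg z⟩
  refine ⟨⟨Int.fract (s / (2 * Real.pi)), Int.fract_nonneg _, (Int.fract_lt_one _).le⟩, ?_⟩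
  rw [← hs, Circle.exp_eq_exp]
  refine ⟨-⌊s / (2 * Real.pi)⌋, ?_⟩
  simp only [Int.fract]
  push_cast
  field_simp
  ring

namespace IsPrincipalBundle

variable {G : Type*} [Group G] [TopologicalSpace G] {P X : Type*}
  [TopologicalSpace P] [TopologicalSpace X] [MulAction Gᵐᵒᵖ P] {π : P → X}

theorem surjective (hπ : IsPrincipalBundle G π) : Function.Surjective π := fun x => by
  obtain ⟨e, he⟩ := hπ.locallyTrivial x
  exact ⟨e.toOpenPartialHomeomorph.symm (x, 1), e.proj_symm_apply' he⟩

theorem eq_of_act_eq (hπ : IsPrincipalBundle G π) {p : P} {g h : G} (hp : p <• g = p <• h) :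
    g = h := by
  have h1 : p <• (g * h⁻¹) = p := by
    rw [← MulOpposite.smul_smul_right, hp, MulOpposite.smul_smul_right]
    simp
  exact mul_inv_eq_one.1 (hπ.free p _ h1)

variable [DiscreteTopology G]

theorem isCoveringMap (hπ : IsPrincipalBundle G π) : IsCoveringMap π :=
  IsFiberBundle.isCoveringMap hπ.locallyTrivial

theorem t2Space [T2Space X] (hπ : IsPrincipalBundle G π) : T2Space P where
  t2 p q hpq := by
    by_cases h : π p = π q
    · exact hπ.isCoveringMap.isSeparatedMap p q h hpq
    · exact separated_by_continuous hπ.isCoveringMap.continuous h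

/-- Lifting the parametrization of a closed curve to the total space of a principal bundle
identifies the pullback along the curve with one of the bundles `CircleBundle g`. -/
theorem exists_hasMonodromy [T2Space X] [Finite G] (hπ : IsPrincipalBundle G π) {γ : Circle → X}
    (hγ : Continuous γ) : ∃ g : G, HasMonodromy π γ g := by
  have hT2 := hπ.t2Space
  let c : C(unitInterval, X) := ⟨fun t => γ (Circle.exp (2 * Real.pi * t)),
    hγ.comp (Circle.exp.continuous.comp (continuous_const.mul continuous_subtype_val))⟩
  obtain ⟨p, hp⟩ := hπ.surjective (c 0)
  obtain ⟨Γ, hΓ, -⟩ := hπ.isCoveringMap.exists_path_lifts c p hp.symm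
  have hΓ' : ∀ t, π (Γ t) = γ (Circle.exp (2 * Real.pi * t)) := fun t => congrFun hΓ t
  -- The order of the endpoints matters: `Γ 0 = Γ 1 <• g` matches the gluing of `(0, h)` with `(1, g
  -- * h)`.
  obtain ⟨g, hg⟩ := hπ.transitive (Γ 1) (Γ 0) (by rw [hΓ', hΓ']; simp)
  have hmem : ∀ a : unitInterval × G,
      γ (Circle.exp (2 * Real.pi * a.1)) = π (Γ a.1 <• a.2) := fun a => by
    rw [hπ.proj_act, hΓ']
  let F : unitInterval × G → {q : Circle × P // γ q.1 = π q.2} := fun a =>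
    ⟨(Circle.exp (2 * Real.pi * a.1), Γ a.1 <• a.2), hmem a⟩
  have hFc : Continuous F := by
    refine Continuous.subtype_mk (Continuous.prodMk (by fun_prop) ?_) _
    exact continuous_prod_of_discrete_right.2 fun h => (hπ.continuous_act h).comp Γ.continuous
  have hF : ∀ a b : unitInterval × G, (∃ h : G, a = (0, h) ∧ b = (1, g * h)) → F a = F b := by
    rintro _ _ ⟨h, rfl, rfl⟩
    refine Subtype.ext (Prod.ext (by simp [F]) ?_)
    change Γ 0 <• h = Γ 1 <• (g * h)
    rw [← MulOpposite.smul_smul_right, ← hg]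
  let f : CircleBundle g → {q : Circle × P // γ q.1 = π q.2} := Quot.lift F hF
  have hfc : Continuous f := continuous_quot_lift hF hFc
  have hglue : ∀ h : G, CircleBundle.mk g (0, h) = CircleBundle.mk g (1, g * h) := fun h =>
    Quot.sound ⟨h, rfl, rfl⟩
  have hinj : Function.Injective f := by
    rintro ⟨s, h⟩ ⟨t, k⟩ hst
    have h1 : Circle.exp (2 * Real.pi * s) = Circle.exp (2 * Real.pi * t) :=
      congrArg (fun q => q.1.1) hst
    have h2 : Γ s <• h = Γ t <• k := congrArg (fun q => q.1.2) hst
    change CircleBundle.mk g (s, h) = CircleBundle.mk g (t, k)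
    rcases Circle.exp_eq_exp_unitInterval h1 with rfl | ⟨rfl, rfl⟩ | ⟨rfl, rfl⟩
    · rw [hπ.eq_of_act_eq h2]
    · rw [hg, MulOpposite.smul_smul_right] at h2
      rw [hglue, hπ.eq_of_act_eq h2]
    · rw [hg, MulOpposite.smul_smul_right] at h2
      rw [hglue, hπ.eq_of_act_eq h2]
  have hsurj : Function.Surjective f := by
    rintro ⟨⟨z, q⟩, hq⟩
    obtain ⟨t, rfl⟩ := Circle.exists_unitInterval z
    obtain ⟨h, rfl⟩ := hπ.transitive (Γ t) q (by rw [hΓ']; exact hq)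
    exact ⟨CircleBundle.mk g (t, h), rfl⟩
  -- Finiteness of `G` makes the model compact, so the continuous bijection onto the Hausdorff
  -- pullback is a homeomorphism.
  have : CompactSpace (CircleBundle g) := inferInstanceAs (CompactSpace (Quot _))
  let Φ := Continuous.homeoOfEquivCompactToT2 (f := Equiv.ofBijective f ⟨hinj, hsurj⟩) hfc
  refine ⟨g, Φ, ?_, ?_⟩
  · rintro ⟨t, h⟩
    rfl
  · rintro ⟨t, h⟩ k
    refine Prod.ext rfl ?_
    exact (MulOpposite.smul_smul_right (Γ t) h k).symm

end IsPrincipalBundle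

/-! ### Characters are trivial on the monodromy -/

namespace IsPrincipalBundle

variable {G : Type*} [Group G] [TopologicalSpace G] [DiscreteTopology G]
  {S : Type*} [TopologicalSpace S] [ChartedSpace (EuclideanSpace ℝ (Fin 2)) S]
  {P : Type*} [TopologicalSpace P] [MulAction Gᵐᵒᵖ P] {π : P → S}

/-- The coefficient at `p` is `χ` of the group element that carries the local section to `p`. That
element is locally constant because `π` is locally injective. -/
theorem exists_equivariantFrame (hπ : IsPrincipalBundle G π) {ι : Type*} [Fintype ι]
    (𝒞 : OrientedCover S ι) (e : ι → Bundle.Trivialization G π)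
    (he : ∀ i, (𝒞.chart i).source ⊆ (e i).baseSet) (χ : G →* ℂ) :
    Nonempty (EquivariantFrame 𝒞 π χ) := by
  classical
  let σ : ι → S → P := fun i x => (e i).toOpenPartialHomeomorph.symm (x, 1)
  have hσ : ∀ i, ∀ x ∈ (𝒞.chart i).source, π (σ i x) = x := fun i x hx =>
    (e i).proj_symm_apply' (he i hx)
  have hσc : ∀ i, ContinuousOn (σ i) (𝒞.chart i).source := fun i => by
    refine (e i).toOpenPartialHomeomorph.continuousOn_symm.comp
      (Continuous.prodMk_left (1 : G)).continuousOn fun x hx => ?_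
    exact (e i).mem_target.2 (he i hx)
  have hd : ∀ i p, ∃ g : G, π p ∈ (𝒞.chart i).source → p = σ i (π p) <• g := fun i p => by
    by_cases hp : π p ∈ (𝒞.chart i).source
    · obtain ⟨g, hg⟩ := hπ.transitive (σ i (π p)) p (hσ i _ hp)
      exact ⟨g, fun _ => hg⟩
    · exact ⟨1, fun h => absurd h hp⟩
  choose d hd using hd
  have hd_eq : ∀ i p g, π p ∈ (𝒞.chart i).source → p = σ i (π p) <• g → d i p = g :=
    fun i p g hp hg => hπ.eq_of_act_eq ((hd i p hp).symm.trans hg)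
  refine ⟨⟨fun i p => if π p ∈ (𝒞.chart i).source then χ (d i p) else 0, σ, fun i p g => ?_,
    fun i p hp => ?_, hσ, hσc, fun i x hx => ?_⟩⟩
  · by_cases hp : π p ∈ (𝒞.chart i).source
    · have h1 : d i (p <• g) = d i p * g := by
        refine hd_eq i _ _ (by rwa [hπ.proj_act]) ?_
        rw [hπ.proj_act, ← MulOpposite.smul_smul_right, ← hd i p hp]
      simp only [hπ.proj_act, hp, if_true, h1, map_mul, mul_comm]
    · simp only [hπ.proj_act, hp, if_false, mul_zero]
  · obtain ⟨U, hU, hpU, hinj⟩ := hπ.isCoveringMap.isLocalHomeomorph.isLocallyInjective p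
    have hπc := hπ.isCoveringMap.continuous
    have hsrc : ∀ᶠ q in 𝓝 p, π q ∈ (𝒞.chart i).source :=
      hπc.continuousAt ((𝒞.chart i).open_source.mem_nhds hp)
    have hc : ContinuousAt (fun q => σ i (π q) <• d i p) p :=
      (hπ.continuous_act (d i p)).continuousAt.comp
        (((hσc i).continuousAt ((𝒞.chart i).open_source.mem_nhds hp)).comp hπc.continuousAt)
    have hmem : ∀ᶠ q in 𝓝 p, σ i (π q) <• d i p ∈ U :=
      hc (hU.mem_nhds (show σ i (π p) <• d i p ∈ U by rwa [← hd i p hp]))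
    filter_upwards [hsrc, hmem, hU.mem_nhds hpU] with q hq hq' hqU
    rw [if_pos hq, if_pos hp, hd_eq i q (d i p) hq]
    exact hinj hqU hq' (by rw [hπ.proj_act, hσ i _ hq])
  · have h1 : π (σ i x) ∈ (𝒞.chart i).source := by rwa [hσ i x hx]
    rw [if_pos h1, hd_eq i (σ i x) 1 h1 (by rw [hσ i x hx]; simp), map_one]

variable [IsManifold (𝓡 2) ∞ S] [T2Space S] [CompactSpace S] [ConnectedSpace S] [Finite G]

/-- A generic equivariant function on the total space has only regular zeros. Its `n`-th power,
`n` the order of the group, is a function on the surface, whose winding number along a separating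
curve is a multiple of `n`; so the equivariant function closes up along a lift of the curve. -/
theorem map_eq_one_of_hasMonodromy (hπ : IsPrincipalBundle G π) (o : SmoothOrientation S)
    {γ : Circle → S} (hγ : IsEmbeddedClosedCurve γ) (hsep : IsSeparatingCurve γ) (χ : G →* ℂ)
    {g : G} (hg : HasMonodromy π γ g) : χ g = 1 := by
  have hcov := hπ.isCoveringMap
  set n := Nat.card G with hn
  have hn0 : 0 < n := Nat.card_pos
  have hχ : ∀ k, χ k ^ n = 1 := fun k => by rw [← map_pow, hn, pow_card_eq_one', map_one]
  have hγc : Continuous fun t => γ (Circle.exp t) :=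
    hγ.isEmbedding.continuous.comp Circle.exp.continuous
  choose e he using hπ.locallyTrivial
  obtain ⟨t, 𝒞, ht⟩ := exists_orientedCover o (fun x => (e x).baseSet)
    (fun x => (e x).open_baseSet) he
  obtain ⟨ℰ⟩ := hπ.exists_equivariantFrame 𝒞 (fun k => e k) ht χ
  obtain ⟨v, hv⟩ := ℰ.exists_regular hπ.transitive hγ
  set R : P → S → ℂ := ℰ.rep Finset.univ v with hR
  have hRs : ∀ p, ContMDiff (𝓡 2) 𝓘(ℝ, ℂ) ∞ (R p) := ℰ.contMDiff_rep _ v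
  choose s hs using hπ.surjective
  -- The section `s` is arbitrary, not continuous: the `n`-th power does not depend on the point of
  -- the fiber, since `χ ^ n = 1`.
  set h : S → ℂ := fun x => R (s x) x ^ n with hh
  have hact : ∀ p k, R (p <• k) (π (p <• k)) = χ k * R p (π p) := fun p k => by
    rw [hπ.proj_act, hR, ℰ.rep_act]
  have hhπ : ∀ p, h (π p) = R p (π p) ^ n := fun p => by
    obtain ⟨k, hk⟩ := hπ.transitive p (s (π p)) (hs _).symm
    have h1 := hact p k
    rw [hπ.proj_act] at h1
    rw [hh]
    simp only
    rw [hk, h1, mul_pow, hχ, one_mul]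
  have hloc : ∀ p, h =ᶠ[𝓝 (π p)] fun x => R p x ^ n := fun p => by
    rw [← hcov.isLocalHomeomorph.map_nhds_eq p, EventuallyEq, eventually_map]
    filter_upwards [ℰ.rep_eventually Finset.univ v p le_rfl (hcov.continuous.tendsto p)] with q hq
    rw [hhπ, hR, hq]
  have hsm : ContMDiff (𝓡 2) 𝓘(ℝ, ℂ) ∞ h := fun x => by
    obtain ⟨p, rfl⟩ := hπ.surjective x
    refine ContMDiffAt.congr_of_eventuallyEq ?_ (hloc p)
    exact ((contDiff_id.pow n).contMDiff.comp (hRs p)).contMDiffAt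
  have hγz : ∀ z, h (γ z) ≠ 0 := fun z hz => by
    obtain ⟨p, hp⟩ := hπ.surjective (γ z)
    rw [← hp, hhπ] at hz
    exact (hv p (pow_eq_zero_iff hn0.ne' |>.1 hz)).1 ⟨z, hp.symm⟩
  obtain ⟨N, hN⟩ := 𝒞.exists_winding_eq hγ hsep hsm hn0 (fun x hx => by
    obtain ⟨p, rfl⟩ := hπ.surjective x
    rw [hhπ] at hx
    obtain ⟨-, j, hj, hdet⟩ := hv p (pow_eq_zero_iff hn0.ne' |>.1 hx)
    exact ⟨j, R p, hj, hRs p, hloc p, hdet⟩) hγz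
  obtain ⟨Φ, hΦ, hΦact⟩ := hg
  set Γ : unitInterval → P := fun τ => (Φ (CircleBundle.mk g (τ, 1))).1.2 with hΓ
  have hΓc : Continuous Γ := by
    have h1 : Continuous fun τ : unitInterval => CircleBundle.mk g (τ, (1 : G)) :=
      continuous_quot_mk.comp (Continuous.prodMk_left (1 : G))
    exact (continuous_snd.comp continuous_subtype_val).comp (Φ.continuous.comp h1)
  have hΓπ : ∀ τ, π (Γ τ) = γ (Circle.exp (2 * Real.pi * τ)) := fun τ => by
    have h1 := (Φ (CircleBundle.mk g (τ, 1))).2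
    rw [hΦ] at h1
    exact h1.symm
  have hΓg : Γ 0 = Γ 1 <• g := by
    have h1 : CircleBundle.mk g (0, 1) = CircleBundle.mk g (1, 1) <• g :=
      (Quot.sound ⟨1, rfl, rfl⟩ : CircleBundle.mk g (0, 1) = CircleBundle.mk g (1, g * 1)).trans
        (congrArg (fun k => CircleBundle.mk g (1, k)) (by simp))
    have h2 := hΦact (CircleBundle.mk g (1, 1)) g
    rw [← h1] at h2
    exact congrArg Prod.snd h2
  have hpi := Real.two_pi_pos
  set q : ℝ → P := fun τ => Γ (projIcc 0 1 zero_le_one (τ / (2 * Real.pi))) with hq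
  have hqc : Continuous q := hΓc.comp (continuous_projIcc.comp (continuous_id.div_const _))
  have hqπ : ∀ τ ∈ Icc 0 (2 * Real.pi), π (q τ) = γ (Circle.exp τ) := fun τ hτ => by
    have h1 : τ / (2 * Real.pi) ∈ Icc (0 : ℝ) 1 :=
      ⟨div_nonneg hτ.1 hpi.le, (div_le_one hpi).2 hτ.2⟩
    simp only [hq, projIcc_of_mem zero_le_one h1]
    rw [hΓπ]
    congr 2
    field_simp
  set F : ℝ → ℂ := fun τ => R (q τ) (π (q τ)) with hF
  set H : ℝ → ℂ := fun τ => h (γ (Circle.exp τ)) with hH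
  have hF' : ∀ τ ∈ Icc 0 (2 * Real.pi), HasDerivWithinAt F (deriv H τ / (n * H τ) * F τ)
      (Icc 0 (2 * Real.pi)) τ := by
    intro τ hτ
    -- Freezing the point of `P` at `q τ` gives a smooth function that agrees with `F` near `τ`
    -- within the interval.
    set φ : ℝ → ℂ := fun τ' => R (q τ) (γ (Circle.exp τ')) with hφ
    have hφd : HasDerivAt φ (deriv φ τ) τ :=
      ((hγ.contDiff_comp (hRs (q τ))).differentiable (by simp) τ).hasDerivAt
    have hFφ : F =ᶠ[𝓝[Icc 0 (2 * Real.pi)] τ] φ := by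
      have h1 := ℰ.rep_eventually Finset.univ v (q τ) le_rfl (hcov.continuous.tendsto (q τ))
      filter_upwards [((hqc.tendsto τ).mono_left nhdsWithin_le_nhds).eventually h1,
        self_mem_nhdsWithin] with τ' hτ' hmem
      simp only [hF, hφ, ← hqπ τ' hmem]
      exact hτ'
    have hHφ : H =ᶠ[𝓝 τ] fun τ' => φ τ' ^ n := by
      have h1 := hloc (q τ)
      rw [hqπ τ hτ] at h1
      exact (hγc.continuousAt (x := τ)).eventually h1
    have hdH : deriv H τ = n * φ τ ^ (n - 1) * deriv φ τ := by
      rw [hHφ.deriv_eq]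
      exact (hφd.fun_pow n).deriv
    have hφ0 : φ τ ≠ 0 := fun h0 => hγz (Circle.exp τ) (by
      have := hHφ.eq_of_nhds
      rw [h0, zero_pow hn0.ne'] at this
      exact this)
    have hval : deriv H τ / (n * H τ) * F τ = deriv φ τ := by
      rw [hdH, hHφ.eq_of_nhds, hFφ.eq_of_nhdsWithin hτ]
      have hnC : (n : ℂ) ≠ 0 := Nat.cast_ne_zero.2 hn0.ne'
      have hpow : φ τ ^ n = φ τ ^ (n - 1) * φ τ := by
        rw [← pow_succ, Nat.sub_add_cancel hn0]
      rw [hpow]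
      field_simp
    rw [hval]
    exact hφd.hasDerivWithinAt.congr_of_eventuallyEq hFφ (hFφ.eq_of_nhdsWithin hτ)
  -- The gluing relation `Γ 0 = Γ 1 <• g` read through equivariance; it gives `χ g = 1` once the
  -- values of `F` at the two ends are known to agree.
  have hF0 : F 0 = χ g * F (2 * Real.pi) := by
    have h0 : q 0 = Γ 0 := by simp [hq]
    have h1 : q (2 * Real.pi) = Γ 1 := by simp [hq]
    simp only [hF, h0, h1, hΓg]
    exact hact _ _
  have hFne : F 0 ≠ 0 := fun h0 => by
    refine hγz (Circle.exp 0) ?_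
    rw [← hqπ 0 ⟨le_rfl, hpi.le⟩, hhπ]
    have h0 : R (q 0) (π (q 0)) = 0 := h0
    rw [h0, zero_pow hn0.ne']
  have hχ1 : ‖χ g‖ = 1 := Complex.norm_eq_one_of_pow_eq_one (hχ g) hn0.ne'
  have hend := eq_of_winding ((hγ.contDiff_comp hsm).of_le (by simp)) (fun τ => hγz _) hn0
    hpi.le (fun τ hτ => (hF' τ hτ).continuousWithinAt) hF' hFne
    (by rw [hF0, norm_mul, hχ1, one_mul]) hN
  rw [hend] at hF0
  exact (mul_eq_right₀ hFne).1 hF0.symm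

end IsPrincipalBundle

/-- The field `ℂ` has enough roots of unity for the characters of a finite abelian group, here the
abelianization, to separate its points. -/
theorem mem_commutator_of_forall_map_eq_one {G : Type*} [Group G] [Finite G] {g : G}
    (hg : ∀ χ : G →* ℂ, χ g = 1) : g ∈ commutator G := by
  rw [← Abelianization.ker_of, MonoidHom.mem_ker]
  by_contra hne
  obtain ⟨φ, hφ⟩ := CommGroup.exists_apply_ne_one_of_hasEnoughRootsOfUnity (Abelianization G) ℂ hne
  exact hφ (Units.ext (hg ((Units.coeHom ℂ).comp (φ.comp Abelianization.of))))

end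

theorem mainTheorem12 {G : Type*} [Group G] [Finite G] [TopologicalSpace G] [DiscreteTopology G]
    {S : Type*} [TopologicalSpace S] [ChartedSpace (EuclideanSpace ℝ (Fin 2)) S]
    [IsManifold (𝓡 2) ∞ S] [T2Space S] [CompactSpace S] [ConnectedSpace S]
    (_orientation : SmoothOrientation S)
    {P : Type*} [TopologicalSpace P] [ChartedSpace (EuclideanSpace ℝ (Fin 2)) P]
    [IsManifold (𝓡 2) ∞ P] [MulAction Gᵐᵒᵖ P]
    (π : P → S) (_hπ : IsGCobordism G π)
    (γ : Circle → S) (_hγ : IsEmbeddedClosedCurve γ) (_hsep : IsSeparatingCurve γ) :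
    (∃ g : G, HasMonodromy π γ g) ∧ ∀ g : G, HasMonodromy π γ g → g ∈ commutator G := by
  refine ⟨_hπ.toIsPrincipalBundle.exists_hasMonodromy _hγ.isEmbedding.continuous, fun g hg => ?_⟩
  exact mem_commutator_of_forall_map_eq_one fun χ =>
    _hπ.toIsPrincipalBundle.map_eq_one_of_hasMonodromy _orientation _hγ _hsep χ hg
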